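/- Let $V$ be a finite-dimensional real inner product space of dimension $r$, and let $W$ be a finite group of linear isometries of $V$ generated by orthogonal reflections in hyperplanes. Let $\mathcal{A}$ be its reflection arrangement, i.e. the set of all linear hyperplanes $H \subset V$ such that the orthogonal reflection in $H$ lies in $W$, and assume that $\mathcal{A}$ is essential, i.e. $\bigcap_{H \in \mathcal{A}} H = \{0\}$. Fix a chamber of $\mathcal{A}$, let $S \subset W$ be the set of reflections in its walls, let $\ell$ be the word length on $W$ with respect to $S$, and put $\mathrm{Des}(w) = \{ s \in S : \ell(ws) < \ell(w) \}$ for $w \in W$. For $T \subseteq S$ let $Y_T = \sum_{w \in W,\ \mathrm{Des}(w) \subseteq T} w \in \mathbb{R}W$, and let $$\mathbf{s} = \sum_{s \in S} Y_{\{s\}} \in \mathbb{R}W$$ be the Barr element. (i) The element $\mathbf{s}$ acts semisimply on $\mathbb{R}W$, with real eigenvalues: for left multiplication by $\mathbf{s}$, and likewise for right multiplication by $\mathbf{s}$, the space $\mathbb{R}W$ is the sum of the eigenspaces. (ii) Suppose that $W$ is coincidental, i.e. $(W,S)$ is of type $A_n$ $(n \ge 1)$, $B_n$ $(n \ge 2)$,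 $H_3$ or $I_2(m)$ $(m \ge 3)$. Then there are integers $0 \le \sigma_0 < \sigma_1 < \dots < \sigma_r$ such that the set of eigenvalues of $\mathbf{s}$ on $\mathbb{R}W$ (for left multiplication and for right multiplication) is exactly $\{\sigma_0, \dots, \sigma_r\}$, and such that for every $0 \le k \le r$ and every flat $X$ of $\mathcal{A}$ (intersection of hyperplanes of $\mathcal{A}$, with $V$ included as the empty intersection) of dimension $k$, the number of rays (one-dimensional faces) of the restricted arrangement $\mathcal{A}^X = \{ H \cap X : H \in \mathcal{A},\ X \not\subseteq H \}$ in $X$ is $\sigma_k$. -/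

import Mathlib

noncomputable section

/-! ### Hyperplane arrangements

A (central) arrangement in a real vector space `E` is a set `A` of linear hyperplanes of `E`. -/

namespace Arrangement

variable {E : Type*} [AddCommGroup E] [Module ℝ E]

/-- A flat of `A` is an intersection of some of the hyperplanes of `A`; the empty intersection
is the whole space. -/
def IsFlat (A : Set (Submodule ℝ E)) (X : Submodule ℝ E) : Prop :=
  ∃ B ⊆ A, X = sInf B

/-- The restriction of `A` to `X`: the arrangement in the vector space `X` of all `H ∩ X`,
for the hyperplanes `H` in `A` which do not contain `X`. -/
def restriction (A : Set (Submodule ℝ E)) (X : Submodule ℝ E) : Set (Submodule ℝ X) :=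
  {K | ∃ H ∈ A, ¬ X ≤ H ∧ K = H.comap X.subtype}

/-- `s` is one of the two closed half-spaces bounded by the hyperplane `H`. -/
def IsClosedHalfSpace (H : Submodule ℝ E) (s : Set E) : Prop :=
  ∃ f : E →ₗ[ℝ] ℝ, LinearMap.ker f = H ∧ s = {x | 0 ≤ f x}

/-- A face of `A` is an intersection which has, for each hyperplane `H` of `A`, one term: either
`H` itself or one of the two closed half-spaces bounded by `H`. -/
def IsFace (A : Set (Submodule ℝ E)) (F : Set E) : Prop :=
  ∃ t : Submodule ℝ E → Set E,
    (∀ H ∈ A, t H = (H : Set E) ∨ IsClosedHalfSpace H (t H)) ∧ F = ⋂ H ∈ A, t H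

/-- The support of `F`: the smallest flat of `A` which contains `F`. -/
def support (A : Set (Submodule ℝ E)) (F : Set E) : Submodule ℝ E :=
  sInf {X | IsFlat A X ∧ F ⊆ X}

/-- The dimension of a face is the dimension of its support. -/
def faceDim (A : Set (Submodule ℝ E)) (F : Set E) : ℕ :=
  Module.finrank ℝ (support A F)

/-- The number of rays (one-dimensional faces) of `A`. -/
def numRays (A : Set (Submodule ℝ E)) : ℕ :=
  {F | IsFace A F ∧ faceDim A F = 1}.ncard

/-- A (closed) chamber of `A` is a face whose support is the whole space. -/
def IsChamber (A : Set (Submodule ℝ E)) (C : Set E) : Prop :=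
  IsFace A C ∧ support A C = ⊤

/-- `H` is a wall of the chamber `C`: the hyperplane `H` of `A` is the support of a face of `A`
which is contained in `C`. -/
def IsWall (A : Set (Submodule ℝ E)) (C : Set E) (H : Submodule ℝ E) : Prop :=
  H ∈ A ∧ ∃ F, IsFace A F ∧ F ⊆ C ∧ support A F = H

end Arrangement

/-! ### Finite reflection groups and descents -/

namespace ReflectionGroup

variable {V : Type*} [NormedAddCommGroup V] [InnerProductSpace ℝ V] [FiniteDimensional ℝ V]

/-- The reflection arrangement of `W`: all linear hyperplanes `H` such that the orthogonal
reflection in `H` belongs to `W`. -/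
def arrangement (W : Subgroup (V ≃ₗᵢ[ℝ] V)) : Set (Submodule ℝ V) :=
  {H | Module.finrank ℝ H + 1 = Module.finrank ℝ V ∧ H.reflection ∈ W}

/-- `W` is generated by orthogonal reflections in hyperplanes. -/
def IsReflectionGroup (W : Subgroup (V ≃ₗᵢ[ℝ] V)) : Prop :=
  Subgroup.closure {t | ∃ H ∈ arrangement W, t = H.reflection} = W

/-- `W` is essential: its reflecting hyperplanes intersect in the origin only. -/
def IsEssential (W : Subgroup (V ≃ₗᵢ[ℝ] V)) : Prop :=
  sInf (arrangement W) = ⊥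

/-- The Coxeter generators of `W` determined by the fundamental chamber `C`: the reflections in
the walls of `C`. -/
def coxeterGenerators (W : Subgroup (V ≃ₗᵢ[ℝ] V)) (C : Set V) : Set W :=
  {s | ∃ H, Arrangement.IsWall (arrangement W) C H ∧ (s : V ≃ₗᵢ[ℝ] V) = H.reflection}

end ReflectionGroup

section Descents

variable {G : Type*} [Group G]

/-- The length of `w` in the generating set `S` (consisting of involutions): the least number of
factors in an expression of `w` as a product of elements of `S`. -/
def wordLength (S : Set G) (w : G) : ℕ :=
  sInf {n | ∃ l : List G, l.length = n ∧ (∀ s ∈ l, s ∈ S) ∧ l.prod = w}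

/-- The descent set of `w` with respect to `S`. -/
def descentSet (S : Set G) (w : G) : Set G :=
  {s | s ∈ S ∧ wordLength S (w * s) < wordLength S w}

open Classical in
/-- `Y_T`, the sum in the real group algebra of all `w` with `Des(w) ⊆ T`. -/
def descentSum [Fintype G] (S T : Set G) : MonoidAlgebra ℝ G :=
  ∑ w : G with descentSet S w ⊆ T, MonoidAlgebra.of ℝ G w

open Classical in
/-- The Barr element `∑_{s ∈ S} Y_{{s}}`. -/
def barrElement [Fintype G] (S : Set G) : MonoidAlgebra ℝ G :=
  ∑ s : G with s ∈ S, descentSum S {s}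

end Descents

/-- A Coxeter system with generators `S` has the type of the Coxeter matrix `M`: the generators
can be labelled by the index set of `M` so that `M i j` is the order of the product of the `i`-th
and the `j`-th generator. -/
def HasCoxeterType {G B : Type*} [Group G] (S : Set G) (M : CoxeterMatrix B) : Prop :=
  ∃ e : B ≃ S, ∀ i j, orderOf ((e i : G) * (e j : G)) = M i j

/-- Coincidental type: `A_n` with `n ≥ 1` (the symmetric groups `S_{n+1}`), `B_n` with `n ≥ 2`
(the hyperoctahedral groups), `H_3`, or the dihedral type `I_2(m)` with `m ≥ 3`.
`CoxeterMatrix.I k` is the matrix of type `I_2(k + 2)`. -/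
def IsCoincidentalType {G : Type*} [Group G] (S : Set G) : Prop :=
  (∃ n, 1 ≤ n ∧ HasCoxeterType S (CoxeterMatrix.A n)) ∨
  (∃ n, 2 ≤ n ∧ HasCoxeterType S (CoxeterMatrix.B n)) ∨
  HasCoxeterType S CoxeterMatrix.H₃ ∨
  (∃ k, 1 ≤ k ∧ HasCoxeterType S (CoxeterMatrix.I k))

/-- An endomorphism of a real vector space is semisimple with real eigenvalues: the space is the
sum of its eigenspaces. -/
def IsRealSemisimple {M : Type*} [AddCommGroup M] [Module ℝ M] (f : Module.End ℝ M) : Prop :=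
  ⨆ μ : ℝ, f.eigenspace μ = ⊤

end

/-! Encode a face of the reflection arrangement by the signs of all roots. Faces form a monoid: `F *
G` is the face reached from a point of `F` by a small step towards `G`. It is a left regular band,
`x * y * x = x * y`. Let `p` be a point inside the fundamental chamber. The chambers are those of
the points `w p`, one for each `w` in `W`, and they are stable under left multiplication.

Relative to a chamber `w`, every ray is `w u ω` for exactly one pair of a fundamental weight `ω`,
attached to a simple reflection `s`, and an element `u` with descents in `{s}`; the ray times the
chamber `w` is the chamber `w u`. So on chambers, left multiplication by the sum of all rays is
right multiplication by the Barr element (`sum_rayFaces_mul_chamberMap`). The face algebra acts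
faithfully on chambers (`eq_zero_of_mul_chamber_eq_zero`), hence the two elements satisfy the same
polynomials.

In a left regular band, a sum over a finite set `R` is killed by the product of the `X - j`, where
`j` runs over the numbers of elements of `R` that fix some `G` from the right
(`aeval_sum_of_leftRegularBand`); characters show that each such `j` is a root of every annihilating
polynomial (`eval_fixCount_eq_zero`). Distinct linear factors give semisimplicity on both sides, and
the `j` are the eigenvalues. For the rays, the number attached to `G` is the number of rays in the
flat that supports `G` (`fixCount_rayFaces`).

Part (ii) is thereby reduced to the claim that the number of rays in a flat depends only on its
dimension; strict growth comes from a flag of flats. In types A and B, suitable coordinates turn the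
hyperplanes into the kernels of all `y i` and `y i - ε * y j`, with `ε` in `{1}` or `{1, -1}`. Every
flat has coordinates in which the restriction has the same shape, so only their number matters
(`rayCount_eq_of_finrank_eq`). In rank at most three only planes in rank three need an argument, and
in type H₃ all reflecting hyperplanes are conjugate. -/

noncomputable section

set_option linter.unusedSectionVars false

/-! ### Roots, positivity and simple roots -/

namespace ReflectionGroup

open scoped RealInnerProductSpace

variable {V : Type*} [NormedAddCommGroup V] [InnerProductSpace ℝ V] [FiniteDimensional ℝ V]

/-- The reflection in the hyperplane orthogonal to `a`. -/
abbrev refl (a : V) : V ≃ₗᵢ[ℝ] V := (ℝ ∙ a)ᗮ.reflection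

lemma refl_apply {a : V} (ha : ‖a‖ = 1) (x : V) : refl a x = x - (2 * ⟪a, x⟫) • a := by
  rw [Submodule.reflection_orthogonal_apply, Submodule.reflection_singleton_apply]
  simp only [ha, RCLike.ofReal_real_eq_id, id, one_pow, div_one]
  module

lemma mul_map (f g : V ≃ₗᵢ[ℝ] V) (x : V) : (f * g) x = f (g x) := rfl

lemma inner_refl (a x y : V) : ⟪refl a x, y⟫ = ⟪x, refl a y⟫ := by
  conv_lhs => rw [← Submodule.reflection_reflection (ℝ ∙ a)ᗮ y]
  exact LinearIsometryEquiv.inner_map_map _ _ _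

lemma refl_neg (a : V) : refl (-a) = refl a := by
  have : (ℝ ∙ (-a)) = ℝ ∙ a := by
    rw [← Set.neg_singleton, Submodule.span_neg]
  simp only [refl, this]

lemma refl_map (w : V ≃ₗᵢ[ℝ] V) {a : V} (ha : ‖a‖ = 1) : refl (w a) = w * refl a * w⁻¹ := by
  ext x
  have hx : ⟪w a, x⟫ = ⟪a, w⁻¹ x⟫ := by
    conv_lhs => rw [← LinearIsometryEquiv.apply_symm_apply w x]
    exact LinearIsometryEquiv.inner_map_map _ _ _
  have h2 : w (w⁻¹ x) = x := LinearIsometryEquiv.apply_symm_apply w x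
  rw [refl_apply (by simpa using ha), mul_map, mul_map,
    refl_apply ha, map_sub, map_smul, h2, hx]

lemma refl_mul_self (a : V) : refl a * refl a = 1 := Submodule.reflection_mul_reflection _

lemma eq_or_eq_neg_of_mem_span {a b : V} (ha : ‖a‖ = 1) (hb : ‖b‖ = 1) (h : b ∈ ℝ ∙ a) :
    b = a ∨ b = -a := by
  obtain ⟨c, rfl⟩ := Submodule.mem_span_singleton.1 h
  rw [norm_smul, ha, mul_one, Real.norm_eq_abs] at hb
  rcases abs_eq_abs.1 (hb.trans (abs_one).symm) with rfl | rfl <;> simp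

lemma eq_or_eq_neg_of_inner {a b : V} (ha : ‖a‖ = 1) (hb : ‖b‖ = 1)
    (h : ∀ x, ⟪a, x⟫ = 0 → ⟪b, x⟫ = 0) : b = a ∨ b = -a := by
  apply eq_or_eq_neg_of_mem_span ha hb
  have h1 : ⟪a, b - ⟪a, b⟫ • a⟫ = 0 := by
    rw [inner_sub_right, inner_smul_right, real_inner_self_eq_norm_sq, ha]; ring
  have h2 := h _ h1
  have h3 : b - ⟪a, b⟫ • a = 0 := by
    rw [← inner_self_eq_zero (𝕜 := ℝ), inner_sub_left, inner_smul_left, h1, h2]; simp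
  rw [sub_eq_zero.1 h3]
  exact Submodule.smul_mem _ _ (Submodule.mem_span_singleton_self a)

lemma eq_or_eq_neg_of_refl_eq {a b : V} (ha : ‖a‖ = 1) (hb : ‖b‖ = 1) (h : refl a = refl b) :
    b = a ∨ b = -a := by
  apply eq_or_eq_neg_of_inner ha hb
  intro x hx
  have h1 : refl b x = x := by rw [← h, refl_apply ha, hx]; simp
  rw [refl_apply hb] at h1
  have h2 : (2 * ⟪b, x⟫) • b = 0 := by simpa using h1
  have hb0 : b ≠ 0 := by rintro rfl; simp at hb
  simpa [hb0] using h2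

/-- The unit normals of the reflecting hyperplanes of `W`. -/
def roots (W : Subgroup (V ≃ₗᵢ[ℝ] V)) : Set V := {a | ‖a‖ = 1 ∧ refl a ∈ W}

variable {W : Subgroup (V ≃ₗᵢ[ℝ] V)} {p : V}

lemma roots_finite (W : Subgroup (V ≃ₗᵢ[ℝ] V)) [Finite W] : (roots W).Finite := by
  have hW : (W : Set (V ≃ₗᵢ[ℝ] V)).Finite := Set.toFinite _
  have hfin : (refl '' roots W).Finite := hW.subset (by rintro _ ⟨a, ha, rfl⟩; exact ha.2)
  refine Set.Finite.of_finite_fibers refl hfin ?_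
  rintro _ ⟨a, ha, rfl⟩
  refine (Set.toFinite {a, -a}).subset ?_
  rintro b ⟨hb, hab⟩
  exact eq_or_eq_neg_of_refl_eq ha.1 hb.1 (Eq.symm hab)

lemma neg_mem_roots {a : V} (ha : a ∈ roots W) : -a ∈ roots W :=
  ⟨by simpa using ha.1, by rw [refl_neg]; exact ha.2⟩

lemma map_mem_roots {w : V ≃ₗᵢ[ℝ] V} (hw : w ∈ W) {a : V} (ha : a ∈ roots W) : w a ∈ roots W :=
  ⟨by simpa using ha.1, by
    rw [refl_map w ha.1]; exact W.mul_mem (W.mul_mem hw ha.2) (W.inv_mem hw)⟩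

lemma inner_map_eq (w : V ≃ₗᵢ[ℝ] V) (a x : V) : ⟪w a, x⟫ = ⟪a, w⁻¹ x⟫ := by
  conv_lhs => rw [← LinearIsometryEquiv.apply_symm_apply w x]
  exact LinearIsometryEquiv.inner_map_map _ _ _

lemma mem_arrangement_iff {H : Submodule ℝ V} :
    H ∈ arrangement W ↔ ∃ a ∈ roots W, H = (ℝ ∙ a)ᗮ := by
  constructor
  · rintro ⟨h1, h2⟩
    have h3 : Module.finrank ℝ Hᗮ = 1 := by
      have := Submodule.finrank_add_finrank_orthogonal H
      omega
    obtain ⟨v, hv, hspan⟩ := finrank_eq_one_iff'.1 h3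
    have hv' : (v : V) ≠ 0 := by simpa using hv
    have hle : Hᗮ = ℝ ∙ (v : V) := by
      apply le_antisymm
      · intro x hx
        obtain ⟨c, hc⟩ := hspan ⟨x, hx⟩
        exact Submodule.mem_span_singleton.2 ⟨c, congrArg Subtype.val hc⟩
      · rw [Submodule.span_singleton_le_iff_mem]; exact v.2
    have hspan' : (ℝ ∙ (‖(v : V)‖⁻¹ • (v : V))) = ℝ ∙ (v : V) :=
      Submodule.span_singleton_smul_eq (IsUnit.mk0 _ (by simpa using hv')) _
    have hH : H = (ℝ ∙ (‖(v : V)‖⁻¹ • (v : V)))ᗮ := by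
      rw [hspan', ← hle, Submodule.orthogonal_orthogonal]
    refine ⟨_, ⟨?_, ?_⟩, hH⟩
    · rw [norm_smul, norm_inv, norm_norm, inv_mul_cancel₀ (by simpa using hv')]
    · rw [refl]; simp only [← hH]; exact h2
  · rintro ⟨a, ha, rfl⟩
    refine ⟨?_, ha.2⟩
    have h0 : a ≠ 0 := by rintro rfl; simpa using ha.1
    have := Submodule.finrank_add_finrank_orthogonal (ℝ ∙ a)
    rw [finrank_span_singleton h0] at this
    omega

lemma mem_orthogonal_singleton {a x : V} : x ∈ (ℝ ∙ a)ᗮ ↔ ⟪a, x⟫ = 0 :=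
  Submodule.mem_orthogonal_singleton_iff_inner_right

/-- `W` is a finite essential reflection group and `p` is on none of its hyperplanes. -/
structure IsRegularPoint (W : Subgroup (V ≃ₗᵢ[ℝ] V)) (p : V) : Prop where
  finite : Finite W
  gen : IsReflectionGroup W
  ess : IsEssential W
  ne_zero : ∀ a ∈ roots W, ⟪a, p⟫ ≠ 0

/-- The unit normals, positive at `p`, of the walls of the chamber of `p`. -/
def simpleRoots (W : Subgroup (V ≃ₗᵢ[ℝ] V)) (p : V) : Set V :=
  {a | a ∈ roots W ∧ 0 < ⟪a, p⟫ ∧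
    ∃ x, ⟪a, x⟫ = 0 ∧ ∀ b ∈ roots W, 0 < ⟪b, p⟫ → b ≠ a → 0 < ⟪b, x⟫}

namespace IsRegularPoint

variable (h : IsRegularPoint W p)
include h

lemma eq_zero_of_roots {x : V} (hx : ∀ a ∈ roots W, ⟪a, x⟫ = 0) : x = 0 := by
  have : x ∈ sInf (arrangement W) := by
    rw [Submodule.mem_sInf]
    intro H hH
    obtain ⟨a, ha, rfl⟩ := mem_arrangement_iff.1 hH
    exact mem_orthogonal_singleton.2 (hx a ha)
  rw [h.ess] at this
  simpa using this

lemma pos_or_neg {a : V} (ha : a ∈ roots W) : 0 < ⟪a, p⟫ ∨ 0 < ⟪-a, p⟫ := by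
  rw [inner_neg_left]
  rcases lt_or_gt_of_ne (h.ne_zero a ha) with h | h
  · right; linarith
  · left; exact h

/-- The closed chamber of `p` is cut out by the simple roots. -/
lemma nonneg_of_simple {x : V} (hx : ∀ a ∈ simpleRoots W p, 0 ≤ ⟪a, x⟫) {b : V} (hb : b ∈ roots W)
    (hbp : 0 < ⟪b, p⟫) : 0 ≤ ⟪b, x⟫ := by
  have := h.finite
  have hfin : {b ∈ roots W | 0 < ⟪b, p⟫}.Finite := (roots_finite W).subset (Set.sep_subset _ _)
  -- Take a minimal set `B` of positive roots that still cuts out the closed chamber; each member of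
  -- `B` turns out to be simple.
  have hP : {B : Set V | B ⊆ {b ∈ roots W | 0 < ⟪b, p⟫} ∧ ∀ y, (∀ b ∈ B, 0 ≤ ⟪b, y⟫) →
      ∀ b ∈ roots W, 0 < ⟪b, p⟫ → 0 ≤ ⟪b, y⟫}.Finite :=
    hfin.finite_subsets.subset fun B hB => hB.1
  obtain ⟨B, hB⟩ := hP.exists_minimal ⟨_, subset_rfl, fun y hy b hb hbp => hy b ⟨hb, hbp⟩⟩
  refine hB.prop.2 x (fun a ha => hx a ?_) b hb hbp
  obtain ⟨haR, hap⟩ := hB.prop.1 ha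
  refine ⟨haR, hap, ?_⟩
  have hnot : ¬ ∀ y, (∀ b ∈ B \ {a}, 0 ≤ ⟪b, y⟫) → ∀ b ∈ roots W, 0 < ⟪b, p⟫ → 0 ≤ ⟪b, y⟫ := by
    intro hall
    have := hB.le_of_le ⟨Set.sdiff_subset.trans hB.prop.1, hall⟩ Set.sdiff_subset ha
    exact this.2 rfl
  push Not at hnot
  obtain ⟨y, hy, c, hc, hcp, hcy⟩ := hnot
  have hay : ⟪a, y⟫ < 0 := by
    by_contra! hay
    refine absurd (hB.prop.2 y (fun b hb => ?_) c hc hcp) (not_le.2 hcy)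
    by_cases hba : b = a
    · rwa [hba]
    · exact hy b ⟨hb, hba⟩
  -- Up to a positive factor, `q` is the point where the segment from `p` to `y` meets the
  -- hyperplane of `a`. It is strictly positive on the rest of `B`, so it is the candidate for an
  -- interior point of the wall.
  set q := ⟪a, p⟫ • y - ⟪a, y⟫ • p with hq
  have hqi : ∀ b, ⟪b, q⟫ = ⟪a, p⟫ * ⟪b, y⟫ - ⟪a, y⟫ * ⟪b, p⟫ := by
    intro b; rw [hq, inner_sub_right, inner_smul_right, inner_smul_right]
  have hqa : ⟪a, q⟫ = 0 := by rw [hqi]; ring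
  have hqB : ∀ b ∈ B, b ≠ a → 0 < ⟪b, q⟫ := by
    intro b hb hba
    rw [hqi]
    nlinarith [mul_nonneg hap.le (hy b ⟨hb, hba⟩), mul_pos (neg_pos.2 hay) (hB.prop.1 hb).2]
  refine ⟨q, hqa, fun b hb hbp hba => ?_⟩
  by_contra! hneg
  -- If `b` were not positive at `q`, a small step from `q` against the projection `z` of `b` to the
  -- hyperplane of `a` would preserve all inequalities of `B` and make `b` negative.
  set z := b - ⟪a, b⟫ • a with hz
  have haa : ⟪a, a⟫ = 1 := by rw [real_inner_self_eq_norm_sq, haR.1]; norm_num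
  have hbb : ⟪b, b⟫ = 1 := by rw [real_inner_self_eq_norm_sq, hb.1]; norm_num
  have haz : ⟪a, z⟫ = 0 := by rw [hz, inner_sub_right, inner_smul_right, haa]; ring
  have hz0 : z ≠ 0 := by
    intro h0
    have : b ∈ ℝ ∙ a := by
      rw [sub_eq_zero.1 h0]; exact Submodule.smul_mem _ _ (Submodule.mem_span_singleton_self a)
    rcases eq_or_eq_neg_of_mem_span haR.1 hb.1 this with h1 | h1
    · exact hba h1
    · rw [h1, inner_neg_left] at hbp; linarith
  have hbz : 0 < ⟪b, z⟫ := by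
    have : ⟪b, z⟫ = ⟪z, z⟫ := by
      conv_rhs => rw [hz, inner_sub_left, inner_smul_left, ← hz, haz]
      simp
    rw [this]; exact real_inner_self_pos.2 hz0
  have hev : ∀ᶠ ε : ℝ in nhdsWithin 0 (Set.Ioi 0), ∀ c ∈ B, 0 ≤ ⟪c, q - ε • z⟫ := by
    rw [Filter.eventually_all_finite (hfin.subset hB.prop.1)]
    intro c hc
    by_cases hca : c = a
    · refine Filter.Eventually.of_forall fun ε => ?_
      rw [hca, inner_sub_right, inner_smul_right, haz, hqa]; simp
    · have ht : Filter.Tendsto (fun ε : ℝ => ⟪c, q - ε • z⟫) (nhds 0)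
          (nhds ⟪c, q - (0 : ℝ) • z⟫) := by
        apply Continuous.tendsto; fun_prop
      rw [zero_smul, sub_zero] at ht
      exact ((ht.eventually (lt_mem_nhds (hqB c hc hca))).filter_mono nhdsWithin_le_nhds).mono
        fun ε h => h.le
  obtain ⟨ε, hε, hε0⟩ := (hev.and self_mem_nhdsWithin).exists
  have := hB.prop.2 _ hε b hb hbp
  rw [inner_sub_right, inner_smul_right] at this
  nlinarith [mul_pos (show (0:ℝ) < ε from hε0) hbz]

/-- Take interior points `x` and `y` of the walls of `a` and `c`. With a positive inner product, the
root `refl a c` would be positive at `x` and negative at `y`, but a root has a constant weak sign on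
the closed chamber. -/
lemma inner_simple_nonpos {a c : V} (ha : a ∈ simpleRoots W p) (hc : c ∈ simpleRoots W p)
    (hac : a ≠ c) : ⟪a, c⟫ ≤ 0 := by
  by_contra! hpos
  obtain ⟨haR, hap, x, hax, hx⟩ := ha
  obtain ⟨hcR, hcp, y, hcy, hy⟩ := hc
  have hγ : refl a c ∈ roots W := map_mem_roots haR.2 hcR
  have hγi : ∀ z, ⟪refl a c, z⟫ = ⟪c, z⟫ - 2 * ⟪a, c⟫ * ⟪a, z⟫ := by
    intro z; rw [refl_apply haR.1, inner_sub_left, inner_smul_left]; simp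
  rcases h.pos_or_neg hγ with h1 | h1
  · have h2 : 0 < ⟪a, y⟫ := hy a haR hap hac
    by_cases he : refl a c = c
    · have := hγi y
      rw [he] at this; nlinarith [mul_pos hpos h2]
    · have := hy _ hγ h1 he
      rw [hγi, hcy] at this; nlinarith [mul_pos hpos h2]
  · have h2 : 0 < ⟪c, x⟫ := hx c hcR hcp hac.symm
    have h3 : ⟪-refl a c, x⟫ = -⟪c, x⟫ := by rw [inner_neg_left, hγi, hax]; ring
    by_cases he : -refl a c = a
    · rw [he, hax] at h3; linarith
    · have := hx _ (neg_mem_roots hγ) h1 he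
      linarith

/-- The reflection fixes an interior point `x` of the wall of `a`, so `refl a b` is positive at `x`
as `b` is, and a negative root cannot be. -/
lemma refl_pos {a b : V} (ha : a ∈ simpleRoots W p) (hb : b ∈ roots W) (hbp : 0 < ⟪b, p⟫)
    (hba : b ≠ a) : 0 < ⟪refl a b, p⟫ := by
  obtain ⟨haR, hap, x, hax, hx⟩ := ha
  have hr : ⟪refl a b, x⟫ = ⟪b, x⟫ := by
    rw [inner_refl, refl_apply haR.1, hax]; simp
  have h1 := hx b hb hbp hba
  rcases h.pos_or_neg (map_mem_roots haR.2 hb) with h2 | h2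
  · exact h2
  · exfalso
    by_cases he : -refl a b = a
    · rw [← neg_eq_iff_eq_neg.2 he.symm] at hr
      rw [inner_neg_left, hax] at hr; linarith
    · have := hx _ (neg_mem_roots (map_mem_roots haR.2 hb)) h2 he
      rw [inner_neg_left] at this; linarith

lemma eq_zero_of_simple {x : V} (hx : ∀ a ∈ simpleRoots W p, ⟪a, x⟫ = 0) : x = 0 := by
  apply h.eq_zero_of_roots
  have key : ∀ a ∈ roots W, 0 < ⟪a, p⟫ → ⟪a, x⟫ = 0 := by
    intro a ha hap
    have h1 := h.nonneg_of_simple (x := x) (fun c hc => (hx c hc).ge) ha hap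
    have h2 := h.nonneg_of_simple (x := -x)
      (fun c hc => by rw [inner_neg_right, hx c hc, neg_zero]) ha hap
    rw [inner_neg_right] at h2
    linarith
  intro a ha
  rcases h.pos_or_neg ha with h1 | h1
  · exact key a ha h1
  · have := key _ (neg_mem_roots ha) h1
    rw [inner_neg_left] at this; linarith

/-- Vectors in an open half-space with pairwise nonpositive inner products are independent. -/
lemma linearIndependent_simple : LinearIndependent ℝ (fun a : simpleRoots W p => (a : V)) := by
  refine LinearMap.BilinForm.linearIndependent_of_pairwise_le_zero (R := ℝ)
    (B := innerₗ V) ?_ (innerₗ V p) _ ?_ ?_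
  · intro x hx
    exact real_inner_self_pos.2 hx
  · intro a
    rw [innerₗ_apply_apply, real_inner_comm]; exact a.2.2.1
  · intro a b hab
    exact h.inner_simple_nonpos a.2 b.2 (fun e => hab (Subtype.ext e))

lemma span_simple : Submodule.span ℝ (simpleRoots W p) = ⊤ := by
  rw [← Submodule.orthogonal_eq_bot_iff, Submodule.eq_bot_iff]
  intro x hx
  exact h.eq_zero_of_simple fun a ha =>
    (Submodule.mem_orthogonal _ _).1 hx a (Submodule.subset_span ha)

lemma exists_simple_inner_pos {b : V} (hb : b ∈ roots W) (hbp : 0 < ⟪b, p⟫) :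
    ∃ a ∈ simpleRoots W p, 0 < ⟪a, b⟫ := by
  by_contra! hall
  have := h.nonneg_of_simple (x := -b)
    (fun a ha => by rw [inner_neg_right]; linarith [hall a ha]) hb hbp
  rw [inner_neg_right, real_inner_self_eq_norm_sq, hb.1] at this
  linarith

/-- Every root is conjugate to a simple root, under the group generated by simple reflections. -/
lemma exists_map_simple {b : V} (hb : b ∈ roots W) :
    ∃ w ∈ Subgroup.closure (refl '' simpleRoots W p), ∃ a ∈ simpleRoots W p, b = w a := by
  have := h.finite
  set G := Subgroup.closure (refl '' simpleRoots W p) with hG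
  have hGW : G ≤ W := by
    rw [hG, Subgroup.closure_le]; rintro _ ⟨a, ha, rfl⟩; exact ha.1.2
  have hrG : ∀ a ∈ simpleRoots W p, refl a ∈ G := fun a ha =>
    Subgroup.subset_closure (Set.mem_image_of_mem _ ha)
  have key : ∀ b ∈ roots W, 0 < ⟪b, p⟫ → ∃ w ∈ G, ∃ a ∈ simpleRoots W p, b = w a := by
    intro b hb hbp
    let O : Set V := {c | c ∈ roots W ∧ 0 < ⟪c, p⟫ ∧ ∃ w ∈ G, b = w c}
    have hO : O.Finite := (roots_finite W).subset fun c hc => hc.1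
    -- Choose a positive root in the orbit with the least height `⟪c, p⟫`. If it were not simple,
    -- some simple reflection would lower the height and keep it positive.
    obtain ⟨c, ⟨hc, hcp, w, hw, hbc⟩, hmin⟩ :=
      hO.exists_minimalFor (fun c => ⟪c, p⟫) O ⟨b, hb, hbp, 1, G.one_mem, rfl⟩
    by_cases hcs : c ∈ simpleRoots W p
    · exact ⟨w, hw, c, hcs, hbc⟩
    obtain ⟨a, ha, hac⟩ := h.exists_simple_inner_pos hc hcp
    have hne : c ≠ a := fun e => hcs (e ▸ ha)
    have hlt : ⟪refl a c, p⟫ < ⟪c, p⟫ := by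
      rw [refl_apply ha.1.1, inner_sub_left, inner_smul_left]
      have := mul_pos hac ha.2.1
      simp only [conj_trivial]
      linarith
    have := hmin (j := refl a c) ⟨map_mem_roots ha.1.2 hc, h.refl_pos ha hc hcp hne, w * refl a,
      G.mul_mem hw (hrG a ha), by
        rw [mul_map, Submodule.reflection_reflection]; exact hbc⟩ hlt.le
    exact absurd hlt (not_lt.2 this)
  rcases h.pos_or_neg hb with h1 | h1
  · exact key b hb h1
  · obtain ⟨w, hw, a, ha, hba⟩ := key _ (neg_mem_roots hb) h1
    refine ⟨w * refl a, G.mul_mem hw (hrG a ha), a, ha, ?_⟩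
    have : refl a a = -a := Submodule.reflection_orthogonalComplement_singleton_eq_neg a
    rw [mul_map, this, map_neg, ← hba, neg_neg]

lemma closure_simple : Subgroup.closure (refl '' simpleRoots W p) = W := by
  apply le_antisymm
  · rw [Subgroup.closure_le]; rintro _ ⟨a, ha, rfl⟩; exact ha.1.2
  · conv_lhs => rw [← h.gen]
    rw [Subgroup.closure_le]
    rintro _ ⟨H, hH, rfl⟩
    obtain ⟨b, hb, rfl⟩ := mem_arrangement_iff.1 hH
    obtain ⟨w, hw, a, ha, rfl⟩ := h.exists_map_simple hb
    have := refl_map w ha.1.1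
    simp only [refl] at this
    rw [this]
    exact mul_mem (mul_mem hw (Subgroup.subset_closure (Set.mem_image_of_mem _ ha))) (inv_mem hw)

/-- Every vector is conjugate to one of the closed chamber of `p`. -/
lemma exists_map_nonneg (v : V) : ∃ w ∈ W, ∀ b ∈ roots W, 0 < ⟪b, p⟫ → 0 ≤ ⟪b, w v⟫ := by
  have := h.finite
  -- The point of the orbit with the largest inner product with `p` lies in the chamber, since a
  -- simple root negative on it would give a reflection that increases this product.
  obtain ⟨w, hw, hmax⟩ := (Set.toFinite (W : Set (V ≃ₗᵢ[ℝ] V))).exists_maximalFor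
    (fun w => ⟪w v, p⟫) _ ⟨1, W.one_mem⟩
  refine ⟨w, hw, fun b hb hbp => h.nonneg_of_simple (fun a ha => ?_) hb hbp⟩
  by_contra! hneg
  have hlt : ⟪w v, p⟫ < ⟪(refl a * w) v, p⟫ := by
    rw [mul_map, refl_apply ha.1.1, inner_sub_left, inner_smul_left]
    simp only [conj_trivial]
    nlinarith [mul_pos (neg_pos.2 hneg) ha.2.1]
  exact absurd hlt (not_lt.2 (hmax (j := refl a * w) (W.mul_mem ha.1.2 hw) hlt.le))

end IsRegularPoint

/-! ### Word length and descents -/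

instance instFiniteRoots [Finite W] : Finite (roots W) := (roots_finite W).to_subtype

instance instFiniteSimpleRoots [Finite W] : Finite (simpleRoots W p) :=
  ((roots_finite W).subset fun _ ha => ha.1).to_subtype

instance instFintypeSimpleRoots [Finite W] : Fintype (simpleRoots W p) := Fintype.ofFinite _

/-- The reflections in the simple roots. -/
def simpleReflections (W : Subgroup (V ≃ₗᵢ[ℝ] V)) (p : V) : Set W :=
  {s | ∃ a ∈ simpleRoots W p, (s : V ≃ₗᵢ[ℝ] V) = refl a}

/-- The simple reflection attached to a simple root. -/
def simpleRefl (a : simpleRoots W p) : W := ⟨refl (a : V), a.2.1.2⟩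

lemma simpleRefl_mem (a : simpleRoots W p) : simpleRefl a ∈ simpleReflections W p :=
  ⟨a, a.2, rfl⟩

lemma simpleRefl_mul_self (a : simpleRoots W p) : simpleRefl a * simpleRefl a = 1 :=
  Subtype.ext (refl_mul_self _)

lemma refl_self (a : V) : refl a a = -a :=
  Submodule.reflection_orthogonalComplement_singleton_eq_neg a

lemma inner_map_inv (w : V ≃ₗᵢ[ℝ] V) (a x : V) : ⟪a, w x⟫ = ⟪w⁻¹ a, x⟫ := by
  rw [inner_map_eq, inv_inv]

lemma inv_map_map (w : V ≃ₗᵢ[ℝ] V) (x : V) : w⁻¹ (w x) = x := w.symm_apply_apply x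

lemma map_inv_map (w : V ≃ₗᵢ[ℝ] V) (x : V) : w (w⁻¹ x) = x := w.apply_symm_apply x

section WordLength

variable {G : Type*} [Group G] {S : Set G}

lemma wordLength_le {l : List G} (hl : ∀ s ∈ l, s ∈ S) : wordLength S l.prod ≤ l.length :=
  Nat.sInf_le ⟨l, rfl, hl, rfl⟩

lemma exists_word_of_exists {w : G} (hw : ∃ l : List G, (∀ s ∈ l, s ∈ S) ∧ l.prod = w) :
    ∃ l : List G, l.length = wordLength S w ∧ (∀ s ∈ l, s ∈ S) ∧ l.prod = w := by
  obtain ⟨l, hl, hp⟩ := hw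
  exact Nat.sInf_mem (s := {n | ∃ l : List G, l.length = n ∧ (∀ s ∈ l, s ∈ S) ∧ l.prod = w})
    ⟨_, l, rfl, hl, hp⟩

end WordLength

namespace IsRegularPoint

variable (h : IsRegularPoint W p)
include h

lemma exists_word (w : W) : ∃ l : List W, (∀ s ∈ l, s ∈ simpleReflections W p) ∧ l.prod = w := by
  have key : ∀ x ∈ Subgroup.closure (refl '' simpleRoots W p),
      ∃ l : List W, (∀ s ∈ l, s ∈ simpleReflections W p) ∧ (l.prod : V ≃ₗᵢ[ℝ] V) = x := by
    intro x hx
    induction hx using Subgroup.closure_induction with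
    | mem x hx =>
      obtain ⟨a, ha, rfl⟩ := hx
      exact ⟨[⟨refl a, ha.1.2⟩], by simpa using ⟨a, ha, rfl⟩, by simp⟩
    | one => exact ⟨[], by simp, rfl⟩
    | mul x y _ _ hx hy =>
      obtain ⟨l, hl, rfl⟩ := hx
      obtain ⟨m, hm, rfl⟩ := hy
      refine ⟨l ++ m, fun s hs => ?_, by simp⟩
      rcases List.mem_append.1 hs with hs | hs
      exacts [hl s hs, hm s hs]
    | inv x _ hx =>
      obtain ⟨l, hl, rfl⟩ := hx
      refine ⟨l.reverse, fun s hs => hl s (List.mem_reverse.1 hs), ?_⟩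
      have : l.map (fun s => s⁻¹) = l := by
        conv_rhs => rw [← List.map_id l]
        refine List.map_congr_left fun s hs => ?_
        obtain ⟨a, ha, hsa⟩ := hl s hs
        have : s * s = 1 := Subtype.ext (by rw [Subgroup.coe_mul, hsa]; exact refl_mul_self a)
        exact inv_eq_of_mul_eq_one_right this
      rw [← Subgroup.coe_inv, List.prod_inv_reverse, this]
  obtain ⟨l, hl, hx⟩ := key w (by rw [h.closure_simple]; exact w.2)
  exact ⟨l, hl, Subtype.ext hx⟩

/-- This is the exchange condition. Apply the letters to `a` from the right. The first letter which
makes the image negative must be the reflection in that image, hence a conjugate of the reflection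
in `a`, and it can be deleted. -/
lemma exists_shorter_word {l : List W} (hl : ∀ s ∈ l, s ∈ simpleReflections W p)
    (a : simpleRoots W p) (ha : ⟪(l.prod : V ≃ₗᵢ[ℝ] V) a, p⟫ < 0) :
    ∃ m : List W, (∀ s ∈ m, s ∈ simpleReflections W p) ∧ m.length + 1 = l.length ∧
      m.prod = l.prod * simpleRefl a := by
  induction l with
  | nil =>
    have := a.2.2.1
    simp only [List.prod_nil, Subgroup.coe_one] at ha
    exact absurd this (not_lt.2 ha.le)
  | cons s l ih =>
    have hl' : ∀ s ∈ l, s ∈ simpleReflections W p := fun t ht => hl t (List.mem_cons_of_mem _ ht)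
    have hroot : (l.prod : V ≃ₗᵢ[ℝ] V) a ∈ roots W := map_mem_roots l.prod.2 a.2.1
    obtain ⟨c, hc, hsc⟩ := hl s List.mem_cons_self
    rw [List.prod_cons, Subgroup.coe_mul, mul_map, hsc] at ha
    rcases lt_or_gt_of_ne (h.ne_zero _ hroot) with hneg | hpos
    · obtain ⟨m, hm, hlen, hprod⟩ := ih hl' hneg
      refine ⟨s :: m, ?_, by simp [hlen], by rw [List.prod_cons, List.prod_cons, hprod, mul_assoc]⟩
      intro t ht
      rcases List.mem_cons.1 ht with rfl | ht
      exacts [hl _ List.mem_cons_self, hm t ht]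
    · have hca : (l.prod : V ≃ₗᵢ[ℝ] V) a = c := by
        by_contra hne
        exact absurd (h.refl_pos hc hroot hpos hne) (not_lt.2 ha.le)
      refine ⟨l, hl', by simp, ?_⟩
      have h1 := refl_map (l.prod : V ≃ₗᵢ[ℝ] V) a.2.1.1
      rw [hca, ← hsc] at h1
      have h2 : s = l.prod * simpleRefl a * l.prod⁻¹ := Subtype.ext h1
      rw [List.prod_cons, h2]
      simp [mul_assoc, simpleRefl_mul_self]

lemma wordLength_mul_lt_of_neg (w : W) (a : simpleRoots W p)
    (ha : ⟪(w : V ≃ₗᵢ[ℝ] V) a, p⟫ < 0) :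
    wordLength (simpleReflections W p) (w * simpleRefl a) <
      wordLength (simpleReflections W p) w := by
  obtain ⟨l, hlen, hl, rfl⟩ := exists_word_of_exists (h.exists_word w)
  obtain ⟨m, hm, hmlen, hprod⟩ := h.exists_shorter_word hl a ha
  rw [← hprod, ← hlen, ← hmlen]
  exact Nat.lt_succ_of_le (wordLength_le hm)

/-- Descents become signs of roots. For the converse, if `w a` is positive, then `w * simpleRefl a`
sends `a` to a negative root and is the longer of the two. -/
lemma wordLength_mul_lt_iff (w : W) (a : simpleRoots W p) :
    wordLength (simpleReflections W p) (w * simpleRefl a) < wordLength (simpleReflections W p) w ↔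
      ⟪(w : V ≃ₗᵢ[ℝ] V) a, p⟫ < 0 := by
  refine ⟨fun hlt => ?_, h.wordLength_mul_lt_of_neg w a⟩
  by_contra! hge
  have hpos := lt_of_le_of_ne hge (h.ne_zero _ (map_mem_roots w.2 a.2.1)).symm
  have := h.wordLength_mul_lt_of_neg (w * simpleRefl a) a (by
    have : ((w * simpleRefl a : W) : V ≃ₗᵢ[ℝ] V) a = -(w : V ≃ₗᵢ[ℝ] V) a := by
      rw [Subgroup.coe_mul, mul_map, ← map_neg]; congr 1; exact refl_self _
    rw [this, inner_neg_left]; linarith)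
  rw [mul_assoc, simpleRefl_mul_self, mul_one] at this
  exact absurd this hlt.asymm

/-- The last letter of a nonempty reduced word is a descent, so some simple root becomes negative.
-/
lemma eq_one_of_pos (w : W) (hw : ∀ a : simpleRoots W p, 0 < ⟪(w : V ≃ₗᵢ[ℝ] V) a, p⟫) : w = 1 := by
  obtain ⟨l, hlen, hl, rfl⟩ := exists_word_of_exists (h.exists_word w)
  rcases List.eq_nil_or_concat l with rfl | ⟨m, s, rfl⟩
  · rfl
  exfalso
  obtain ⟨a, ha, hs⟩ := hl s (by simp)
  have hs' : s = simpleRefl (⟨a, ha⟩ : simpleRoots W p) := Subtype.ext hs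
  have hm : ∀ s ∈ m, s ∈ simpleReflections W p := fun t ht => hl t (by simp [ht])
  have hlt : ((m ++ [s]).prod) * simpleRefl (⟨a, ha⟩ : simpleRoots W p) = m.prod := by
    rw [List.prod_append, List.prod_singleton, hs', mul_assoc, simpleRefl_mul_self, mul_one]
  rw [List.concat_eq_append] at hlen hw
  have := (h.wordLength_mul_lt_iff (m ++ [s]).prod ⟨a, ha⟩).1 (by
    rw [hlt, ← hlen]
    exact (wordLength_le hm).trans_lt (by simp))
  exact absurd (hw _) this.asymm

/-! ### Fundamental weights -/

variable [Finite W]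

/-- The basis of simple roots. -/
def basis : Module.Basis (simpleRoots W p) ℝ V :=
  Module.Basis.mk h.linearIndependent_simple (by
    rw [Subtype.range_coe_subtype]; exact h.span_simple.ge)

/-- The fundamental weights: the basis dual to the simple roots. -/
def weight (a : simpleRoots W p) : V :=
  (InnerProductSpace.toDual ℝ V).symm (LinearMap.toContinuousLinearMap (h.basis.coord a))

lemma inner_weight_left (a : simpleRoots W p) (x : V) : ⟪h.weight a, x⟫ = h.basis.coord a x := by
  rw [weight, InnerProductSpace.toDual_symm_apply]; rfl

lemma inner_weight (a b : simpleRoots W p) [Decidable (a = b)] :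
    ⟪(a : V), h.weight b⟫ = if a = b then 1 else 0 := by
  classical
  rw [real_inner_comm, h.inner_weight_left]
  have : (a : V) = h.basis a := by simp [basis]
  rw [this, Module.Basis.coord_apply, Module.Basis.repr_self, Finsupp.single_apply]

lemma inner_weight_self (a : simpleRoots W p) : ⟪(a : V), h.weight a⟫ = 1 := by
  classical
  rw [h.inner_weight, if_pos rfl]

lemma inner_weight_ne {a b : simpleRoots W p} (hab : a ≠ b) : ⟪(a : V), h.weight b⟫ = 0 := by
  classical
  rw [h.inner_weight, if_neg hab]

lemma eq_sum_simple (x : V) : x = ∑ a : simpleRoots W p, ⟪x, h.weight a⟫ • (a : V) := by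
  conv_lhs => rw [← h.basis.sum_repr x]
  refine Finset.sum_congr rfl fun a _ => ?_
  rw [real_inner_comm, h.inner_weight_left, Module.Basis.coord_apply]
  simp [basis]

lemma inner_eq_sum (x y : V) : ⟪x, y⟫ = ∑ a : simpleRoots W p, ⟪x, h.weight a⟫ * ⟪(a : V), y⟫ := by
  conv_lhs => rw [h.eq_sum_simple x, sum_inner]
  refine Finset.sum_congr rfl fun a _ => ?_
  rw [inner_smul_left]; rfl

lemma eq_sum_weight (x : V) : x = ∑ a : simpleRoots W p, ⟪(a : V), x⟫ • h.weight a := by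
  refine ext_inner_left ℝ fun y => ?_
  rw [h.inner_eq_sum y x, inner_sum]
  refine Finset.sum_congr rfl fun a _ => ?_
  rw [inner_smul_right, mul_comm]

lemma weight_nonneg (a : simpleRoots W p) {b : V} (hb : b ∈ roots W) (hbp : 0 < ⟪b, p⟫) :
    0 ≤ ⟪b, h.weight a⟫ := by
  classical
  refine h.nonneg_of_simple (fun c hc => ?_) hb hbp
  rw [h.inner_weight ⟨c, hc⟩ a]
  split_ifs <;> norm_num

/-- Positivity of a positive root on the closed chamber of `p`, in coordinates. -/
lemma inner_pos_iff {b : V} (hb : b ∈ roots W) (hbp : 0 < ⟪b, p⟫) {x : V}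
    (hx : ∀ a : simpleRoots W p, 0 ≤ ⟪(a : V), x⟫) :
    0 < ⟪b, x⟫ ↔ ∃ a : simpleRoots W p, 0 < ⟪b, h.weight a⟫ ∧ 0 < ⟪(a : V), x⟫ := by
  rw [h.inner_eq_sum b x]
  have hnn : ∀ a ∈ (Finset.univ : Finset (simpleRoots W p)),
      0 ≤ ⟪b, h.weight a⟫ * ⟪(a : V), x⟫ :=
    fun a _ => mul_nonneg (h.weight_nonneg a hb hbp) (hx a)
  rw [Finset.sum_pos_iff_of_nonneg hnn]
  constructor
  · rintro ⟨a, -, ha⟩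
    exact ⟨a, lt_of_le_of_ne (h.weight_nonneg a hb hbp) (fun e => by rw [← e] at ha; simp at ha),
      lt_of_le_of_ne (hx a) (fun e => by rw [← e] at ha; simp at ha)⟩
  · rintro ⟨a, h1, h2⟩
    exact ⟨a, Finset.mem_univ _, mul_pos h1 h2⟩

lemma weight_ne_zero (a : simpleRoots W p) : h.weight a ≠ 0 := by
  intro h0
  have := h.inner_weight_self a
  rw [h0, inner_zero_right] at this
  exact zero_ne_one this

lemma finrank_eq : Module.finrank ℝ V = Fintype.card (simpleRoots W p) :=
  Module.finrank_eq_card_basis h.basis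

end IsRegularPoint

end ReflectionGroup

/-! ### Sums of elements in the algebra of a left regular band -/

section LeftRegularBand

open Polynomial

variable {M : Type*} [Monoid M]

/-- The number of elements of `R` which fix `G` under right multiplication. -/
def fixCount [DecidableEq M] (R : Finset M) (G : M) : ℕ := (R.filter fun F => G * F = G).card

variable [DecidableEq M]

/-- Whatever fixes `G` also fixes `G * F`, by `E * F * E = E * F`; moreover `F` fixes `G * F` by
idempotence, and by assumption not `G`. -/
lemma fixCount_lt (hM : ∀ x y : M, x * y * x = x * y) {R : Finset M} {G F : M} (hF : F ∈ R)
    (hGF : G * F ≠ G) : fixCount R G < fixCount R (G * F) := by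
  have hidem : ∀ x : M, x * x = x := fun x => by simpa using hM x 1
  apply Finset.card_lt_card
  rw [Finset.ssubset_iff_of_subset]
  · exact ⟨F, by simp [hF, mul_assoc, hidem], by simp [hGF]⟩
  · intro E hE
    rw [Finset.mem_filter] at hE ⊢
    refine ⟨hE.1, ?_⟩
    calc G * F * E = G * E * F * E := by rw [hE.2]
      _ = G * (E * F * E) := by simp only [mul_assoc]
      _ = G * F := by rw [hM, ← mul_assoc, hE.2]

/-- In the algebra of a left regular band, a sum of distinct elements is annihilated by a
polynomial with simple roots. -/
theorem aeval_sum_of_leftRegularBand (hM : ∀ x y : M, x * y * x = x * y) (R : Finset M)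
    (Λ : Finset ℕ) (hΛ : ∀ G : M, fixCount R G ∈ Λ) :
    aeval (∑ F ∈ R, MonoidAlgebra.of ℝ M F) (∏ j ∈ Λ, (X - C (j : ℝ))) = 0 := by
  set a := ∑ F ∈ R, MonoidAlgebra.of ℝ M F with ha
  -- On `G`, only the factors with `j` at least `fixCount R G` are needed. The factor at `fixCount R
  -- G` cancels the terms with `G * F = G`; the remaining `G * F` have larger fix counts and are
  -- killed by the remaining factors.
  have key : ∀ G : M,
      MonoidAlgebra.of ℝ M G * aeval a (∏ j ∈ Λ with fixCount R G ≤ j, (X - C (j : ℝ))) = 0 := by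
    intro G
    induction hn : R.card - fixCount R G using Nat.strong_induction_on generalizing G with
    | _ n ih =>
    subst hn
    have h1 : (Λ.filter fun j => fixCount R G ≤ j)
        = insert (fixCount R G) (Λ.filter fun j => fixCount R G < j) := by
      ext j; simp only [Finset.mem_filter, Finset.mem_insert]
      constructor
      · rintro ⟨h1, h2⟩; rcases h2.eq_or_lt with h | h <;> simp [*]
      · rintro (rfl | h)
        exacts [⟨hΛ _, le_rfl⟩, ⟨h.1, h.2.le⟩]
    rw [h1, Finset.prod_insert (by simp), map_mul, ← mul_assoc]
    have h2 : MonoidAlgebra.of ℝ M G * aeval a (X - C ((fixCount R G : ℕ) : ℝ)) =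
        ∑ F ∈ R with ¬ G * F = G, MonoidAlgebra.of ℝ M (G * F) := by
      rw [map_sub, aeval_X, aeval_C, mul_sub, ha, Finset.mul_sum,
        ← Finset.sum_filter_add_sum_filter_not R (fun F => G * F = G),
        Finset.sum_congr rfl (g := fun _ => MonoidAlgebra.of ℝ M G) fun F hF => by
          rw [← map_mul, (Finset.mem_filter.1 hF).2], Finset.sum_const,
        ← Algebra.commutes, ← Algebra.smul_def, Nat.cast_smul_eq_nsmul]
      simp only [fixCount, ← map_mul]
      abel
    rw [h2, Finset.sum_mul]
    refine Finset.sum_eq_zero fun F hF => ?_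
    rw [Finset.mem_filter] at hF
    have hlt := fixCount_lt hM hF.1 hF.2
    have hsub : (Λ.filter fun j => fixCount R (G * F) ≤ j) ⊆ Λ.filter fun j => fixCount R G < j :=
      fun j hj => by
        rw [Finset.mem_filter] at hj ⊢
        exact ⟨hj.1, hlt.trans_le hj.2⟩
    obtain ⟨q, hq⟩ := Finset.prod_dvd_prod_of_subset _ _ (fun j : ℕ => (X - C (j : ℝ))) hsub
    have hle : fixCount R (G * F) ≤ R.card := Finset.card_filter_le _ _
    rw [hq, map_mul (aeval a), ← mul_assoc, ih _ (by omega) _ rfl, zero_mul]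
  have h1 := key 1
  rw [map_one, one_mul] at h1
  obtain ⟨q, hq⟩ := Finset.prod_dvd_prod_of_subset _ _ (fun j : ℕ => (X - C (j : ℝ)))
    (Finset.filter_subset (fun j => fixCount R 1 ≤ j) Λ)
  rw [hq, map_mul, h1, zero_mul]

end LeftRegularBand

/-! ### Semisimplicity and eigenvalues from a polynomial with simple roots -/

section Semisimple

open Polynomial

lemma ker_aeval_prod {M : Type*} [AddCommGroup M] [Module ℝ M] (f : Module.End ℝ M)
    (Λ : Finset ℝ) :
    LinearMap.ker (aeval f (∏ j ∈ Λ, (X - C j))) ≤ ⨆ μ : ℝ, f.eigenspace μ := by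
  classical
  induction Λ using Finset.induction_on with
  | empty => simp [Module.End.one_eq_id]
  | insert j Λ hj ih =>
    rw [Finset.prod_insert hj, ← Polynomial.sup_ker_aeval_eq_ker_aeval_mul_of_coprime]
    · refine sup_le (le_trans (le_of_eq ?_) (le_iSup _ j)) ih
      ext x
      simp [sub_eq_zero]
    · refine IsCoprime.prod_right fun i hi => ?_
      exact isCoprime_X_sub_C_of_isUnit_sub (sub_ne_zero.2 fun e : j = i => hj (e ▸ hi)).isUnit

lemma isRealSemisimple_of_aeval {M : Type*} [AddCommGroup M] [Module ℝ M] (f : Module.End ℝ M)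
    (Λ : Finset ℝ) (h : aeval f (∏ j ∈ Λ, (X - C j)) = 0) : IsRealSemisimple f := by
  have := ker_aeval_prod f Λ
  rw [h, LinearMap.ker_zero] at this
  exact top_le_iff.1 this

variable {A : Type*} [Ring A] [Algebra ℝ A]

lemma aeval_mulLeft (b : A) (q : ℝ[X]) :
    aeval (LinearMap.mulLeft ℝ b) q = LinearMap.mulLeft ℝ (aeval b q) := by
  induction q using Polynomial.induction_on' with
  | add p q hp hq => rw [map_add, map_add, hp, hq]; ext x; simp [add_mul]
  | monomial n r =>
    rw [aeval_monomial, aeval_monomial, LinearMap.pow_mulLeft]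
    ext x; simp [Algebra.smul_def]

lemma aeval_mulRight (b : A) (q : ℝ[X]) :
    aeval (LinearMap.mulRight ℝ b) q = LinearMap.mulRight ℝ (aeval b q) := by
  induction q using Polynomial.induction_on' with
  | add p q hp hq => rw [map_add, map_add, hp, hq]; ext x; simp [mul_add]
  | monomial n r =>
    rw [aeval_monomial, aeval_monomial, LinearMap.pow_mulRight]
    ext x; simp [← Algebra.smul_def]

lemma isRealSemisimple_mul {b : A} {Λ : Finset ℝ} (h0 : aeval b (∏ j ∈ Λ, (X - C j)) = 0) :
    IsRealSemisimple (LinearMap.mulLeft ℝ b) ∧ IsRealSemisimple (LinearMap.mulRight ℝ b) :=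
  ⟨isRealSemisimple_of_aeval _ Λ (by rw [aeval_mulLeft, h0]; ext; simp),
    isRealSemisimple_of_aeval _ Λ (by rw [aeval_mulRight, h0]; ext; simp)⟩

/-- If `b` has minimal polynomial `∏ (X - j)`, these `j` are the eigenvalues of left and right
multiplication by `b`. -/
lemma hasEigenvalue_mul_iff {b : A} {Λ : Finset ℝ} (h0 : aeval b (∏ j ∈ Λ, (X - C j)) = 0)
    (hmin : ∀ q : ℝ[X], aeval b q = 0 → ∀ j ∈ Λ, q.eval j = 0) (μ : ℝ) :
    (Module.End.HasEigenvalue (LinearMap.mulLeft ℝ b) μ ↔ μ ∈ Λ) ∧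
      (Module.End.HasEigenvalue (LinearMap.mulRight ℝ b) μ ↔ μ ∈ Λ) := by
  classical
  have hroot : ∀ f : Module.End ℝ A, aeval f (∏ j ∈ Λ, (X - C j)) = 0 →
      Module.End.HasEigenvalue f μ → μ ∈ Λ := by
    intro f hf hμ
    obtain ⟨x, hx⟩ := hμ.exists_hasEigenvector
    have h1 := Module.End.aeval_apply_of_hasEigenvector (p := ∏ j ∈ Λ, (X - C j)) hx
    rw [hf, LinearMap.zero_apply] at h1
    have h2 := (smul_eq_zero.1 h1.symm).resolve_right hx.2
    rw [eval_prod, Finset.prod_eq_zero_iff] at h2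
    obtain ⟨j, hj, hj0⟩ := h2
    simp only [eval_sub, eval_X, eval_C, sub_eq_zero] at hj0
    rwa [hj0]
  -- Omit the factor `X - μ` and evaluate at `b`. The value is nonzero by `hmin`, as the omitted
  -- product does not vanish at `μ`. It commutes with `b`, so one vector serves both sides.
  have hvec : μ ∈ Λ → ∃ x : A, x ≠ 0 ∧ b * x = μ • x ∧ x * b = μ • x := by
    intro hμ
    set q := ∏ j ∈ Λ.erase μ, (X - C j) with hq
    have hprod : (X - C μ) * q = ∏ j ∈ Λ, (X - C j) := Finset.mul_prod_erase _ _ hμ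
    refine ⟨aeval b q, fun h => ?_, ?_, ?_⟩
    · have := hmin q h μ hμ
      rw [hq, eval_prod, Finset.prod_eq_zero_iff] at this
      obtain ⟨j, hj, hj0⟩ := this
      simp only [eval_sub, eval_X, eval_C, sub_eq_zero] at hj0
      exact (Finset.ne_of_mem_erase hj) hj0.symm
    · have : aeval b ((X - C μ) * q) = 0 := by rw [hprod, h0]
      rw [map_mul, map_sub, aeval_X, aeval_C, sub_mul, sub_eq_zero] at this
      rw [this, Algebra.smul_def]
    · have : aeval b (q * (X - C μ)) = 0 := by rw [mul_comm, hprod, h0]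
      rw [map_mul, map_sub, aeval_X, aeval_C, mul_sub, sub_eq_zero] at this
      rw [this, Algebra.smul_def, Algebra.commutes]
  refine ⟨⟨hroot _ ?_, fun hμ => ?_⟩, ⟨hroot _ ?_, fun hμ => ?_⟩⟩
  · rw [aeval_mulLeft, h0]; ext; simp
  · obtain ⟨x, hx, h1, -⟩ := hvec hμ
    exact Module.End.hasEigenvalue_of_hasEigenvector (x := x)
      ⟨Module.End.mem_eigenspace_iff.2 h1, hx⟩
  · rw [aeval_mulRight, h0]; ext; simp
  · obtain ⟨x, hx, -, h1⟩ := hvec hμ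
    exact Module.End.hasEigenvalue_of_hasEigenvector (x := x)
      ⟨Module.End.mem_eigenspace_iff.2 h1, hx⟩

end Semisimple

/-! ### Ray vectors and the band of signs -/

namespace Arrangement

variable {E : Type*} [AddCommGroup E] [Module ℝ E]

/-- The intersection of the hyperplanes of `A` which contain `v` is the line spanned by `v`. -/
def IsRayVector (A : Set (Submodule ℝ E)) (v : E) : Prop :=
  v ≠ 0 ∧ ∀ x, (∀ H ∈ A, v ∈ H → x ∈ H) → ∃ c : ℝ, x = c • v

end Arrangement

/-- The signs `0`, `+`, `-`, with the product in which the first nonzero sign wins. -/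
@[ext] structure SignBand where
  /-- The underlying sign. -/
  sign : SignType

namespace SignBand

instance : Finite SignBand := Finite.of_injective sign fun _ _ => SignBand.ext

instance : Monoid SignBand where
  one := ⟨0⟩
  mul a b := if a.sign = 0 then b else a
  mul_assoc a b c := by
    change (if (if a.sign = 0 then b else a).sign = 0 then c
      else (if a.sign = 0 then b else a)) =
      if a.sign = 0 then (if b.sign = 0 then c else b) else a
    by_cases ha : a.sign = 0 <;> simp [ha]
  one_mul a := if_pos rfl
  mul_one a := by
    change (if a.sign = 0 then ⟨0⟩ else a) = a
    split_ifs with h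
    · exact SignBand.ext h.symm
    · rfl

lemma eq_one_iff {a : SignBand} : a = 1 ↔ a.sign = 0 := SignBand.ext_iff

lemma mul_of_eq_one {a b : SignBand} (ha : a = 1) : a * b = b := by rw [ha, one_mul]

lemma mul_of_ne_one {a b : SignBand} (ha : a ≠ 1) : a * b = a :=
  if_neg (fun e => ha (eq_one_iff.2 e))

lemma mul_mul_self (a b : SignBand) : a * b * a = a * b := by
  by_cases ha : a = 1
  · rw [ha, one_mul, mul_one]
  · rw [mul_of_ne_one ha, mul_of_ne_one ha]

lemma mul_eq_left_iff (a b : SignBand) : a * b = a ↔ (a = 1 → b = 1) := by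
  by_cases ha : a = 1
  · simp [ha]
  · simp [mul_of_ne_one ha, ha]

lemma mul_eq_one_iff (a b : SignBand) : a * b = 1 ↔ a = 1 ∧ b = 1 := by
  by_cases ha : a = 1
  · simp [ha]
  · simp [mul_of_ne_one ha, ha]

/-- The sign of a real number. -/
def ofReal (x : ℝ) : SignBand := ⟨SignType.sign x⟩

lemma ofReal_eq_iff {x y : ℝ} : ofReal x = ofReal y ↔ SignType.sign x = SignType.sign y :=
  SignBand.ext_iff

lemma ofReal_eq_one_iff {x : ℝ} : ofReal x = 1 ↔ x = 0 := eq_one_iff.trans sign_eq_zero_iff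

lemma ofReal_of_pos {x y : ℝ} (hx : 0 < x) (hy : 0 < y) : ofReal x = ofReal y := by
  rw [ofReal_eq_iff, sign_pos hx, sign_pos hy]

lemma ofReal_of_neg {x y : ℝ} (hx : x < 0) (hy : y < 0) : ofReal x = ofReal y := by
  rw [ofReal_eq_iff, sign_neg hx, sign_neg hy]

lemma ofReal_neg_eq {x y : ℝ} (h : ofReal x = ofReal y) : ofReal (-x) = ofReal (-y) := by
  rw [ofReal_eq_iff] at *
  rw [Left.sign_neg, Left.sign_neg, h]

lemma ofReal_eq_cases {x y : ℝ} (h : ofReal x = ofReal y) :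
    (0 < x ↔ 0 < y) ∧ (x = 0 ↔ y = 0) ∧ (x < 0 ↔ y < 0) := by
  rw [ofReal_eq_iff] at h
  rw [← sign_eq_one_iff, ← sign_eq_one_iff, ← sign_eq_zero_iff, ← sign_eq_zero_iff (a := y),
    ← sign_eq_neg_one_iff, ← sign_eq_neg_one_iff, h]
  simp

end SignBand

/-! ### The monoid of faces of the reflection arrangement -/

namespace ReflectionGroup

open scoped RealInnerProductSpace
open Arrangement

variable {V : Type*} [NormedAddCommGroup V] [InnerProductSpace ℝ V] [FiniteDimensional ℝ V]
variable (W : Subgroup (V ≃ₗᵢ[ℝ] V)) {p : V}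

/-- The sign vector of `x`. -/
def signVec (x : V) : roots W → SignBand := fun a => SignBand.ofReal ⟪(a : V), x⟫

lemma signVec_zero : signVec W 0 = 1 := by
  funext a
  exact SignBand.ofReal_eq_one_iff.2 (inner_zero_right (𝕜 := ℝ) (a : V))

/-- For small positive `ε`, the point `x + ε • y` keeps every nonzero sign of `x` and takes the sign
of `y` where `x` vanishes. There are finitely many roots, so one `ε` works for all. -/
lemma exists_signVec_mul [Finite W] (x y : V) :
    ∃ z, signVec W z = signVec W x * signVec W y := by
  have hev : ∀ᶠ ε : ℝ in nhdsWithin 0 (Set.Ioi 0), ∀ a ∈ roots W,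
      SignBand.ofReal ⟪a, x + ε • y⟫ = SignBand.ofReal ⟪a, x⟫ * SignBand.ofReal ⟪a, y⟫ := by
    rw [Filter.eventually_all_finite (roots_finite W)]
    intro a _
    have ht : Filter.Tendsto (fun ε : ℝ => ⟪a, x + ε • y⟫) (nhdsWithin 0 (Set.Ioi 0))
        (nhds ⟪a, x + (0 : ℝ) • y⟫) := by
      refine Filter.Tendsto.mono_left (Continuous.tendsto ?_ 0) nhdsWithin_le_nhds
      fun_prop
    rw [zero_smul, add_zero] at ht
    rcases lt_trichotomy ⟪a, x⟫ 0 with hx | hx | hx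
    · filter_upwards [ht.eventually (gt_mem_nhds hx)] with ε hε
      rw [SignBand.mul_of_ne_one (fun e => hx.ne (SignBand.ofReal_eq_one_iff.1 e))]
      exact SignBand.ofReal_of_neg hε hx
    · filter_upwards [self_mem_nhdsWithin] with ε hε
      rw [SignBand.mul_of_eq_one (SignBand.ofReal_eq_one_iff.2 hx), inner_add_right, hx, zero_add,
        inner_smul_right]
      rw [SignBand.ofReal_eq_iff, sign_mul, sign_pos (show (0 : ℝ) < ε from hε), one_mul]
    · filter_upwards [ht.eventually (lt_mem_nhds hx)] with ε hε
      rw [SignBand.mul_of_ne_one (fun e => hx.ne' (SignBand.ofReal_eq_one_iff.1 e))]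
      exact SignBand.ofReal_of_pos hε hx
  obtain ⟨ε, hε⟩ := hev.exists
  exact ⟨x + ε • y, funext fun a => hε a a.2⟩

/-- The monoid of faces of the reflection arrangement, as sign vectors. -/
def faceMonoid [Finite W] : Submonoid (roots W → SignBand) where
  carrier := Set.range (signVec W)
  one_mem' := ⟨0, signVec_zero W⟩
  mul_mem' := by
    rintro _ _ ⟨x, rfl⟩ ⟨y, rfl⟩
    exact exists_signVec_mul W x y

/-- The face with `x` in its relative interior. -/
def face [Finite W] (x : V) : faceMonoid W := ⟨signVec W x, x, rfl⟩

variable {W}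

instance [Finite W] : Finite (faceMonoid W) := Subtype.finite

lemma face_surjective [Finite W] : Function.Surjective (face W) := by
  rintro ⟨_, x, rfl⟩; exact ⟨x, rfl⟩

lemma faceMonoid_mul_mul_self [Finite W] (F G : faceMonoid W) : F * G * F = F * G :=
  Subtype.ext (funext fun _ => SignBand.mul_mul_self _ _)

lemma face_eq_iff [Finite W] {x y : V} : face W x = face W y ↔
    ∀ a ∈ roots W, SignBand.ofReal ⟪a, x⟫ = SignBand.ofReal ⟪a, y⟫ := by
  rw [Subtype.ext_iff, funext_iff, Subtype.forall]; rfl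

lemma face_mul_eq_iff [Finite W] {x y z : V} : face W x * face W y = face W z ↔
    ∀ a ∈ roots W, SignBand.ofReal ⟪a, x⟫ * SignBand.ofReal ⟪a, y⟫ = SignBand.ofReal ⟪a, z⟫ := by
  rw [Subtype.ext_iff, funext_iff, Subtype.forall]; rfl

lemma face_mul_map [Finite W] (w : W) {x y z : V} (hxyz : face W x * face W y = face W z) :
    face W ((w : V ≃ₗᵢ[ℝ] V) x) * face W ((w : V ≃ₗᵢ[ℝ] V) y) = face W ((w : V ≃ₗᵢ[ℝ] V) z) := by
  rw [face_mul_eq_iff] at hxyz ⊢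
  intro a ha
  rw [inner_map_inv, inner_map_inv, inner_map_inv]
  exact hxyz _ (map_mem_roots (W.inv_mem w.2) ha)

lemma face_map [Finite W] (w : W) {x y : V} (hxy : face W x = face W y) :
    face W ((w : V ≃ₗᵢ[ℝ] V) x) = face W ((w : V ≃ₗᵢ[ℝ] V) y) := by
  rw [face_eq_iff] at hxy ⊢
  intro a ha
  rw [inner_map_inv, inner_map_inv]
  exact hxy _ (map_mem_roots (W.inv_mem w.2) ha)

/-- The faces which fix a face from the right are those contained in its support; this turns fix
counts into geometric counts. -/
lemma face_mul_eq_left_iff [Finite W] {x y : V} : face W x * face W y = face W x ↔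
    ∀ a ∈ roots W, ⟪a, x⟫ = 0 → ⟪a, y⟫ = 0 := by
  rw [face_mul_eq_iff]
  refine forall₂_congr fun a _ => ?_
  rw [SignBand.mul_eq_left_iff, SignBand.ofReal_eq_one_iff, SignBand.ofReal_eq_one_iff]

lemma isRayVector_iff {v : V} : IsRayVector (arrangement W) v ↔
    v ≠ 0 ∧ ∀ x, (∀ a ∈ roots W, ⟪a, v⟫ = 0 → ⟪a, x⟫ = 0) → ∃ c : ℝ, x = c • v := by
  refine and_congr_right fun _ => forall_congr' fun x => imp_congr_left ?_
  constructor
  · intro hx a ha hav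
    exact mem_orthogonal_singleton.1 (hx _ (mem_arrangement_iff.2 ⟨a, ha, rfl⟩)
      (mem_orthogonal_singleton.2 hav))
  · intro hx H hH hv
    obtain ⟨a, ha, rfl⟩ := mem_arrangement_iff.1 hH
    exact mem_orthogonal_singleton.2 (hx a ha (mem_orthogonal_singleton.1 hv))

lemma isRayVector_map (w : W) {v : V} (hv : IsRayVector (arrangement W) v) :
    IsRayVector (arrangement W) ((w : V ≃ₗᵢ[ℝ] V) v) := by
  rw [isRayVector_iff] at hv ⊢
  refine ⟨by simpa using hv.1, fun x hx => ?_⟩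
  obtain ⟨c, hc⟩ := hv.2 ((w : V ≃ₗᵢ[ℝ] V)⁻¹ x) (fun a ha hav => by
    rw [← inner_map_eq]
    refine hx _ (map_mem_roots w.2 ha) ?_
    rw [inner_map_eq, inv_map_map, hav])
  exact ⟨c, by rw [← map_smul, ← hc, map_inv_map]⟩

namespace IsRegularPoint

variable (h : IsRegularPoint W p) [Finite W]
include h

/-- Points of the closed chamber of `p` are in the same face if they are on the same walls. -/
lemma face_eq_of_dominant {x y : V} (hx : ∀ a : simpleRoots W p, 0 ≤ ⟪(a : V), x⟫)
    (hy : ∀ a : simpleRoots W p, 0 ≤ ⟪(a : V), y⟫)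
    (hxy : ∀ a : simpleRoots W p, 0 < ⟪(a : V), x⟫ ↔ 0 < ⟪(a : V), y⟫) : face W x = face W y := by
  have key : ∀ b ∈ roots W, 0 < ⟪b, p⟫ → SignBand.ofReal ⟪b, x⟫ = SignBand.ofReal ⟪b, y⟫ := by
    intro b hb hbp
    have hiff : 0 < ⟪b, x⟫ ↔ 0 < ⟪b, y⟫ := by
      rw [h.inner_pos_iff hb hbp hx, h.inner_pos_iff hb hbp hy]
      simp only [hxy]
    have hbx := h.nonneg_of_simple (fun a ha => hx ⟨a, ha⟩) hb hbp
    have hby := h.nonneg_of_simple (fun a ha => hy ⟨a, ha⟩) hb hbp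
    by_cases hpos : 0 < ⟪b, x⟫
    · exact SignBand.ofReal_of_pos hpos (hiff.1 hpos)
    · rw [le_antisymm (not_lt.1 hpos) hbx, le_antisymm (not_lt.1 (hiff.not.1 hpos)) hby]
  rw [face_eq_iff]
  intro b hb
  rcases h.pos_or_neg hb with hbp | hbp
  · exact key b hb hbp
  · have := SignBand.ofReal_neg_eq (key _ (neg_mem_roots hb) hbp)
    simpa only [inner_neg_left, neg_neg] using this

/-- The chamber with a given interior point. -/
lemma face_eq_chamber_iff (w : W) {z : V} :
    face W z = face W ((w : V ≃ₗᵢ[ℝ] V) p) ↔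
      ∀ a : simpleRoots W p, 0 < ⟪(w : V ≃ₗᵢ[ℝ] V) a, z⟫ := by
  constructor
  · intro hz a
    have := face_eq_iff.1 hz _ (map_mem_roots w.2 a.2.1)
    rw [(SignBand.ofReal_eq_cases this).1, inner_map_eq, inv_map_map]
    exact a.2.2.1
  · intro hz
    have := h.face_eq_of_dominant (x := (w : V ≃ₗᵢ[ℝ] V)⁻¹ z) (y := p)
      (fun a => by rw [← inner_map_eq]; exact (hz a).le) (fun a => a.2.2.1.le)
      (fun a => iff_of_true (by rw [← inner_map_eq]; exact hz a) a.2.2.1)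
    have := face_map w this
    rwa [map_inv_map] at this

lemma exists_face_eq_chamber {z : V} (hz : ∀ a ∈ roots W, ⟪a, z⟫ ≠ 0) :
    ∃ w : W, face W z = face W ((w : V ≃ₗᵢ[ℝ] V) p) := by
  obtain ⟨w, hw, hpos⟩ := h.exists_map_nonneg z
  refine ⟨⟨w, hw⟩⁻¹, (h.face_eq_chamber_iff _).2 fun a => ?_⟩
  rw [Subgroup.coe_inv, inner_map_eq, inv_inv]
  refine lt_of_le_of_ne (hpos a a.2.1 a.2.2.1) (Ne.symm ?_)
  rw [inner_map_inv]
  exact hz _ (map_mem_roots (W.inv_mem hw) a.2.1)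

/-- A product with a chamber is a chamber. -/
lemma exists_face_mul_chamber (x : V) {y : V} (hy : ∀ a ∈ roots W, ⟪a, y⟫ ≠ 0) :
    ∃ w : W, face W x * face W y = face W ((w : V ≃ₗᵢ[ℝ] V) p) := by
  obtain ⟨z, hz⟩ := exists_signVec_mul W x y
  have hz' : face W x * face W y = face W z := Subtype.ext hz.symm
  obtain ⟨w, hw⟩ := h.exists_face_eq_chamber (z := z) (fun a ha h0 => by
    have := face_mul_eq_iff.1 hz' a ha
    rw [SignBand.ofReal_eq_one_iff.2 h0, SignBand.mul_eq_one_iff, SignBand.ofReal_eq_one_iff,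
      SignBand.ofReal_eq_one_iff] at this
    exact hy a ha this.2)
  exact ⟨w, hz'.trans hw⟩

/-- If `u p` and `w p` are in the same chamber, then `w⁻¹ * u` keeps all simple roots positive,
hence is trivial. -/
lemma face_map_injective : Function.Injective fun w : W => face W ((w : V ≃ₗᵢ[ℝ] V) p) := by
  intro u w huw
  have := h.eq_one_of_pos (w⁻¹ * u) (fun a => by
    have := (h.face_eq_chamber_iff u).1 (Eq.symm huw) a
    rwa [Subgroup.coe_mul, mul_map, inner_map_eq, Subgroup.coe_inv, inv_inv])
  exact (inv_mul_eq_one.1 this).symm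

lemma isRayVector_weight (s : simpleRoots W p) : IsRayVector (arrangement W) (h.weight s) := by
  rw [isRayVector_iff]
  refine ⟨h.weight_ne_zero s, fun x hx => ⟨⟪(s : V), x⟫, ?_⟩⟩
  conv_lhs => rw [h.eq_sum_weight x]
  refine Finset.sum_eq_single s (fun t _ hts => ?_) (by simp)
  rw [hx t t.2.1 (h.inner_weight_ne hts), zero_smul]

/-- The hypothesis says that `u` has no descent outside `s`. The weight decides the sign of the root
`u s`; at the other `u t` the ray vanishes and the second factor `p` is positive. -/
lemma face_weight_mul (u : W) (s : simpleRoots W p)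
    (hu : ∀ t : simpleRoots W p, t ≠ s → 0 < ⟪(u : V ≃ₗᵢ[ℝ] V) t, p⟫) :
    face W ((u : V ≃ₗᵢ[ℝ] V) (h.weight s)) * face W p = face W ((u : V ≃ₗᵢ[ℝ] V) p) := by
  obtain ⟨z, hz⟩ := exists_signVec_mul W ((u : V ≃ₗᵢ[ℝ] V) (h.weight s)) p
  have hz' : face W ((u : V ≃ₗᵢ[ℝ] V) (h.weight s)) * face W p = face W z := Subtype.ext hz.symm
  rw [hz', h.face_eq_chamber_iff]
  intro t
  have h1 := face_mul_eq_iff.1 hz' _ (map_mem_roots u.2 t.2.1)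
  rw [inner_map_eq _ _ ((u : V ≃ₗᵢ[ℝ] V) _), inv_map_map] at h1
  by_cases hts : t = s
  · rw [hts, h.inner_weight_self, SignBand.mul_of_ne_one
      (fun e => one_ne_zero (SignBand.ofReal_eq_one_iff.1 e))] at h1
    rw [hts]
    exact (SignBand.ofReal_eq_cases h1).1.1 one_pos
  · rw [h.inner_weight_ne hts, SignBand.mul_of_eq_one (SignBand.ofReal_eq_one_iff.2 rfl)] at h1
    exact (SignBand.ofReal_eq_cases h1).1.1 (hu t hts)

/-- Converse of `face_weight_mul`. Multiplying the ray by the base chamber gives the chamber `u p`,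
which has the ray in its closure. Moved back by `u⁻¹`, the ray lies in the closed fundamental
chamber and must be spanned by a weight. -/
lemma exists_face_eq_weight {v : V} (hv : IsRayVector (arrangement W) v) :
    ∃ (u : W) (s : simpleRoots W p), face W v = face W ((u : V ≃ₗᵢ[ℝ] V) (h.weight s)) ∧
      ∀ t : simpleRoots W p, t ≠ s → 0 < ⟪(u : V ≃ₗᵢ[ℝ] V) t, p⟫ := by
  obtain ⟨u, hu⟩ := h.exists_face_mul_chamber v h.ne_zero
  have hsign : ∀ t : simpleRoots W p, 0 ≤ ⟪(u : V ≃ₗᵢ[ℝ] V) t, v⟫ ∧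
      (⟪(u : V ≃ₗᵢ[ℝ] V) t, v⟫ = 0 → 0 < ⟪(u : V ≃ₗᵢ[ℝ] V) t, p⟫) := by
    intro t
    have h1 := face_mul_eq_iff.1 hu _ (map_mem_roots u.2 t.2.1)
    rw [inner_map_eq _ _ ((u : V ≃ₗᵢ[ℝ] V) _), inv_map_map] at h1
    by_cases h0 : ⟪(u : V ≃ₗᵢ[ℝ] V) t, v⟫ = 0
    · rw [SignBand.mul_of_eq_one (SignBand.ofReal_eq_one_iff.2 h0)] at h1
      exact ⟨h0.ge, fun _ => (SignBand.ofReal_eq_cases h1).1.2 t.2.2.1⟩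
    · rw [SignBand.mul_of_ne_one (fun e => h0 (SignBand.ofReal_eq_one_iff.1 e))] at h1
      exact ⟨((SignBand.ofReal_eq_cases h1).1.2 t.2.2.1).le, fun e => absurd e h0⟩
  set v' := ((u⁻¹ : W) : V ≃ₗᵢ[ℝ] V) v with hv'
  have hvv' : ∀ a, ⟪(u : V ≃ₗᵢ[ℝ] V) a, v⟫ = ⟪a, v'⟫ := fun a => inner_map_eq _ _ _
  simp only [hvv'] at hsign
  have hray := isRayVector_iff.1 (isRayVector_map u⁻¹ hv)
  rw [← hv'] at hray
  obtain ⟨s, hs⟩ : ∃ s : simpleRoots W p, ⟪(s : V), v'⟫ ≠ 0 := by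
    by_contra! hall
    exact hray.1 (h.eq_zero_of_simple fun a ha => hall ⟨a, ha⟩)
  have hspos : 0 < ⟪(s : V), v'⟫ := lt_of_le_of_ne (hsign s).1 hs.symm
  -- A positive root which vanishes at `v'` has no `s` component, because all terms of its expansion
  -- at `v'` are nonnegative. So the weight lies on every hyperplane through `v'`, which leaves only
  -- the line of `v'`.
  have key : ∀ b ∈ roots W, 0 < ⟪b, p⟫ → ⟪b, v'⟫ = 0 → ⟪b, h.weight s⟫ = 0 := by
    intro b hb hbp h0
    by_contra hne
    have hpos := lt_of_le_of_ne (h.weight_nonneg s hb hbp) (Ne.symm hne)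
    have := (h.inner_pos_iff hb hbp (fun a => (hsign a).1)).2 ⟨s, hpos, hspos⟩
    exact this.ne' h0
  obtain ⟨c, hc⟩ := hray.2 (h.weight s) (fun b hb h0 => by
    rcases h.pos_or_neg hb with hbp | hbp
    · exact key b hb hbp h0
    · have := key _ (neg_mem_roots hb) hbp (by rw [inner_neg_left, h0, neg_zero])
      simpa [inner_neg_left] using this)
  have hc0 : c ≠ 0 := by
    rintro rfl
    exact h.weight_ne_zero s (by simpa using hc)
  have hzero : ∀ t : simpleRoots W p, t ≠ s → ⟪(t : V), v'⟫ = 0 := by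
    intro t hts
    have h1 := h.inner_weight_ne hts
    rw [hc, inner_smul_right] at h1
    exact (mul_eq_zero.1 h1).resolve_left hc0
  refine ⟨u, s, ?_, fun t hts => (hsign t).2 (hzero t hts)⟩
  have hface : face W v' = face W (h.weight s) := by
    refine h.face_eq_of_dominant (fun a => (hsign a).1)
      (fun a => h.weight_nonneg s a.2.1 a.2.2.1) fun a => ?_
    by_cases has : a = s
    · rw [has, h.inner_weight_self]; simp [hspos]
    · rw [hzero a has, h.inner_weight_ne has]
  have := face_map u hface
  rwa [hv', Subgroup.coe_inv, map_inv_map] at this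

lemma weight_face_injective {s t : simpleRoots W p}
    (hst : face W (h.weight s) = face W (h.weight t)) :
    s = t := by
  by_contra hne
  have := (SignBand.ofReal_eq_cases (face_eq_iff.1 hst s s.2.1)).2.1
  rw [h.inner_weight_self, h.inner_weight_ne hne] at this
  simp at this

end IsRegularPoint

end ReflectionGroup

/-! ### Characters of a left regular band -/

section LeftRegularBand

open Polynomial

variable {M : Type*} [Monoid M] [DecidableEq M]

/-- The character of a left regular band attached to an element. -/
def bandCharacter (hM : ∀ x y : M, x * y * x = x * y) (G : M) : M →* ℝ where
  toFun F := if G * F = G then 1 else 0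
  map_one' := by simp
  map_mul' E F := by
    have hiff : G * (E * F) = G ↔ G * E = G ∧ G * F = G := by
      constructor
      · intro hG
        have h1 : G * E = G := by
          calc G * E = G * (E * F) * E := by rw [hG]
            _ = G * (E * F * E) := by simp only [mul_assoc]
            _ = G := by rw [hM, hG]
        refine ⟨h1, ?_⟩
        rwa [← mul_assoc, h1] at hG
      · rintro ⟨h1, h2⟩
        rw [← mul_assoc, h1, h2]
    by_cases h1 : G * E = G <;> by_cases h2 : G * F = G <;> simp [hiff, h1, h2]

/-- The character attached to `G` sends the sum over `R` to the number of elements of `R` that fix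
`G`; apply it to the relation. -/
lemma eval_fixCount_eq_zero (hM : ∀ x y : M, x * y * x = x * y) (R : Finset M) (G : M) {q : ℝ[X]}
    (hq : aeval (∑ F ∈ R, MonoidAlgebra.of ℝ M F) q = 0) : q.eval (fixCount R G : ℝ) = 0 := by
  have h1 : MonoidAlgebra.lift ℝ ℝ M (bandCharacter hM G) (∑ F ∈ R, MonoidAlgebra.of ℝ M F) =
      (fixCount R G : ℝ) := by
    rw [map_sum]
    simp only [MonoidAlgebra.lift_of]
    simp [bandCharacter, fixCount]
  have h2 := congrArg (MonoidAlgebra.lift ℝ ℝ M (bandCharacter hM G)) hq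
  rw [← Polynomial.aeval_algHom_apply, h1, map_zero] at h2
  simpa using h2

lemma coeff_mul_of [Fintype M] (c : MonoidAlgebra ℝ M) (G D : M) :
    (c * MonoidAlgebra.of ℝ M G).coeff D = ∑ F with F * G = D, c.coeff F := by
  induction c using MonoidAlgebra.induction_linear with
  | zero => simp
  | add x y hx hy => rw [add_mul, MonoidAlgebra.coeff_add, Finsupp.add_apply, hx, hy,
      ← Finset.sum_add_distrib]; rfl
  | single F r =>
    rw [MonoidAlgebra.of_apply, MonoidAlgebra.single_mul_single, mul_one]
    simp [Finsupp.single_apply, Finset.sum_ite_eq]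

end LeftRegularBand

/-! ### The Barr element as the sum of the rays -/

namespace ReflectionGroup

open scoped RealInnerProductSpace
open Arrangement Polynomial

variable {V : Type*} [NormedAddCommGroup V] [InnerProductSpace ℝ V] [FiniteDimensional ℝ V]
variable (W : Subgroup (V ≃ₗᵢ[ℝ] V)) {p : V}

/-- The rays of the reflection arrangement, in the monoid of faces. -/
def rayFaces [Finite W] : Finset (faceMonoid W) :=
  (Set.toFinite {F | ∃ v, IsRayVector (arrangement W) v ∧ face W v = F}).toFinset

variable {W}

lemma mem_rayFaces [Finite W] {F : faceMonoid W} :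
    F ∈ rayFaces W ↔ ∃ v, IsRayVector (arrangement W) v ∧ face W v = F := by
  simp [rayFaces]

lemma map_map_mul (u w : W) (x : V) :
    ((u * w : W) : V ≃ₗᵢ[ℝ] V) x = (u : V ≃ₗᵢ[ℝ] V) ((w : V ≃ₗᵢ[ℝ] V) x) := rfl

lemma map_map_inv (w : W) (x : V) : (w : V ≃ₗᵢ[ℝ] V) (((w⁻¹ : W) : V ≃ₗᵢ[ℝ] V) x) = x :=
  map_inv_map _ _

lemma exists_face_mul_face [Finite W] (x y : V) : ∃ z, face W x * face W y = face W z :=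
  let ⟨z, hz⟩ := exists_signVec_mul W x y
  ⟨z, Subtype.ext hz.symm⟩

namespace IsRegularPoint

variable (h : IsRegularPoint W p)
include h

section Faithful

variable [Finite W]

/-- The sum of a set of fundamental weights. -/
def weightSum (K : Finset (simpleRoots W p)) : V := ∑ a ∈ K, h.weight a

lemma inner_weightSum_mem {K : Finset (simpleRoots W p)} {a : simpleRoots W p} (ha : a ∈ K) :
    ⟪(a : V), h.weightSum K⟫ = 1 := by
  rw [weightSum, inner_sum, Finset.sum_eq_single_of_mem a ha, h.inner_weight_self]
  exact fun b _ hba => h.inner_weight_ne hba.symm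

lemma inner_weightSum_notMem {K : Finset (simpleRoots W p)} {a : simpleRoots W p} (ha : a ∉ K) :
    ⟪(a : V), h.weightSum K⟫ = 0 := by
  rw [weightSum, inner_sum]
  exact Finset.sum_eq_zero fun b hb => h.inner_weight_ne (fun e => ha (e ▸ hb))

lemma inner_weightSum_nonneg (K : Finset (simpleRoots W p)) (a : simpleRoots W p) :
    0 ≤ ⟪(a : V), h.weightSum K⟫ := by
  by_cases ha : a ∈ K
  · rw [h.inner_weightSum_mem ha]; norm_num
  · rw [h.inner_weightSum_notMem ha]

lemma exists_face_eq_weightSum {x : V} (hx : ∀ a : simpleRoots W p, 0 ≤ ⟪(a : V), x⟫) :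
    ∃ K : Finset (simpleRoots W p), face W x = face W (h.weightSum K) ∧
      ∀ a, a ∈ K ↔ 0 < ⟪(a : V), x⟫ := by
  classical
  have hK : ∀ a, a ∈ Finset.univ.filter (fun a : simpleRoots W p => 0 < ⟪(a : V), x⟫) ↔
    0 < ⟪(a : V), x⟫ := by simp
  refine ⟨_, h.face_eq_of_dominant hx (h.inner_weightSum_nonneg _) fun a => ?_, hK⟩
  by_cases ha : 0 < ⟪(a : V), x⟫
  · rw [h.inner_weightSum_mem ((hK a).2 ha)]; simp [ha]
  · rw [h.inner_weightSum_notMem ((hK a).not.2 ha)]; simp [not_lt.1 ha]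

/-- The algebra of the monoid of faces acts faithfully on the chambers. -/
theorem eq_zero_of_mul_chamber_eq_zero (c : MonoidAlgebra ℝ (faceMonoid W))
    (hc : ∀ u : W, c * MonoidAlgebra.of ℝ _ (face W ((u : V ≃ₗᵢ[ℝ] V) p)) = 0) : c = 0 := by
  classical
  have := Fintype.ofFinite (faceMonoid W)
  -- Every face has the form `w` applied to a sum of weights over some `K`. The induction is on the
  -- codimension, so larger `K` come first.
  have key : ∀ (w : W) (K : Finset (simpleRoots W p)),
      c.coeff (face W ((w : V ≃ₗᵢ[ℝ] V) (h.weightSum K))) = 0 := by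
    intro w K
    induction hn : (Kᶜ).card using Nat.strong_induction_on generalizing K with
    | _ n ih =>
    subst hn
    -- The chamber `u` is separated from `w` by the walls in `K` and not by those outside `K`. A
    -- face which multiplies `u` to `w` must be positive on the walls in `K` and nonnegative on the
    -- others, so it belongs to some `L ⊇ K`. By induction only `L = K` contributes to the
    -- coefficient of `w`.
    obtain ⟨u, hu⟩ := h.exists_face_mul_chamber ((w : V ≃ₗᵢ[ℝ] V) (h.weightSum Kᶜ))
      (y := (w : V ≃ₗᵢ[ℝ] V) (-p)) (fun a ha => by
        rw [inner_map_inv, inner_neg_right, neg_ne_zero]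
        exact h.ne_zero _ (map_mem_roots (W.inv_mem w.2) ha))
    have h1 := coeff_mul_of c (face W ((u : V ≃ₗᵢ[ℝ] V) p)) (face W ((w : V ≃ₗᵢ[ℝ] V) p))
    rw [hc, Finset.sum_eq_single (face W ((w : V ≃ₗᵢ[ℝ] V) (h.weightSum K)))] at h1
    · simpa using h1.symm
    · intro F hF hne
      rw [Finset.mem_filter] at hF
      obtain ⟨v, rfl⟩ := face_surjective F
      have hF2 := hF.2
      rw [← hu] at hF2
      have hsign : ∀ a : simpleRoots W p, 0 ≤ ⟪(a : V), ((w⁻¹ : W) : V ≃ₗᵢ[ℝ] V) v⟫ ∧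
          (a ∈ K → 0 < ⟪(a : V), ((w⁻¹ : W) : V ≃ₗᵢ[ℝ] V) v⟫) := by
        intro a
        have h2 : SignBand.ofReal ⟪(w : V ≃ₗᵢ[ℝ] V) a, v⟫ *
            (SignBand.ofReal ⟪(w : V ≃ₗᵢ[ℝ] V) a, (w : V ≃ₗᵢ[ℝ] V) (h.weightSum Kᶜ)⟫ *
              SignBand.ofReal ⟪(w : V ≃ₗᵢ[ℝ] V) a, (w : V ≃ₗᵢ[ℝ] V) (-p)⟫) =
            SignBand.ofReal ⟪(w : V ≃ₗᵢ[ℝ] V) a, (w : V ≃ₗᵢ[ℝ] V) p⟫ :=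
          congrFun (congrArg Subtype.val hF2) ⟨_, map_mem_roots w.2 a.2.1⟩
        rw [LinearIsometryEquiv.inner_map_map, LinearIsometryEquiv.inner_map_map,
          LinearIsometryEquiv.inner_map_map, inner_map_eq] at h2
        have hap := a.2.2.1
        by_cases h0 : ⟪(a : V), (w : V ≃ₗᵢ[ℝ] V)⁻¹ v⟫ = 0
        · refine ⟨h0.ge, fun haK => ?_⟩
          rw [SignBand.mul_of_eq_one (SignBand.ofReal_eq_one_iff.2 h0),
            h.inner_weightSum_notMem (by simpa using haK),
            SignBand.mul_of_eq_one (SignBand.ofReal_eq_one_iff.2 rfl), inner_neg_right] at h2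
          have := (SignBand.ofReal_eq_cases h2).1.2 hap
          linarith
        · rw [SignBand.mul_of_ne_one (fun e => h0 (SignBand.ofReal_eq_one_iff.1 e))] at h2
          have := (SignBand.ofReal_eq_cases h2).1.2 hap
          exact ⟨this.le, fun _ => this⟩
      obtain ⟨L, hL, hmem⟩ := h.exists_face_eq_weightSum fun a => (hsign a).1
      have hL' := face_map w hL
      rw [map_map_inv] at hL'
      rw [hL'] at hne ⊢
      refine ih _ ?_ L rfl
      have hKL : K ⊆ L := fun a ha => (hmem a).2 ((hsign a).2 ha)
      have hKL' : K ⊂ L := hKL.ssubset_of_ne fun e => hne (by rw [e])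
      exact Finset.card_lt_card (Finset.compl_ssubset_compl.2 hKL')
    · intro hF
      exfalso
      apply hF
      rw [Finset.mem_filter]
      refine ⟨Finset.mem_univ _, ?_⟩
      rw [← hu]
      obtain ⟨z, hz⟩ := exists_face_mul_face (W := W) ((w : V ≃ₗᵢ[ℝ] V) (h.weightSum Kᶜ))
        ((w : V ≃ₗᵢ[ℝ] V) (-p))
      obtain ⟨z', hz'⟩ := exists_face_mul_face (W := W) ((w : V ≃ₗᵢ[ℝ] V) (h.weightSum K)) z
      rw [hz, hz', h.face_eq_chamber_iff]
      intro a
      have h2 := face_mul_eq_iff.1 hz' _ (map_mem_roots w.2 a.2.1)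
      have h3 := face_mul_eq_iff.1 hz _ (map_mem_roots w.2 a.2.1)
      rw [LinearIsometryEquiv.inner_map_map] at h2 h3
      by_cases haK : a ∈ K
      · rw [h.inner_weightSum_mem haK, SignBand.mul_of_ne_one
          (fun e => one_ne_zero (SignBand.ofReal_eq_one_iff.1 e))] at h2
        exact (SignBand.ofReal_eq_cases h2).1.1 one_pos
      · rw [h.inner_weightSum_notMem haK,
          SignBand.mul_of_eq_one (SignBand.ofReal_eq_one_iff.2 rfl)] at h2
        rw [h.inner_weightSum_mem (by simpa using haK), SignBand.mul_of_ne_one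
          (fun e => one_ne_zero (SignBand.ofReal_eq_one_iff.1 e)), h2] at h3
        exact (SignBand.ofReal_eq_cases h3).1.1 one_pos
  ext F
  obtain ⟨v, rfl⟩ := face_surjective F
  obtain ⟨w, hw, hpos⟩ := h.exists_map_nonneg v
  obtain ⟨K, hK, -⟩ := h.exists_face_eq_weightSum (x := w v) fun a => hpos a a.2.1 a.2.2.1
  have := face_map (⟨w, hw⟩⁻¹ : W) hK
  rw [Subgroup.coe_inv, inv_map_map] at this
  rw [this, ← Subgroup.coe_inv, key]
  rfl

end Faithful

variable [Fintype W]

lemma descentSet_subset_iff (u : W) (s : simpleRoots W p) :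
    descentSet (simpleReflections W p) u ⊆ {simpleRefl s} ↔
      ∀ t : simpleRoots W p, t ≠ s → 0 < ⟪(u : V ≃ₗᵢ[ℝ] V) t, p⟫ := by
  constructor
  · intro hu t hts
    by_contra hneg
    have hlt := lt_of_le_of_ne (not_lt.1 hneg) (h.ne_zero _ (map_mem_roots u.2 t.2.1))
    have : simpleRefl t = simpleRefl s :=
      hu ⟨simpleRefl_mem t, (h.wordLength_mul_lt_iff u t).2 hlt⟩
    have := congrArg Subtype.val this
    rcases eq_or_eq_neg_of_refl_eq s.2.1.1 t.2.1.1 this.symm with e | e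
    · exact hts (Subtype.ext e)
    · have h1 := t.2.2.1
      rw [e, inner_neg_left] at h1
      linarith [s.2.2.1]
  · rintro hu x ⟨⟨t, ht, hx⟩, hlt⟩
    have hx' : x = simpleRefl ⟨t, ht⟩ := Subtype.ext hx
    rw [hx', h.wordLength_mul_lt_iff] at hlt
    by_cases hts : (⟨t, ht⟩ : simpleRoots W p) = s
    · rw [← hts]; exact hx'
    · exact absurd (hu _ hts) hlt.asymm

open Classical in
lemma barrElement_eq : barrElement (simpleReflections W p) =
    ∑ s : simpleRoots W p, ∑ u : W with ∀ t : simpleRoots W p, t ≠ s →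
      0 < ⟪((u : W) : V ≃ₗᵢ[ℝ] V) t, p⟫, MonoidAlgebra.of ℝ W u := by
  symm
  refine Finset.sum_nbij simpleRefl ?_ ?_ ?_ ?_
  · intro s _
    exact Finset.mem_filter.2 ⟨Finset.mem_univ _, simpleRefl_mem s⟩
  · intro s _ t _ hst
    rcases eq_or_eq_neg_of_refl_eq s.2.1.1 t.2.1.1 (congrArg Subtype.val hst) with e | e
    · exact Subtype.ext e.symm
    · have h1 := t.2.2.1
      rw [e, inner_neg_left] at h1
      linarith [s.2.2.1]
  · intro x hx
    obtain ⟨t, ht, hxt⟩ := (Finset.mem_filter.1 hx).2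
    exact ⟨⟨t, ht⟩, by simp, Subtype.ext hxt.symm⟩
  · intro s _
    rw [descentSum]
    refine Finset.sum_congr (Finset.filter_congr fun u _ => ?_) fun _ _ => rfl
    exact (h.descentSet_subset_iff u s).symm

/-- The linear map from the group algebra to the algebra of the monoid of faces which sends group
elements to chambers. -/
def chamberMap (_ : IsRegularPoint W p) : MonoidAlgebra ℝ W →ₗ[ℝ] MonoidAlgebra ℝ (faceMonoid W) :=
  MonoidAlgebra.mapDomainLinearMap ℝ ℝ fun w : W => face W ((w : V ≃ₗᵢ[ℝ] V) p)

lemma chamberMap_of (w : W) : h.chamberMap (MonoidAlgebra.of ℝ W w) =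
    MonoidAlgebra.of ℝ _ (face W ((w : V ≃ₗᵢ[ℝ] V) p)) := by
  simp [chamberMap]

lemma chamberMap_injective : Function.Injective h.chamberMap :=
  MonoidAlgebra.mapDomain_injective h.face_map_injective

/-- The sum of the rays acts on chambers as right multiplication by the Barr element. -/
lemma sum_rayFaces_mul_chamberMap (x : MonoidAlgebra ℝ W) :
    (∑ F ∈ rayFaces W, MonoidAlgebra.of ℝ (faceMonoid W) F) * h.chamberMap x =
      h.chamberMap (x * barrElement (simpleReflections W p)) := by
  classical
  have key : ∀ w : W, (∑ F ∈ rayFaces W, MonoidAlgebra.of ℝ (faceMonoid W) F) *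
      h.chamberMap (MonoidAlgebra.of ℝ W w) =
      h.chamberMap (MonoidAlgebra.of ℝ W w * barrElement (simpleReflections W p)) := by
    intro w
    rw [h.chamberMap_of, h.barrElement_eq, Finset.mul_sum, map_sum, Finset.sum_mul]
    simp only [Finset.mul_sum, map_sum, ← map_mul, h.chamberMap_of]
    rw [Finset.sum_sigma']
    symm
    -- The pair `(s, u)` corresponds to the ray through `w u` applied to the weight of `s`;
    -- `face_weight_mul`, moved by `w`, identifies the two terms.
    refine Finset.sum_bij (fun x _ => face W (((w * x.2 : W) : V ≃ₗᵢ[ℝ] V) (h.weight x.1)))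
      ?_ ?_ ?_ ?_
    · rintro ⟨s, u⟩ _
      exact mem_rayFaces.2 ⟨_, isRayVector_map _ (h.isRayVector_weight s), rfl⟩
    · rintro ⟨s, u⟩ hs ⟨t, u'⟩ ht heq
      simp only [Finset.mem_sigma, Finset.mem_univ, Finset.mem_filter, true_and] at hs ht
      have h0 := face_map w⁻¹ heq
      simp only [map_map_mul, Subgroup.coe_inv, inv_map_map] at h0
      -- The ray recovers `u` through its product with the base chamber, and then `s`.
      have h1 := h.face_weight_mul u s hs
      have h2 := h.face_weight_mul u' t ht
      rw [h0] at h1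
      have huu : u = u' := h.face_map_injective (h1.symm.trans h2)
      subst huu
      have h3 := face_map u⁻¹ h0
      rw [Subgroup.coe_inv, inv_map_map, inv_map_map] at h3
      rw [h.weight_face_injective h3]
    · intro F hF
      obtain ⟨v, hv, rfl⟩ := mem_rayFaces.1 hF
      obtain ⟨u, s, hus, hu⟩ := h.exists_face_eq_weight (isRayVector_map w⁻¹ hv)
      refine ⟨⟨s, u⟩, by simpa using hu, ?_⟩
      have := face_map w hus
      rw [map_map_inv] at this
      rw [this, map_map_mul]
    · rintro ⟨s, u⟩ hs
      simp only [Finset.mem_sigma, Finset.mem_univ, Finset.mem_filter, true_and] at hs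
      have := face_mul_map w (h.face_weight_mul u s hs)
      rw [map_map_mul, map_map_mul, this]
  induction x using MonoidAlgebra.induction_linear with
  | zero => simp
  | add x y hx hy => rw [map_add, mul_add, hx, hy, add_mul, map_add]
  | single w r =>
    have : MonoidAlgebra.single w r = r • MonoidAlgebra.of ℝ W w := by simp
    rw [this, map_smul, mul_smul_comm, key, smul_mul_assoc, map_smul]

lemma aeval_sum_rayFaces_mul_chamberMap (q : ℝ[X]) (x : MonoidAlgebra ℝ W) :
    aeval (∑ F ∈ rayFaces W, MonoidAlgebra.of ℝ (faceMonoid W) F) q * h.chamberMap x =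
      h.chamberMap (x * aeval (barrElement (simpleReflections W p)) q) := by
  induction q using Polynomial.induction_on generalizing x with
  | C r => rw [aeval_C, aeval_C, ← Algebra.smul_def, ← Algebra.commutes, ← Algebra.smul_def,
      map_smul]
  | add q q' hq hq' => rw [map_add, add_mul, hq, hq', map_add, mul_add, map_add]
  | monomial n r hn =>
    rw [pow_succ, ← mul_assoc, map_mul, aeval_X, mul_assoc, h.sum_rayFaces_mul_chamberMap, hn,
      mul_assoc, mul_comm (C r * X ^ n) X, map_mul (aeval (barrElement _)) X, aeval_X]

/-- The Barr element and the sum of the rays satisfy the same polynomial equations. -/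
lemma aeval_barrElement_eq_zero_iff (q : ℝ[X]) :
    aeval (barrElement (simpleReflections W p)) q = 0 ↔
      aeval (∑ F ∈ rayFaces W, MonoidAlgebra.of ℝ (faceMonoid W) F) q = 0 := by
  constructor
  · intro hq
    refine h.eq_zero_of_mul_chamber_eq_zero _ fun u => ?_
    rw [← h.chamberMap_of, h.aeval_sum_rayFaces_mul_chamberMap, hq, mul_zero, map_zero]
  · intro hq
    have := h.aeval_sum_rayFaces_mul_chamberMap q 1
    rw [hq, zero_mul, one_mul] at this
    exact h.chamberMap_injective (by rw [← this, map_zero])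

end IsRegularPoint

end ReflectionGroup

/-- Two maps with the same fibres on `s` have images of equal size. Rays are counted as faces, as
half-lines and in coordinates, and this compares the counts. -/
lemma Set.ncard_image_congr {α β γ : Type*} {f : α → β} {g : α → γ} {s : Set α}
    (h : ∀ x ∈ s, ∀ y ∈ s, f x = f y ↔ g x = g y) : (f '' s).ncard = (g '' s).ncard := by
  refine Set.ncard_congr (fun _ hb => g hb.choose) ?_ ?_ ?_
  · intro b hb
    exact ⟨_, hb.choose_spec.1, rfl⟩
  · intro b c hb hc hbc
    rw [← hb.choose_spec.2, ← hc.choose_spec.2]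
    exact (h _ hb.choose_spec.1 _ hc.choose_spec.1).2 hbc
  · rintro _ ⟨x, hx, rfl⟩
    have hb : f x ∈ f '' s := ⟨x, hx, rfl⟩
    exact ⟨f x, hb, (h _ hb.choose_spec.1 _ hx).1 hb.choose_spec.2⟩

/-! ### Rays as half-lines, and the rays of a restriction -/

namespace Arrangement

variable {E : Type*} [AddCommGroup E] [Module ℝ E]

/-- The closed half-line spanned by `v`. -/
def halfLine (v : E) : Set E := {x | ∃ c : ℝ, 0 ≤ c ∧ x = c • v}

lemma self_mem_halfLine (v : E) : v ∈ halfLine v := ⟨1, zero_le_one, (one_smul _ _).symm⟩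

lemma halfLine_eq_iff {v w : E} (hv : v ≠ 0) :
    halfLine v = halfLine w ↔ ∃ c : ℝ, 0 < c ∧ v = c • w := by
  constructor
  · intro h
    obtain ⟨c, hc, rfl⟩ : v ∈ halfLine w := h ▸ self_mem_halfLine v
    refine ⟨c, lt_of_le_of_ne hc ?_, rfl⟩
    rintro rfl
    simp at hv
  · rintro ⟨c, hc, rfl⟩
    ext x
    constructor
    · rintro ⟨d, hd, rfl⟩
      exact ⟨d * c, mul_nonneg hd hc.le, smul_smul _ _ _⟩
    · rintro ⟨d, hd, rfl⟩
      exact ⟨d * c⁻¹, mul_nonneg hd (inv_nonneg.2 hc.le), by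
        rw [smul_smul, mul_assoc, inv_mul_cancel₀ hc.ne', mul_one]⟩

lemma support_eq (A : Set (Submodule ℝ E)) (F : Set E) :
    support A F = sInf {H ∈ A | F ⊆ H} := by
  apply le_antisymm
  · refine sInf_le ⟨⟨_, Set.sep_subset _ _, rfl⟩, fun x hx => ?_⟩
    rw [SetLike.mem_coe, Submodule.mem_sInf]
    exact fun H hH => hH.2 hx
  · refine le_sInf ?_
    rintro _ ⟨⟨B, hB, rfl⟩, hF⟩
    exact le_sInf fun H hH => sInf_le ⟨hB hH, hF.trans fun x hx =>
      (Submodule.mem_sInf.1 hx) H hH⟩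

/-- The rays of an essential arrangement are the half-lines of its ray vectors. -/
lemma setOf_rays_eq {A : Set (Submodule ℝ E)}
    (hker : ∀ H ∈ A, ∃ f : E →ₗ[ℝ] ℝ, LinearMap.ker f = H) (hess : sInf A = ⊥) :
    {F | IsFace A F ∧ faceDim A F = 1} = halfLine '' {v | IsRayVector A v} := by
  classical
  have hzero : ∀ v : E, (∀ H ∈ A, v ∈ H) → v = 0 := fun v hv => by
    have : v ∈ sInf A := Submodule.mem_sInf.2 hv
    rw [hess] at this
    simpa using this
  ext F
  constructor
  · rintro ⟨⟨t, ht, rfl⟩, hdim⟩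
    set F := ⋂ H ∈ A, t H with hF
    have hmem : ∀ x, x ∈ F ↔ ∀ H ∈ A, x ∈ t H := fun x => by simp [hF]
    have hsmul : ∀ x ∈ F, ∀ c : ℝ, 0 ≤ c → c • x ∈ F := by
      intro x hx c hc
      rw [hmem] at hx ⊢
      intro H hH
      have := hx H hH
      rcases ht H hH with h | ⟨f, hf, h⟩
      · rw [h] at this ⊢; exact H.smul_mem c this
      · rw [h] at this ⊢
        simp only [Set.mem_ofPred_eq, map_smul, smul_eq_mul] at this ⊢
        positivity
    have hexists : ∃ v ∈ F, v ≠ 0 := by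
      by_contra! hall
      have hbot : support A F = ⊥ := by
        rw [eq_bot_iff, support_eq, ← hess]
        refine le_sInf fun H hH => sInf_le ⟨hH, fun x hx => ?_⟩
        rw [hall x hx]; exact H.zero_mem
      rw [faceDim, hbot, finrank_bot] at hdim
      exact zero_ne_one hdim
    obtain ⟨v, hvF, hv0⟩ := hexists
    have hsub : ∀ x ∈ F, x ∈ support A F := fun x hx => by
      rw [support_eq, Submodule.mem_sInf]; exact fun H hH => hH.2 hx
    have hline : ∀ x ∈ support A F, ∃ c : ℝ, x = c • v := by
      intro x hx
      obtain ⟨c, hc⟩ := (finrank_eq_one_iff_of_nonzero' (⟨v, hsub v hvF⟩ : support A F)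
        (by simpa using hv0)).1 hdim ⟨x, hx⟩
      exact ⟨c, (congrArg Subtype.val hc).symm⟩
    have hFhalf : F = halfLine v := by
      ext x
      constructor
      · intro hx
        obtain ⟨c, rfl⟩ := hline x (hsub x hx)
        by_cases hc : 0 ≤ c
        · exact ⟨c, hc, rfl⟩
        exfalso
        -- If `F` contains `v` and a negative multiple of `v`, every half-space condition forces `v`
        -- into its hyperplane, against essentiality.
        refine hv0 (hzero v fun H hH => ?_)
        have h1 := (hmem _).1 hvF H hH
        have h2 := (hmem _).1 hx H hH
        rcases ht H hH with h | ⟨f, hf, h⟩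
        · rw [h] at h1; exact h1
        · rw [h] at h1 h2
          simp only [Set.mem_ofPred_eq, map_smul, smul_eq_mul] at h1 h2
          rw [← hf, LinearMap.mem_ker]
          nlinarith
      · rintro ⟨c, hc, rfl⟩
        exact hsmul v hvF c hc
    refine ⟨v, ⟨hv0, fun x hx => hline x ?_⟩, hFhalf.symm⟩
    rw [support_eq, Submodule.mem_sInf]
    exact fun H hH => hx H hH.1 (hH.2 hvF)
  · rintro ⟨v, ⟨hv0, hv⟩, rfl⟩
    choose! f hf using hker
    have hsupp : support A (halfLine v) = ℝ ∙ v := by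
      rw [support_eq]
      apply le_antisymm
      · intro x hx
        rw [Submodule.mem_sInf] at hx
        obtain ⟨c, rfl⟩ := hv x fun H hH hvH => hx H ⟨hH, by
          rintro _ ⟨c, _, rfl⟩; exact H.smul_mem c hvH⟩
        exact Submodule.smul_mem _ _ (Submodule.mem_span_singleton_self v)
      · rw [Submodule.span_singleton_le_iff_mem, Submodule.mem_sInf]
        exact fun H hH => hH.2 (self_mem_halfLine v)
    -- Scaling the form by its value at `v` selects the half-space which contains `v`.
    refine ⟨⟨fun H => if v ∈ H then (H : Set E) else {x | 0 ≤ (f H v • f H) x}, ?_, ?_⟩, ?_⟩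
    · intro H hH
      by_cases hvH : v ∈ H
      · left; simp [hvH]
      · right
        refine ⟨f H v • f H, ?_, by simp [hvH]⟩
        have h0 : f H v ≠ 0 := fun h0 => hvH (by rw [← hf H hH]; exact h0)
        rw [LinearMap.ker_smul _ _ h0, hf H hH]
    · ext x
      simp only [Set.mem_iInter]
      constructor
      · rintro ⟨c, hc, rfl⟩ H hH
        split_ifs with hvH
        · exact H.smul_mem c hvH
        · simp only [Set.mem_ofPred_eq, LinearMap.smul_apply, map_smul, smul_eq_mul]
          nlinarith [mul_nonneg hc (mul_self_nonneg (f H v))]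
      · intro hx
        obtain ⟨c, rfl⟩ := hv x fun H hH hvH => by
          have := hx H hH
          rw [if_pos hvH] at this; exact this
        obtain ⟨H, hH, hvH⟩ : ∃ H ∈ A, v ∉ H := by
          by_contra! hall
          exact hv0 (hzero v hall)
        refine ⟨c, ?_, rfl⟩
        have h1 := hx H hH
        rw [if_neg hvH] at h1
        simp only [Set.mem_ofPred_eq, LinearMap.smul_apply, map_smul, smul_eq_mul] at h1
        have h0 : f H v ≠ 0 := fun h0 => hvH (by rw [← hf H hH]; exact h0)
        by_contra! hc
        nlinarith [mul_self_pos.2 h0]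
    · rw [faceDim, hsupp, finrank_span_singleton hv0]

/-- Hyperplanes containing `X` impose no condition inside `X`. Conversely, `X` is an intersection of
hyperplanes through `v`, so the intersection of all of them already lies in `X`. -/
lemma isRayVector_restriction_iff {A : Set (Submodule ℝ E)} {X : Submodule ℝ E} (hX : IsFlat A X)
    (v : X) : IsRayVector (restriction A X) v ↔ IsRayVector A (v : E) := by
  obtain ⟨B, hB, hXB⟩ := hX
  refine and_congr (by simp) ⟨fun hv x hx => ?_, fun hv x hx => ?_⟩
  · have hxX : x ∈ X := by
      rw [hXB, Submodule.mem_sInf]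
      exact fun H hH => hx H (hB hH) (by
        exact (Submodule.mem_sInf.1 (hXB.le v.2)) H hH)
    obtain ⟨c, hc⟩ := hv ⟨x, hxX⟩ (by
      rintro _ ⟨H, hH, -, rfl⟩ hvH
      exact hx H hH hvH)
    exact ⟨c, congrArg Subtype.val hc⟩
  · obtain ⟨c, hc⟩ := hv x (fun H hH hvH => by
      by_cases hXH : X ≤ H
      · exact hXH x.2
      · exact hx _ ⟨H, hH, hXH, rfl⟩ hvH)
    exact ⟨c, Subtype.ext hc⟩

/-- The number of half-lines in `X` which are rays of `A`. -/
def rayCount (A : Set (Submodule ℝ E)) (X : Submodule ℝ E) : ℕ :=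
  (halfLine '' {v | v ∈ X ∧ IsRayVector A v}).ncard

lemma numRays_restriction {A : Set (Submodule ℝ E)}
    (hker : ∀ H ∈ A, ∃ f : E →ₗ[ℝ] ℝ, LinearMap.ker f = H) (hess : sInf A = ⊥)
    {X : Submodule ℝ E} (hX : IsFlat A X) : numRays (restriction A X) = rayCount A X := by
  have h1 : ∀ K ∈ restriction A X, ∃ f : X →ₗ[ℝ] ℝ, LinearMap.ker f = K := by
    rintro _ ⟨H, hH, -, rfl⟩
    obtain ⟨f, rfl⟩ := hker H hH
    exact ⟨f.comp X.subtype, LinearMap.ker_comp _ _⟩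
  have h2 : sInf (restriction A X) = ⊥ := by
    rw [Submodule.eq_bot_iff]
    intro x hx
    rw [Submodule.mem_sInf] at hx
    have : (x : E) ∈ sInf A := by
      rw [Submodule.mem_sInf]
      intro H hH
      by_cases hXH : X ≤ H
      · exact hXH x.2
      · exact hx _ ⟨H, hH, hXH, rfl⟩
    rw [hess] at this
    simpa using this
  rw [numRays, setOf_rays_eq h1 h2, rayCount]
  rw [← Set.ncard_image_of_injective _ (Set.image_injective.2
    (Subtype.val_injective (p := (· ∈ X))))]
  congr 1
  ext F
  constructor
  · rintro ⟨_, ⟨v, hv, rfl⟩, rfl⟩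
    refine ⟨v, ⟨v.2, (isRayVector_restriction_iff hX v).1 hv⟩, ?_⟩
    ext x
    constructor
    · rintro ⟨c, hc, rfl⟩
      exact ⟨c • v, ⟨c, hc, rfl⟩, rfl⟩
    · rintro ⟨_, ⟨c, hc, rfl⟩, rfl⟩
      exact ⟨c, hc, rfl⟩
  · rintro ⟨v, ⟨hvX, hv⟩, rfl⟩
    refine ⟨_, ⟨⟨v, hvX⟩, (isRayVector_restriction_iff hX _).2 hv, rfl⟩, ?_⟩
    ext x
    constructor
    · rintro ⟨_, ⟨c, hc, rfl⟩, rfl⟩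
      exact ⟨c, hc, rfl⟩
    · rintro ⟨c, hc, rfl⟩
      exact ⟨c • ⟨v, hvX⟩, ⟨c, hc, rfl⟩, rfl⟩

end Arrangement

/-! ### Ray counts of flats and the eigenvalues of the Barr element -/

namespace ReflectionGroup

open scoped RealInnerProductSpace
open Arrangement Polynomial

variable {V : Type*} [NormedAddCommGroup V] [InnerProductSpace ℝ V] [FiniteDimensional ℝ V]
variable {W : Subgroup (V ≃ₗᵢ[ℝ] V)} {p : V}

lemma exists_ker_eq_of_mem_arrangement {H : Submodule ℝ V} (hH : H ∈ arrangement W) :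
    ∃ f : V →ₗ[ℝ] ℝ, LinearMap.ker f = H := by
  obtain ⟨a, -, rfl⟩ := mem_arrangement_iff.1 hH
  refine ⟨innerₗ V a, ?_⟩
  ext x
  rw [mem_orthogonal_singleton]; rfl

variable (W) in
/-- The smallest flat which contains `x`. -/
def flatOf (x : V) : Submodule ℝ V := sInf {H ∈ arrangement W | x ∈ H}

lemma isFlat_flatOf (x : V) : IsFlat (arrangement W) (flatOf W x) := ⟨_, Set.sep_subset _ _, rfl⟩

lemma mem_flatOf {x v : V} : v ∈ flatOf W x ↔ ∀ a ∈ roots W, ⟪a, x⟫ = 0 → ⟪a, v⟫ = 0 := by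
  rw [flatOf, Submodule.mem_sInf]
  constructor
  · intro hv a ha hax
    exact mem_orthogonal_singleton.1 (hv _ ⟨mem_arrangement_iff.2 ⟨a, ha, rfl⟩,
      mem_orthogonal_singleton.2 hax⟩)
  · rintro hv H ⟨hH, hxH⟩
    obtain ⟨a, ha, rfl⟩ := mem_arrangement_iff.1 hH
    exact mem_orthogonal_singleton.2 (hv a ha (mem_orthogonal_singleton.1 hxH))

namespace IsRegularPoint

variable (h : IsRegularPoint W p) [Finite W]
include h

/-- Equal signs put both vectors on the same hyperplanes, so they are proportional; a root that does
not vanish on them shows that the factor is positive. -/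
lemma face_eq_iff_halfLine {v w : V} (hv : IsRayVector (arrangement W) v)
    (hw : IsRayVector (arrangement W) w) : face W v = face W w ↔ halfLine v = halfLine w := by
  rw [halfLine_eq_iff hv.1, face_eq_iff]
  constructor
  · intro hvw
    obtain ⟨c, hc⟩ := (isRayVector_iff.1 hw).2 v fun a ha h0 =>
      (SignBand.ofReal_eq_cases (hvw a ha)).2.1.2 h0
    refine ⟨c, ?_, hc⟩
    obtain ⟨a, ha, ha0⟩ : ∃ a ∈ roots W, ⟪a, w⟫ ≠ 0 := by
      by_contra! hall
      exact hw.1 (h.eq_zero_of_roots hall)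
    have hs := SignBand.ofReal_eq_cases (hvw a ha)
    rw [hc, inner_smul_right] at hs
    rcases lt_or_gt_of_ne ha0 with hneg | hpos
    · have := hs.2.2.2 hneg; nlinarith
    · have := hs.1.2 hpos; nlinarith
  · rintro ⟨c, hc, rfl⟩ a _
    rw [inner_smul_right, SignBand.ofReal_eq_iff, sign_mul, sign_pos hc, one_mul]

open Classical in
lemma fixCount_rayFaces (x : V) :
    fixCount (rayFaces W) (face W x) = rayCount (arrangement W) (flatOf W x) := by
  rw [rayCount, ← Set.ncard_image_congr (f := face W) (fun v hv w hw =>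
    h.face_eq_iff_halfLine hv.2 hw.2),
    fixCount, ← Set.ncard_coe_finset]
  congr 1
  ext F
  simp only [Finset.coe_filter, Set.mem_ofPred_eq, mem_rayFaces, Set.mem_image]
  constructor
  · rintro ⟨⟨v, hv, rfl⟩, hF⟩
    exact ⟨v, ⟨mem_flatOf.2 (face_mul_eq_left_iff.1 hF), hv⟩, rfl⟩
  · rintro ⟨v, ⟨hvX, hv⟩, rfl⟩
    exact ⟨⟨v, hv, rfl⟩, face_mul_eq_left_iff.2 (mem_flatOf.1 hvX)⟩

/-- A positive root has nonnegative coefficients, so if it vanishes on the sum over `K`, it is a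
combination of simple roots outside `K`. -/
lemma mem_flatOf_weightSum {K : Finset (simpleRoots W p)} {v : V} :
    v ∈ flatOf W (h.weightSum K) ↔ ∀ t : simpleRoots W p, t ∉ K → ⟪(t : V), v⟫ = 0 := by
  rw [mem_flatOf]
  constructor
  · intro hv t ht
    exact hv t t.2.1 (h.inner_weightSum_notMem ht)
  · intro hv
    have key : ∀ b ∈ roots W, 0 < ⟪b, p⟫ → ⟪b, h.weightSum K⟫ = 0 → ⟪b, v⟫ = 0 := by
      intro b hb hbp h0
      rw [h.inner_eq_sum b v]
      refine Finset.sum_eq_zero fun t _ => ?_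
      by_cases ht : t ∈ K
      · have hnot := (h.inner_pos_iff hb hbp (h.inner_weightSum_nonneg K)).not.1 (by rw [h0]; simp)
        push Not at hnot
        have h1 : ⟪b, h.weight t⟫ = 0 := by
          by_contra hne
          have := hnot t (lt_of_le_of_ne (h.weight_nonneg t hb hbp) (Ne.symm hne))
          rw [h.inner_weightSum_mem ht] at this
          linarith
        rw [h1, zero_mul]
      · rw [hv t ht, mul_zero]
    intro b hb h0
    rcases h.pos_or_neg hb with hbp | hbp
    · exact key b hb hbp h0
    · have := key _ (neg_mem_roots hb) hbp (by rw [inner_neg_left, h0, neg_zero])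
      simpa [inner_neg_left] using this

lemma linearIndependent_weight : LinearIndependent ℝ h.weight := by
  rw [linearIndependent_iff']
  intro s g hg t ht
  have := congrArg (fun x => ⟪(t : V), x⟫) hg
  simp only [inner_sum, inner_smul_right, inner_zero_right] at this
  rw [Finset.sum_eq_single_of_mem t ht (fun b _ hbt => by
    rw [h.inner_weight_ne (Ne.symm hbt), mul_zero]), h.inner_weight_self, mul_one] at this
  exact this

lemma finrank_flatOf_weightSum (K : Finset (simpleRoots W p)) :
    Module.finrank ℝ (flatOf W (h.weightSum K)) = K.card := by
  have hspan : flatOf W (h.weightSum K) = Submodule.span ℝ (Set.range fun t : K => h.weight t) := by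
    apply le_antisymm
    · intro v hv
      rw [h.mem_flatOf_weightSum] at hv
      rw [h.eq_sum_weight v]
      refine Submodule.sum_mem _ fun t _ => ?_
      by_cases ht : t ∈ K
      · exact Submodule.smul_mem _ _ (Submodule.subset_span ⟨⟨t, ht⟩, rfl⟩)
      · rw [hv t ht, zero_smul]; exact Submodule.zero_mem _
    · rw [Submodule.span_le]
      rintro _ ⟨⟨t, ht⟩, rfl⟩
      rw [SetLike.mem_coe, h.mem_flatOf_weightSum]
      exact fun s hs => h.inner_weight_ne fun e => hs (e ▸ ht)
  rw [hspan, finrank_span_eq_card (b := fun t : K => h.weight t)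
    (h.linearIndependent_weight.comp (Subtype.val : K → _) Subtype.val_injective), Fintype.card_coe]

/-- The ray of a weight in `L` but not in `K` is in the larger flat only. -/
lemma rayCount_lt_rayCount {K L : Finset (simpleRoots W p)} (hKL : K ⊂ L) :
    rayCount (arrangement W) (flatOf W (h.weightSum K)) <
      rayCount (arrangement W) (flatOf W (h.weightSum L)) := by
  classical
  rw [← h.fixCount_rayFaces, ← h.fixCount_rayFaces]
  obtain ⟨t, htL, htK⟩ := Finset.exists_of_ssubset hKL
  have hiff : ∀ (K : Finset (simpleRoots W p)) (v : V),
      face W (h.weightSum K) * face W v = face W (h.weightSum K) ↔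
        ∀ t : simpleRoots W p, t ∉ K → ⟪(t : V), v⟫ = 0 := fun K v => by
    rw [face_mul_eq_left_iff, ← mem_flatOf, h.mem_flatOf_weightSum]
  apply Finset.card_lt_card
  rw [Finset.ssubset_iff_of_subset]
  · refine ⟨face W (h.weight t), ?_, ?_⟩
    · rw [Finset.mem_filter, hiff]
      exact ⟨mem_rayFaces.2 ⟨_, h.isRayVector_weight t, rfl⟩, fun s hs =>
        h.inner_weight_ne fun e => hs (e ▸ htL)⟩
    · rw [Finset.mem_filter, hiff]
      intro hall
      have := hall.2 t htK
      rw [h.inner_weight_self] at this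
      exact one_ne_zero this
  · intro F hF
    obtain ⟨v, rfl⟩ := face_surjective F
    rw [Finset.mem_filter, hiff] at hF ⊢
    exact ⟨hF.1, fun s hs => hF.2 s fun hsK => hs (hKL.1 hsK)⟩

end IsRegularPoint

section Main

variable [Fintype W]

lemma IsRegularPoint.isRealSemisimple_barrElement (h : IsRegularPoint W p) :
    IsRealSemisimple (LinearMap.mulLeft ℝ (barrElement (simpleReflections W p))) ∧
      IsRealSemisimple (LinearMap.mulRight ℝ (barrElement (simpleReflections W p))) := by
  classical
  have := Fintype.ofFinite (faceMonoid W)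
  have h1 := aeval_sum_of_leftRegularBand (faceMonoid_mul_mul_self (W := W)) (rayFaces W)
    (Finset.univ.image (fixCount (rayFaces W)))
    (fun G => Finset.mem_image_of_mem _ (Finset.mem_univ _))
  rw [← h.aeval_barrElement_eq_zero_iff] at h1
  have h2 := Finset.prod_map (Finset.univ.image (fixCount (rayFaces W))) Nat.castEmbedding
    (fun j : ℝ => (X - C j))
  simp only [Nat.castEmbedding_apply] at h2
  rw [← h2] at h1
  exact isRealSemisimple_mul h1

/-- If the number of rays in a flat depends only on its dimension, these numbers are the
eigenvalues of the Barr element. -/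
lemma IsRegularPoint.exists_eigenvalues (h : IsRegularPoint W p)
    (hdim : ∀ X Y : Submodule ℝ V, IsFlat (arrangement W) X → IsFlat (arrangement W) Y →
      Module.finrank ℝ X = Module.finrank ℝ Y →
      rayCount (arrangement W) X = rayCount (arrangement W) Y) :
    ∃ σ : Fin (Module.finrank ℝ V + 1) → ℕ,
      StrictMono σ ∧
      (∀ μ : ℝ, Module.End.HasEigenvalue
        (LinearMap.mulLeft ℝ (barrElement (simpleReflections W p))) μ ↔ ∃ k, μ = (σ k : ℝ)) ∧
      (∀ μ : ℝ, Module.End.HasEigenvalue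
        (LinearMap.mulRight ℝ (barrElement (simpleReflections W p))) μ ↔ ∃ k, μ = (σ k : ℝ)) ∧
      (∀ (k : Fin (Module.finrank ℝ V + 1)) (X : Submodule ℝ V),
        IsFlat (arrangement W) X → Module.finrank ℝ X = k → rayCount (arrangement W) X = σ k) := by
  classical
  let e : simpleRoots W p ≃ Fin (Module.finrank ℝ V) :=
    Fintype.equivFinOfCardEq h.finrank_eq.symm
  -- The first `k` simple roots give a flag with one flat of each dimension `k`. Its ray counts
  -- define `σ`, and nesting makes `σ` strictly increasing.
  let K : Fin (Module.finrank ℝ V + 1) → Finset (simpleRoots W p) := fun k =>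
    Finset.univ.filter fun a => (e a : ℕ) < k
  have hK : ∀ k, (K k).card = k := by
    intro k
    have h1 : (K k).map e.toEmbedding = Finset.univ.filter fun i : Fin _ => (i : ℕ) < k := by
      ext i
      simp only [Finset.mem_map_equiv, K, Finset.mem_filter, Finset.mem_univ, true_and,
        Equiv.apply_symm_apply]
    rw [← Finset.card_map e.toEmbedding, h1, Fin.card_filter_val_lt]
    have := k.2
    omega
  have hKmono : ∀ i j, i < j → K i ⊂ K j := by
    intro i j hij
    refine Finset.ssubset_iff_subset_ne.2 ⟨fun a ha => ?_, fun he => ?_⟩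
    · rw [Finset.mem_filter] at ha ⊢
      exact ⟨ha.1, ha.2.trans hij⟩
    · have := hK i
      rw [he, hK j] at this
      exact hij.ne (Fin.ext this.symm)
  let σ : Fin (Module.finrank ℝ V + 1) → ℕ := fun k =>
    rayCount (arrangement W) (flatOf W (h.weightSum (K k)))
  have hσ : StrictMono σ := fun i j hij => h.rayCount_lt_rayCount (hKmono i j hij)
  have hflat : ∀ (k : Fin (Module.finrank ℝ V + 1)) (X : Submodule ℝ V),
      IsFlat (arrangement W) X → Module.finrank ℝ X = k → rayCount (arrangement W) X = σ k := by
    intro k X hX hk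
    exact hdim _ _ hX (isFlat_flatOf _) (by rw [hk, h.finrank_flatOf_weightSum, hK])
  have hΛ : ∀ G : faceMonoid W, fixCount (rayFaces W) G ∈ Finset.univ.image σ := by
    intro G
    obtain ⟨x, rfl⟩ := face_surjective G
    rw [h.fixCount_rayFaces, hflat ⟨Module.finrank ℝ (flatOf W x),
      Nat.lt_succ_of_le (Submodule.finrank_le _)⟩ _ (isFlat_flatOf x) rfl]
    exact Finset.mem_image_of_mem _ (Finset.mem_univ _)
  have h1 := aeval_sum_of_leftRegularBand (faceMonoid_mul_mul_self (W := W)) (rayFaces W) _ hΛ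
  rw [← h.aeval_barrElement_eq_zero_iff] at h1
  have h2 := Finset.prod_map (Finset.univ.image σ) Nat.castEmbedding (fun j : ℝ => (X - C j))
  simp only [Nat.castEmbedding_apply] at h2
  rw [← h2] at h1
  have hmem : ∀ μ : ℝ, μ ∈ (Finset.univ.image σ).map Nat.castEmbedding ↔ ∃ k, μ = (σ k : ℝ) := by
    intro μ
    simp [eq_comm]
  have heig := hasEigenvalue_mul_iff h1 (fun q hq j hj => by
    obtain ⟨k, rfl⟩ := (hmem j).1 hj
    rw [h.aeval_barrElement_eq_zero_iff] at hq
    have := eval_fixCount_eq_zero faceMonoid_mul_mul_self _ (face W (h.weightSum (K k))) hq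
    rwa [h.fixCount_rayFaces] at this)
  exact ⟨σ, hσ, fun μ => (heig μ).1.trans (hmem μ), fun μ => (heig μ).2.trans (hmem μ), hflat⟩

end Main

end ReflectionGroup

/-! ### The given chamber and its walls -/

namespace Arrangement

variable {E : Type*} [AddCommGroup E] [Module ℝ E]

lemma IsFace.zero_mem {A : Set (Submodule ℝ E)} {F : Set E} (hF : IsFace A F) : (0 : E) ∈ F := by
  obtain ⟨t, ht, rfl⟩ := hF
  simp only [Set.mem_iInter]
  intro H hH
  rcases ht H hH with h | ⟨f, -, h⟩ <;> simp [h]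

lemma IsFace.add_mem {A : Set (Submodule ℝ E)} {F : Set E} (hF : IsFace A F) {x y : E}
    (hx : x ∈ F) (hy : y ∈ F) : x + y ∈ F := by
  obtain ⟨t, ht, rfl⟩ := hF
  simp only [Set.mem_iInter] at hx hy ⊢
  intro H hH
  have hx := hx H hH
  have hy := hy H hH
  rcases ht H hH with h | ⟨f, -, h⟩
  · rw [h] at hx hy ⊢; exact H.add_mem hx hy
  · rw [h] at hx hy ⊢
    rw [Set.mem_ofPred_eq] at hx hy ⊢
    rw [map_add]; exact add_nonneg hx hy

lemma IsFace.sum_mem {A : Set (Submodule ℝ E)} {F : Set E} (hF : IsFace A F) {ι : Type*}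
    (s : Finset ι) {x : ι → E} (hx : ∀ i ∈ s, x i ∈ F) : ∑ i ∈ s, x i ∈ F :=
  Finset.sum_induction x (· ∈ F) (fun _ _ => hF.add_mem) hF.zero_mem hx

end Arrangement

namespace ReflectionGroup

open scoped RealInnerProductSpace
open Arrangement

variable {V : Type*} [NormedAddCommGroup V] [InnerProductSpace ℝ V] [FiniteDimensional ℝ V]
variable {W : Subgroup (V ≃ₗᵢ[ℝ] V)} {p : V}

lemma orthogonal_singleton_neg (a : V) : (ℝ ∙ (-a))ᗮ = (ℝ ∙ a)ᗮ := by
  rw [← Set.neg_singleton, Submodule.span_neg]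

lemma closedHalfSpace_eq {a : V} (ha : ‖a‖ = 1) {s : Set V}
    (hs : IsClosedHalfSpace (ℝ ∙ a)ᗮ s) : s = {x | 0 ≤ ⟪a, x⟫} ∨ s = {x | 0 ≤ ⟪-a, x⟫} := by
  obtain ⟨f, hf, rfl⟩ := hs
  have haa : ⟪a, a⟫ = 1 := by rw [real_inner_self_eq_norm_sq, ha]; norm_num
  have hfx : ∀ x, f x = ⟪a, x⟫ * f a := by
    intro x
    have h1 : x - ⟪a, x⟫ • a ∈ LinearMap.ker f := by
      rw [hf, mem_orthogonal_singleton, inner_sub_right, inner_smul_right, haa]; ring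
    rw [LinearMap.mem_ker, map_sub, map_smul, smul_eq_mul, sub_eq_zero] at h1
    exact h1
  have hfa : f a ≠ 0 := by
    intro h0
    have : a ∈ (ℝ ∙ a)ᗮ := by rw [← hf]; exact h0
    rw [mem_orthogonal_singleton, haa] at this
    exact one_ne_zero this
  rcases lt_or_gt_of_ne hfa with hneg | hpos
  · right
    ext x
    rw [Set.mem_ofPred_eq, Set.mem_ofPred_eq, hfx, inner_neg_left]
    exact ⟨fun h => by by_contra! h'; nlinarith, fun h => by nlinarith⟩
  · left
    ext x
    rw [Set.mem_ofPred_eq, Set.mem_ofPred_eq, hfx]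
    exact mul_nonneg_iff_of_pos_right hpos

/-- The fundamental chamber is given by a regular point. -/
lemma exists_isRegularPoint [Finite W] (hW : IsReflectionGroup W) (hess : IsEssential W) {C : Set V}
    (hC : IsChamber (arrangement W) C) : ∃ p, IsRegularPoint W p ∧
      ∀ x, x ∈ C ↔ ∀ b ∈ roots W, 0 < ⟪b, p⟫ → 0 ≤ ⟪b, x⟫ := by
  have := Fintype.ofFinite (roots W)
  have hface := hC.1
  obtain ⟨⟨t, ht, hCt⟩, hsupp⟩ := hC
  have hmemC : ∀ x, x ∈ C ↔ ∀ H ∈ arrangement W, x ∈ t H := fun x => by simp [hCt]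
  have hnot : ∀ H ∈ arrangement W, ∃ x ∈ C, x ∉ H := by
    intro H hH
    by_contra! hall
    have hle : support (arrangement W) C ≤ H := by
      rw [support_eq]; exact sInf_le ⟨hH, hall⟩
    rw [hsupp, top_le_iff] at hle
    have := hH.1
    rw [hle, finrank_top] at this
    omega
  have hhalf : ∀ a ∈ roots W, ∃ b ∈ roots W, (b = a ∨ b = -a) ∧
      t (ℝ ∙ a)ᗮ = {x | 0 ≤ ⟪b, x⟫} := by
    intro a ha
    have hH : (ℝ ∙ a)ᗮ ∈ arrangement W := mem_arrangement_iff.2 ⟨a, ha, rfl⟩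
    rcases ht _ hH with h | h
    · obtain ⟨x, hxC, hxH⟩ := hnot _ hH
      have := (hmemC x).1 hxC _ hH
      rw [h] at this
      exact absurd this hxH
    · rcases closedHalfSpace_eq ha.1 h with h | h
      exacts [⟨a, ha, Or.inl rfl, h⟩, ⟨-a, neg_mem_roots ha, Or.inr rfl, h⟩]
  have hex : ∀ a : roots W, ∃ x ∈ C, ⟪(a : V), x⟫ ≠ 0 := by
    intro a
    obtain ⟨x, hxC, hx⟩ := hnot _ (mem_arrangement_iff.2 ⟨a, a.2, rfl⟩)
    exact ⟨x, hxC, fun h => hx (mem_orthogonal_singleton.2 h)⟩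
  choose x hxC hx0 using hex
  have hpC : ∑ a, x a ∈ C := hface.sum_mem _ fun a _ => hxC a
  -- For each root, one summand lies strictly on the chamber's side of its hyperplane and the others
  -- weakly, so the sum lies strictly on that side of all of them.
  set p := ∑ a, x a with hp
  have hpos : ∀ a ∈ roots W, ∀ b, (b = a ∨ b = -a) → t (ℝ ∙ a)ᗮ = {x | 0 ≤ ⟪b, x⟫} →
      0 < ⟪b, p⟫ := by
    intro a ha b hba htb
    have hnn : ∀ y ∈ C, 0 ≤ ⟪b, y⟫ := by
      intro y hy
      have := (hmemC y).1 hy _ (mem_arrangement_iff.2 ⟨a, ha, rfl⟩)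
      rw [htb] at this; exact this
    rw [hp, inner_sum]
    refine Finset.sum_pos' (fun c _ => hnn _ (hxC c)) ⟨⟨a, ha⟩, Finset.mem_univ _, ?_⟩
    refine lt_of_le_of_ne (hnn _ (hxC _)) (Ne.symm ?_)
    rcases hba with rfl | rfl
    · exact hx0 ⟨b, ha⟩
    · rw [inner_neg_left, neg_ne_zero]; exact hx0 ⟨a, ha⟩
  refine ⟨p, ⟨inferInstance, hW, hess, fun a ha => ?_⟩,
    fun y => ⟨fun hy b hb hbp => ?_, fun hy => ?_⟩⟩
  · obtain ⟨b, hb, hba, htb⟩ := hhalf a ha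
    have := hpos a ha b hba htb
    rcases hba with rfl | rfl
    · exact this.ne'
    · rw [inner_neg_left] at this; linarith
  · obtain ⟨c, hc, hcb, htc⟩ := hhalf b hb
    have h1 := hpos b hb c hcb htc
    have h2 := (hmemC y).1 hy _ (mem_arrangement_iff.2 ⟨b, hb, rfl⟩)
    rw [htc] at h2
    rcases hcb with rfl | rfl
    · exact h2
    · rw [inner_neg_left] at h1; linarith
  · rw [hmemC]
    intro H hH
    obtain ⟨a, ha, rfl⟩ := mem_arrangement_iff.1 hH
    obtain ⟨b, hb, hba, htb⟩ := hhalf a ha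
    rw [htb]
    exact hy b hb (hpos a ha b hba htb)

/-- Passes between the facet definition of a wall and an interior point of the wall, as in
`simpleRoots`. -/
lemma IsRegularPoint.isWall_iff [Finite W] (h : IsRegularPoint W p) {C : Set V}
    (hC : IsFace (arrangement W) C)
    (hCp : ∀ x, x ∈ C ↔ ∀ b ∈ roots W, 0 < ⟪b, p⟫ → 0 ≤ ⟪b, x⟫) (H : Submodule ℝ V) :
    IsWall (arrangement W) C H ↔ ∃ a ∈ simpleRoots W p, H = (ℝ ∙ a)ᗮ := by
  classical
  have := Fintype.ofFinite (roots W)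
  have hposroot : ∀ H ∈ arrangement W, ∃ a ∈ roots W, 0 < ⟪a, p⟫ ∧ H = (ℝ ∙ a)ᗮ := by
    intro H hH
    obtain ⟨a, ha, rfl⟩ := mem_arrangement_iff.1 hH
    rcases h.pos_or_neg ha with h1 | h1
    exacts [⟨a, ha, h1, rfl⟩, ⟨-a, neg_mem_roots ha, h1, (orthogonal_singleton_neg a).symm⟩]
  constructor
  · rintro ⟨hH, F, hF, hFC, hsupp⟩
    obtain ⟨a, ha, hap, rfl⟩ := hposroot H hH
    refine ⟨a, ⟨ha, hap, ?_⟩, rfl⟩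
    -- No positive root other than `a` vanishes on all of `F`, as the support would then lie in a
    -- second hyperplane. Summing one witness for each root gives a point where all of them are
    -- positive.
    have hex : ∀ b : roots W, ∃ x ∈ F, 0 < ⟪(b : V), p⟫ → (b : V) ≠ a → 0 < ⟪(b : V), x⟫ := by
      intro b
      by_cases hb : 0 < ⟪(b : V), p⟫ ∧ (b : V) ≠ a
      · by_contra! hall
        have hle : support (arrangement W) F ≤ (ℝ ∙ (b : V))ᗮ := by
          rw [support_eq]
          refine sInf_le ⟨mem_arrangement_iff.2 ⟨b, b.2, rfl⟩, fun x hx => ?_⟩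
          rw [SetLike.mem_coe, mem_orthogonal_singleton]
          exact le_antisymm (hall x hx).2.2 ((hCp x).1 (hFC hx) b b.2 hb.1)
        rw [hsupp] at hle
        rcases eq_or_eq_neg_of_inner ha.1 b.2.1 (fun x hx => mem_orthogonal_singleton.1
          (hle (mem_orthogonal_singleton.2 hx))) with e | e
        · exact hb.2 e
        · have := hb.1
          rw [e, inner_neg_left] at this
          linarith
      · exact ⟨0, hF.zero_mem, fun h1 h2 => absurd ⟨h1, h2⟩ hb⟩
    choose x hxF hx using hex
    have hsum : ∑ b, x b ∈ F := hF.sum_mem _ fun b _ => hxF b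
    refine ⟨∑ b, x b, ?_, fun b hb hbp hba => ?_⟩
    · have : ∑ b, x b ∈ support (arrangement W) F := by
        rw [support_eq, Submodule.mem_sInf]; exact fun K hK => hK.2 hsum
      rw [hsupp] at this
      exact mem_orthogonal_singleton.1 this
    · rw [inner_sum]
      exact Finset.sum_pos' (fun c _ => (hCp _).1 (hFC (hxF c)) b hb hbp)
        ⟨⟨b, hb⟩, Finset.mem_univ _, hx ⟨b, hb⟩ hbp hba⟩
  · rintro ⟨a, ⟨ha, hap, x, hax, hx⟩, rfl⟩
    have hH : (ℝ ∙ a)ᗮ ∈ arrangement W := mem_arrangement_iff.2 ⟨a, ha, rfl⟩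
    have hxC : x ∈ C := (hCp x).2 fun b hb hbp => by
      by_cases hba : b = a
      · rw [hba, hax]
      · exact (hx b hb hbp hba).le
    -- The facet is `C` cut by the hyperplane of `a`. It contains `x`, which is on no other
    -- hyperplane, so its support is this hyperplane.
    refine ⟨hH, {y | y ∈ C ∧ ⟪a, y⟫ = 0}, ?_, fun y hy => hy.1, ?_⟩
    · obtain ⟨t, ht, hCt⟩ := hC
      refine ⟨fun H => if H = (ℝ ∙ a)ᗮ then (H : Set V) else t H, fun H hH => ?_, ?_⟩
      · by_cases he : H = (ℝ ∙ a)ᗮ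
        · left; simp [he]
        · simpa [he] using ht H hH
      · ext y
        simp only [Set.mem_ofPred_eq, Set.mem_iInter]
        constructor
        · rintro ⟨hyC, hya⟩ H hH
          split_ifs with he
          · rw [he]; exact mem_orthogonal_singleton.2 hya
          · rw [hCt] at hyC
            simp only [Set.mem_iInter] at hyC
            exact hyC H hH
        · intro hy
          have hya : ⟪a, y⟫ = 0 := by
            have := hy _ hH
            rw [if_pos rfl] at this
            exact mem_orthogonal_singleton.1 this
          refine ⟨?_, hya⟩
          rw [hCt]
          simp only [Set.mem_iInter]
          intro H hH'
          by_cases he : H = (ℝ ∙ a)ᗮ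
          · rw [he]
            rcases ht _ hH with h1 | h1
            · rw [h1]; exact mem_orthogonal_singleton.2 hya
            · obtain ⟨f, hf, h1⟩ := h1
              rw [h1, Set.mem_ofPred_eq]
              have : y ∈ LinearMap.ker f := by rw [hf]; exact mem_orthogonal_singleton.2 hya
              exact (LinearMap.mem_ker.1 this).ge
          · have := hy H hH'
            rwa [if_neg he] at this
    · rw [support_eq]
      apply le_antisymm
      · exact sInf_le ⟨hH, fun y hy => mem_orthogonal_singleton.2 hy.2⟩
      · refine le_sInf ?_
        rintro K ⟨hK, hFK⟩
        obtain ⟨b, hb, hbp, rfl⟩ := hposroot K hK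
        by_cases hba : b = a
        · rw [hba]
        · have : x ∈ (ℝ ∙ b)ᗮ := hFK ⟨hxC, hax⟩
          exact absurd (mem_orthogonal_singleton.1 this) (hx b hb hbp hba).ne'

lemma IsRegularPoint.coxeterGenerators_eq [Finite W] (h : IsRegularPoint W p) {C : Set V}
    (hC : IsFace (arrangement W) C)
    (hCp : ∀ x, x ∈ C ↔ ∀ b ∈ roots W, 0 < ⟪b, p⟫ → 0 ≤ ⟪b, x⟫) :
    coxeterGenerators W C = simpleReflections W p := by
  ext s
  constructor
  · rintro ⟨H, hH, hs⟩
    obtain ⟨a, ha, rfl⟩ := (h.isWall_iff hC hCp H).1 hH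
    exact ⟨a, ha, hs⟩
  · rintro ⟨a, ha, hs⟩
    exact ⟨_, (h.isWall_iff hC hCp _).2 ⟨a, ha, rfl⟩, hs⟩

end ReflectionGroup

/-! ### Arrangements of coordinate forms -/

namespace Arrangement

variable {E : Type*} [AddCommGroup E] [Module ℝ E] {ι : Type*}

/-- The linear forms `y i` and `y i - ε * y j` with `ε` in `U`. -/
def coordForms (y : ι → E →ₗ[ℝ] ℝ) (U : Set ℝ) : Set (E →ₗ[ℝ] ℝ) :=
  {f | (∃ i, f = y i) ∨ ∃ i j, i ≠ j ∧ ∃ ε ∈ U, f = y i - ε • y j}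

/-- A parametrization of `X` by coordinates, in which each form `y j` is zero or a coordinate, up to
a factor in `U`. -/
structure CoordParam (y : ι → E →ₗ[ℝ] ℝ) (U : Set ℝ) (X : Submodule ℝ E) (T : Type) where
  /-- The parametrization. -/
  toFun : (T → ℝ) →ₗ[ℝ] E
  inj : Function.Injective toFun
  range_eq : LinearMap.range toFun = X
  form_eq : ∀ j, (∀ c, y j (toFun c) = 0) ∨ ∃ t, ∃ ε ∈ U, ∀ c, y j (toFun c) = ε * c t
  exists_form : ∀ t, ∃ j, ∃ ε ∈ U, ∀ c, y j (toFun c) = ε * c t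

/-- A set of square roots of one which is closed under multiplication. -/
structure IsSignSet (U : Set ℝ) : Prop where
  one_mem : (1 : ℝ) ∈ U
  mul_mem : ∀ ε ∈ U, ∀ δ ∈ U, ε * δ ∈ U
  mul_self : ∀ ε ∈ U, ε * ε = 1

variable {y : ι → E →ₗ[ℝ] ℝ} {U : Set ℝ} {X : Submodule ℝ E} {T : Type}

namespace CoordParam

variable (φ : CoordParam y U X T)

lemma mem_iff {x : E} : x ∈ X ↔ ∃ c, φ.toFun c = x := (SetLike.ext_iff.1 φ.range_eq x).symm

lemma apply_mem (c : T → ℝ) : φ.toFun c ∈ X := φ.mem_iff.2 ⟨c, rfl⟩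

/-- Each form restricts to `X` as zero, a multiple of a coordinate, or a form with the kernel of `c
t - η * c t'`, since `U` is closed under products and its elements are their own inverses. So no new
shape of hyperplane appears in a flat. -/
lemma ker_cases (hU : IsSignSet U) {f : E →ₗ[ℝ] ℝ} (hf : f ∈ coordForms y U) :
    (∀ c, f (φ.toFun c) = 0) ∨ (∃ t, ∀ c, f (φ.toFun c) = 0 ↔ c t = 0) ∨
      ∃ t t', t ≠ t' ∧ ∃ η ∈ U, ∀ c, f (φ.toFun c) = 0 ↔ c t = η * c t' := by
  have hne : ∀ ε ∈ U, ε ≠ 0 := fun ε hε h0 => by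
    have := hU.mul_self ε hε
    simp [h0] at this
  rcases hf with ⟨i, rfl⟩ | ⟨i, j, -, δ, hδ, rfl⟩
  · rcases φ.form_eq i with h | ⟨t, ε, hε, h⟩
    · exact Or.inl h
    · exact Or.inr (Or.inl ⟨t, fun c => by rw [h]; simp [hne ε hε]⟩)
  · simp only [LinearMap.sub_apply, LinearMap.smul_apply, smul_eq_mul]
    rcases φ.form_eq i with h | ⟨t, ε, hε, h⟩ <;> rcases φ.form_eq j with h' | ⟨t', ε', hε', h'⟩
    · left; intro c; rw [h, h']; simp
    · refine Or.inr (Or.inl ⟨t', fun c => ?_⟩)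
      rw [h, h']; simp [hne ε' hε', hne δ hδ]
    · refine Or.inr (Or.inl ⟨t, fun c => ?_⟩)
      rw [h, h']; simp [hne ε hε]
    · by_cases htt : t = t'
      · subst htt
        by_cases he : ε = δ * ε'
        · left; intro c; rw [h, h', he]; ring
        · refine Or.inr (Or.inl ⟨t, fun c => ?_⟩)
          rw [h, h', ← mul_assoc, ← sub_mul, mul_eq_zero]
          simp [sub_eq_zero, he]
      · refine Or.inr (Or.inr ⟨t, t', htt, ε * (δ * ε'), hU.mul_mem _ hε _ (hU.mul_mem _ hδ _ hε'),
          fun c => ?_⟩)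
        rw [h, h', sub_eq_zero]
        have hs := hU.mul_self ε hε
        constructor
        · intro he
          calc c t = (ε * ε) * c t := by rw [hs, one_mul]
            _ = ε * (δ * (ε' * c t')) := by rw [mul_assoc, he]
            _ = _ := by ring
        · intro he
          calc ε * c t = (ε * ε) * (δ * (ε' * c t')) := by rw [he]; ring
            _ = _ := by rw [hs, one_mul]

open Classical in
/-- The parametrization of a section by a hyperplane which expresses the coordinate `t` by the other
coordinates. -/
def eliminate (t : T) (l : ({s // s ≠ t} → ℝ) →ₗ[ℝ] ℝ)
    (hl : (∀ c, l c = 0) ∨ ∃ t', ∃ η ∈ U, ∀ c, l c = η * c t') (hU : IsSignSet U)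
    {H : Submodule ℝ E} (hH : ∀ c, φ.toFun c ∈ H ↔ c t = l fun s => c s) :
    CoordParam y U (H ⊓ X) {s // s ≠ t} where
  toFun := φ.toFun ∘ₗ LinearMap.pi fun s => if hs : s = t then l else LinearMap.proj ⟨s, hs⟩
  inj := by
    rw [LinearMap.coe_comp]
    refine φ.inj.comp fun c d hcd => ?_
    ext ⟨s, hs⟩
    have := congrFun hcd s
    simpa [hs] using this
  range_eq := by
    ext x
    rw [Submodule.mem_inf, φ.mem_iff]
    have hrest : ∀ c : {s // s ≠ t} → ℝ, (fun s : {s // s ≠ t} =>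
        (LinearMap.pi (fun s => if hs : s = t then l else LinearMap.proj ⟨s, hs⟩) c : T → ℝ)
          s) = c := by
      intro c
      ext ⟨s, hs⟩
      simp [hs]
    constructor
    · rintro ⟨c, rfl⟩
      refine ⟨?_, _, rfl⟩
      rw [LinearMap.comp_apply, hH, hrest]
      simp
    · rintro ⟨hx, c, rfl⟩
      refine ⟨fun s => c s, ?_⟩
      rw [LinearMap.comp_apply]
      congr 1
      ext s
      by_cases hs : s = t
      · rw [hs]; simpa using ((hH c).1 hx).symm
      · simp [hs]
  form_eq j := by
    rcases φ.form_eq j with h | ⟨s, ε, hε, h⟩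
    · exact Or.inl fun c => h _
    · by_cases hs : s = t
      · subst hs
        rcases hl with hl | ⟨t', η, hη, hl⟩
        · left; intro c
          rw [LinearMap.comp_apply, h]
          simp [hl]
        · refine Or.inr ⟨t', ε * η, hU.mul_mem _ hε _ hη, fun c => ?_⟩
          rw [LinearMap.comp_apply, h]
          simp [hl, mul_assoc]
      · refine Or.inr ⟨⟨s, hs⟩, ε, hε, fun c => ?_⟩
        rw [LinearMap.comp_apply, h]
        simp [hs]
  exists_form := by
    rintro ⟨s, hs⟩
    obtain ⟨j, ε, hε, h⟩ := φ.exists_form s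
    refine ⟨j, ε, hε, fun c => ?_⟩
    rw [LinearMap.comp_apply, h]
    simp [hs]

end CoordParam

lemma exists_coordParam_inf [Finite T] (hU : IsSignSet U) (φ : CoordParam y U X T) {f : E →ₗ[ℝ] ℝ}
    (hf : f ∈ coordForms y U) :
    ∃ (T' : Type) (_ : Finite T'), Nonempty (CoordParam y U (LinearMap.ker f ⊓ X) T') := by
  rcases φ.ker_cases hU hf with h | ⟨t, h⟩ | ⟨t, t', htt, η, hη, h⟩
  · have : LinearMap.ker f ⊓ X = X := by
      rw [inf_eq_right]
      intro x hx
      obtain ⟨c, rfl⟩ := φ.mem_iff.1 hx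
      exact h c
    rw [this]
    exact ⟨T, inferInstance, ⟨φ⟩⟩
  · exact ⟨{s // s ≠ t}, inferInstance,
      ⟨φ.eliminate t 0 (Or.inl fun _ => rfl) hU fun c => h c⟩⟩
  · exact ⟨{s // s ≠ t}, inferInstance, ⟨φ.eliminate t (η • LinearMap.proj ⟨t', htt.symm⟩)
      (Or.inr ⟨⟨t', htt.symm⟩, η, hη, fun _ => rfl⟩) hU fun c => (LinearMap.mem_ker.trans (h c))⟩⟩

/-- Ray vectors in coordinates. -/
def IsCoordRay (U : Set ℝ) (c : T → ℝ) : Prop :=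
  c ≠ 0 ∧ ∀ d : T → ℝ, (∀ t, c t = 0 → d t = 0) →
    (∀ t t', ∀ ε ∈ U, c t = ε * c t' → d t = ε * d t') → ∃ k : ℝ, d = k • c

section

variable {A : Set (Submodule ℝ E)} (hA : ∀ H, H ∈ A ↔ ∃ f ∈ coordForms y U, H = LinearMap.ker f)
include hA

lemma exists_coordParam_of_isFlat (hfin : A.Finite) (hU : IsSignSet U) {T₀ : Type} [Finite T₀]
    (φ : CoordParam y U ⊤ T₀) (hX : IsFlat A X) :
    ∃ (T : Type) (_ : Finite T), Nonempty (CoordParam y U X T) := by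
  obtain ⟨B, hB, rfl⟩ := hX
  induction B, hfin.subset hB using Set.Finite.induction_on with
  | empty => rw [sInf_empty]; exact ⟨T₀, inferInstance, ⟨φ⟩⟩
  | @insert H B _ _ ih =>
    obtain ⟨T, _, ⟨ψ⟩⟩ := ih ((Set.subset_insert _ _).trans hB)
    obtain ⟨f, hf, rfl⟩ := (hA H).1 (hB (Set.mem_insert _ _))
    rw [sInf_insert]
    exact exists_coordParam_inf hU ψ hf

/-- The hyperplanes cut out on `X` are exactly those of the coordinates and of the `c t - ε * c t'`.
The right side mentions only `T` and `U`, which is why the count depends on the dimension alone. -/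
lemma isRayVector_coordParam_iff (hU : IsSignSet U) (hX : IsFlat A X) (φ : CoordParam y U X T)
    (c : T → ℝ) : IsRayVector A (φ.toFun c) ↔ IsCoordRay U c := by
  classical
  refine and_congr (map_ne_zero_iff _ φ.inj) ⟨fun hc d hd0 hd => ?_, fun hc x hx => ?_⟩
  · obtain ⟨k, hk⟩ := hc (φ.toFun d) (by
      intro H hH hcH
      obtain ⟨f, hf, rfl⟩ := (hA H).1 hH
      rw [LinearMap.mem_ker] at hcH ⊢
      rcases φ.ker_cases hU hf with h | ⟨t, h⟩ | ⟨t, t', -, η, hη, h⟩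
      · exact h d
      · exact (h d).2 (hd0 t ((h c).1 hcH))
      · exact (h d).2 (hd t t' η hη ((h c).1 hcH)))
    exact ⟨k, φ.inj (by rw [hk, map_smul])⟩
  · have hxX : x ∈ X := by
      obtain ⟨B, hB, hXB⟩ := hX
      rw [hXB, Submodule.mem_sInf]
      intro H hH
      refine hx H (hB hH) ?_
      exact (Submodule.mem_sInf.1 (hXB.le (φ.apply_mem c))) H hH
    obtain ⟨d, rfl⟩ := φ.mem_iff.1 hxX
    have hzero : ∀ t, c t = 0 → d t = 0 := by
      intro t ht
      obtain ⟨j, ε, hε, h⟩ := φ.exists_form t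
      have := hx _ ((hA _).2 ⟨y j, Or.inl ⟨j, rfl⟩, rfl⟩)
        (by rw [LinearMap.mem_ker, h, ht, mul_zero])
      rw [LinearMap.mem_ker, h] at this
      refine (mul_eq_zero.1 this).resolve_left fun h0 => ?_
      have := hU.mul_self ε hε
      simp [h0] at this
    obtain ⟨k, hk⟩ := hc d hzero (by
      intro t t' ε hε hcc
      -- No form represents an equation between a coordinate and itself; such an equation forces `c
      -- t = 0` or `ε = 1`.
      by_cases htt : t = t'
      · subst htt
        by_cases h0 : c t = 0
        · rw [hzero t h0, mul_zero]
        · have : ε = 1 := by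
            have : (ε - 1) * c t = 0 := by linarith
            rcases mul_eq_zero.1 this with h1 | h1
            · linarith
            · exact absurd h1 h0
          rw [this, one_mul]
      obtain ⟨i, ε₁, hε₁, h₁⟩ := φ.exists_form t
      obtain ⟨j, ε₂, hε₂, h₂⟩ := φ.exists_form t'
      have hs₁ := hU.mul_self _ hε₁
      have hs₂ := hU.mul_self _ hε₂
      have hij : i ≠ j := by
        rintro rfl
        have := (h₁ (Pi.single t 1)).symm.trans (h₂ (Pi.single t 1))
        rw [Pi.single_eq_same, Pi.single_eq_of_ne (Ne.symm htt)] at this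
        simp only [mul_one, mul_zero] at this
        simp [this] at hs₁
      -- The coefficient `ε₁ * (ε * ε₂)` undoes the factors with which `y i` and `y j` restrict to
      -- the two coordinates.
      have hval : ∀ b : T → ℝ, (y i - (ε₁ * (ε * ε₂)) • y j) (φ.toFun b) =
          ε₁ * (b t - ε * b t') := by
        intro b
        rw [LinearMap.sub_apply, LinearMap.smul_apply, smul_eq_mul, h₁, h₂]
        linear_combination (-ε₁ * ε * b t') * hs₂
      have := hx _ ((hA _).2 ⟨y i - (ε₁ * (ε * ε₂)) • y j, Or.inr ⟨i, j, hij, _,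
        hU.mul_mem _ hε₁ _ (hU.mul_mem _ hε _ hε₂), rfl⟩, rfl⟩) (by
          rw [LinearMap.mem_ker, hval, hcc]; ring)
      rw [LinearMap.mem_ker, hval] at this
      rcases mul_eq_zero.1 this with h0 | h0
      · simp [h0] at hs₁
      · linarith)
    exact ⟨k, by rw [hk, map_smul]⟩

lemma rayCount_eq_of_coordParam (hU : IsSignSet U) (hX : IsFlat A X) (φ : CoordParam y U X T) :
    rayCount A X = (halfLine '' {c : T → ℝ | IsCoordRay U c}).ncard := by
  have hset : {v | v ∈ X ∧ IsRayVector A v} = φ.toFun '' {c | IsCoordRay U c} := by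
    ext v
    constructor
    · rintro ⟨hvX, hv⟩
      obtain ⟨c, rfl⟩ := φ.mem_iff.1 hvX
      exact ⟨c, (isRayVector_coordParam_iff hA hU hX φ c).1 hv, rfl⟩
    · rintro ⟨c, hc, rfl⟩
      exact ⟨φ.apply_mem c, (isRayVector_coordParam_iff hA hU hX φ c).2 hc⟩
  rw [rayCount, hset, Set.image_image]
  refine Set.ncard_image_congr fun c hc d hd => ?_
  rw [halfLine_eq_iff hc.1, halfLine_eq_iff ((map_ne_zero_iff _ φ.inj).2 hc.1)]
  simp only [← map_smul, φ.inj.eq_iff]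

end

lemma ncard_coordRays_congr {T T' : Type} (e : T ≃ T') :
    (halfLine '' {c : T → ℝ | IsCoordRay U c}).ncard =
      (halfLine '' {c : T' → ℝ | IsCoordRay U c}).ncard := by
  let f : (T → ℝ) ≃ₗ[ℝ] (T' → ℝ) := LinearEquiv.funCongrLeft ℝ ℝ e.symm
  have hf : ∀ c t, f c t = c (e.symm t) := fun _ _ => rfl
  have hray : ∀ c, IsCoordRay U (f c) ↔ IsCoordRay U c := by
    intro c
    refine and_congr (map_ne_zero_iff _ f.injective) ⟨fun h d hd0 hd => ?_, fun h d hd0 hd => ?_⟩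
    · obtain ⟨k, hk⟩ := h (f d) (fun t => hd0 _) (fun t t' => hd _ _)
      exact ⟨k, f.injective (by rw [hk, map_smul])⟩
    · obtain ⟨k, hk⟩ := h (f.symm d)
        (fun t ht => hd0 (e t) (by rw [hf, Equiv.symm_apply_apply, ht]))
        (fun t t' ε hε ht => hd (e t) (e t') ε hε (by
          rw [hf, hf, Equiv.symm_apply_apply, Equiv.symm_apply_apply, ht]))
      exact ⟨k, f.symm.injective (by rw [hk, map_smul, LinearEquiv.symm_apply_apply])⟩
  have hset : {c : T' → ℝ | IsCoordRay U c} = f '' {c | IsCoordRay U c} := by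
    ext c
    constructor
    · intro hc
      exact ⟨f.symm c, (hray _).1 (by rw [LinearEquiv.apply_symm_apply]; exact hc),
        LinearEquiv.apply_symm_apply _ _⟩
    · rintro ⟨c, hc, rfl⟩
      exact (hray c).2 hc
  rw [hset, Set.image_image]
  refine Set.ncard_image_congr fun c hc d hd => ?_
  rw [halfLine_eq_iff hc.1, halfLine_eq_iff ((map_ne_zero_iff _ f.injective).2 hc.1)]
  simp only [← map_smul, f.injective.eq_iff]

/-- For an arrangement of coordinate forms, the number of rays in a flat depends only on the
dimension. -/
theorem rayCount_eq_of_finrank_eq {A : Set (Submodule ℝ E)}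
    (hA : ∀ H, H ∈ A ↔ ∃ f ∈ coordForms y U, H = LinearMap.ker f) (hfin : A.Finite)
    (hU : IsSignSet U) {T₀ : Type} [Finite T₀] (φ : CoordParam y U ⊤ T₀) {X Y : Submodule ℝ E}
    (hX : IsFlat A X) (hY : IsFlat A Y) (hXY : Module.finrank ℝ X = Module.finrank ℝ Y) :
    rayCount A X = rayCount A Y := by
  obtain ⟨T, _, ⟨ψ⟩⟩ := exists_coordParam_of_isFlat hA hfin hU φ hX
  obtain ⟨T', _, ⟨ψ'⟩⟩ := exists_coordParam_of_isFlat hA hfin hU φ hY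
  have := Fintype.ofFinite T
  have := Fintype.ofFinite T'
  have h1 : Module.finrank ℝ X = Fintype.card T := by
    rw [← ψ.range_eq, LinearMap.finrank_range_of_inj ψ.inj, Module.finrank_fintype_fun_eq_card]
  have h2 : Module.finrank ℝ Y = Fintype.card T' := by
    rw [← ψ'.range_eq, LinearMap.finrank_range_of_inj ψ'.inj, Module.finrank_fintype_fun_eq_card]
  have e : T ≃ T' := Fintype.equivOfCardEq (by rw [← h1, ← h2, hXY])
  rw [rayCount_eq_of_coordParam hA hU hX ψ, rayCount_eq_of_coordParam hA hU hY ψ',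
    ncard_coordRays_congr e]

end Arrangement

/-! ### Angles between simple roots from the Coxeter matrix -/

namespace ReflectionGroup

open scoped RealInnerProductSpace
open Arrangement

variable {V : Type*} [NormedAddCommGroup V] [InnerProductSpace ℝ V] [FiniteDimensional ℝ V]
variable {W : Subgroup (V ≃ₗᵢ[ℝ] V)} {p : V}

lemma inner_self_of_mem_roots {a : V} (ha : a ∈ roots W) : ⟪a, a⟫ = 1 := by
  rw [real_inner_self_eq_norm_sq, ha.1]; norm_num

lemma simpleRoot_ne_neg (a b : simpleRoots W p) : (a : V) ≠ -b := by
  intro e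
  have h1 := a.2.2.1
  rw [e, inner_neg_left] at h1
  linarith [b.2.2.1]

lemma simpleRefl_injective : Function.Injective (simpleRefl : simpleRoots W p → W) := by
  intro a b hab
  rcases eq_or_eq_neg_of_refl_eq a.2.1.1 b.2.1.1 (congrArg Subtype.val hab) with e | e
  · exact Subtype.ext e.symm
  · exact absurd e (simpleRoot_ne_neg b a)

lemma exists_labelling {B : Type*} {M : CoxeterMatrix B}
    (hM : HasCoxeterType (simpleReflections W p) M) :
    ∃ e : B ≃ simpleRoots W p, ∀ i j, orderOf (simpleRefl (e i) * simpleRefl (e j)) = M i j := by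
  obtain ⟨e, he⟩ := hM
  let f : simpleRoots W p ≃ simpleReflections W p :=
    Equiv.ofBijective (fun a => ⟨simpleRefl a, simpleRefl_mem a⟩)
      ⟨fun a b hab => simpleRefl_injective (congrArg Subtype.val hab), by
        rintro ⟨s, a, ha, hs⟩
        exact ⟨⟨a, ha⟩, Subtype.ext (Subtype.ext hs.symm)⟩⟩
  have hf : ∀ s, simpleRefl (f.symm s) = (s : W) := fun s =>
    congrArg Subtype.val (f.apply_symm_apply s)
  exact ⟨e.trans f.symm, fun i j => by simp only [Equiv.trans_apply, hf, he]⟩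

section Angles

variable (a b : simpleRoots W p)

lemma refl_pow_eq_one {m : ℕ} (hm : orderOf (simpleRefl a * simpleRefl b) = m) :
    (refl (a : V) * refl (b : V)) ^ m = 1 := by
  have := pow_orderOf_eq_one (simpleRefl a * simpleRefl b)
  rw [hm] at this
  exact congrArg Subtype.val this

lemma ne_of_orderOf {m : ℕ} (hm : orderOf (simpleRefl a * simpleRefl b) = m) (h1 : m ≠ 1) :
    a ≠ b := by
  rintro rfl
  rw [simpleRefl_mul_self, orderOf_one] at hm
  exact h1 hm.symm

lemma refl_refl (u : V) {v : V} (hv : ‖v‖ = 1) : refl (refl u v) = refl u * refl v * refl u := by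
  rw [refl_map _ hv, inv_eq_of_mul_eq_one_right (refl_mul_self u)]

/-- Commuting reflections give `refl a b = ± b`. The plus sign means orthogonality; the minus sign
would make the roots proportional. -/
lemma inner_eq_of_orderOf_two (hm : orderOf (simpleRefl a * simpleRefl b) = 2) :
    ⟪(a : V), b⟫ = 0 := by
  have hne := ne_of_orderOf a b hm (by norm_num)
  have hpow := refl_pow_eq_one a b hm
  have h1 : refl (refl (a : V) b) = refl (b : V) := by
    rw [refl_refl _ b.2.1.1]
    have h2 : (refl (a : V) * refl (b : V) * refl (a : V)) * refl (b : V) = 1 := by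
      simpa [pow_succ, mul_assoc] using hpow
    exact mul_right_cancel (h2.trans (refl_mul_self _).symm)
  rcases eq_or_eq_neg_of_refl_eq b.2.1.1 (by simpa using b.2.1.1) h1.symm with e | e
  · have := congrArg (fun x => ⟪(a : V), x⟫) e
    simp only [refl_apply a.2.1.1, inner_sub_right, inner_smul_right,
      inner_self_of_mem_roots a.2.1] at this
    linarith
  · exfalso
    rw [refl_apply a.2.1.1] at e
    have hmem : (b : V) ∈ ℝ ∙ (a : V) := by
      have : (b : V) = ⟪(a : V), b⟫ • (a : V) := by
        have h3 : (2 : ℝ) • (b : V) = (2 : ℝ) • (⟪(a : V), b⟫ • (a : V)) := by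
          rw [smul_smul, two_smul]
          rw [sub_eq_iff_eq_add] at e
          nth_rewrite 2 [e]
          abel
        exact smul_right_injective V (two_ne_zero (α := ℝ)) h3
      rw [this]
      exact Submodule.smul_mem _ _ (Submodule.mem_span_singleton_self _)
    rcases eq_or_eq_neg_of_mem_span a.2.1.1 b.2.1.1 hmem with e | e
    · exact hne (Subtype.ext e.symm)
    · exact simpleRoot_ne_neg b a e

/-- The braid relation gives `refl a b = ± refl b a`. Pairing with `a` gives a quadratic equation
for the inner product, whose unwanted roots are excluded by nonpositivity and by `a ≠ -b`. -/
lemma inner_eq_of_orderOf_three (h : IsRegularPoint W p)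
    (hm : orderOf (simpleRefl a * simpleRefl b) = 3) : ⟪(a : V), b⟫ = -1 / 2 := by
  have hne := ne_of_orderOf a b hm (by norm_num)
  have hpow := refl_pow_eq_one a b hm
  have hc := h.inner_simple_nonpos a.2 b.2 (fun e => hne (Subtype.ext e))
  have h1 : refl (refl (a : V) b) = refl (refl (b : V) a) := by
    rw [refl_refl _ b.2.1.1, refl_refl _ a.2.1.1]
    have h2 : (refl (a : V) * refl (b : V) * refl (a : V)) *
        (refl (b : V) * refl (a : V) * refl (b : V)) = 1 := by
      simpa [pow_succ, mul_assoc] using hpow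
    have h3 : (refl (b : V) * refl (a : V) * refl (b : V)) *
        (refl (b : V) * refl (a : V) * refl (b : V)) = 1 := by
      rw [mul_assoc, ← mul_assoc (refl (b : V)) (refl (b : V) * _),
        ← mul_assoc (refl (b : V)) (refl (b : V)),
        refl_mul_self, one_mul, ← mul_assoc, mul_assoc (refl (b : V)), refl_mul_self, mul_one,
        refl_mul_self]
    exact mul_right_cancel (h2.trans h3.symm)
  have ha := inner_self_of_mem_roots a.2.1
  have hsymm : ⟪(b : V), a⟫ = ⟪(a : V), b⟫ := real_inner_comm _ _
  rcases eq_or_eq_neg_of_refl_eq (by simpa using a.2.1.1) (by simpa using b.2.1.1) h1.symm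
    with e | e
  · have := congrArg (fun x => ⟪(a : V), x⟫) e
    simp only [refl_apply a.2.1.1, refl_apply b.2.1.1, inner_sub_right, inner_smul_right, ha,
      hsymm] at this
    have h0 : (2 * ⟪(a : V), b⟫ + 1) * (⟪(a : V), b⟫ - 1) = 0 := by linarith
    rcases mul_eq_zero.1 h0 with h0 | h0 <;> linarith
  · exfalso
    have := congrArg (fun x => ⟪(a : V), x⟫) e
    simp only [refl_apply a.2.1.1, refl_apply b.2.1.1, inner_sub_right, inner_smul_right, ha,
      hsymm, inner_neg_right] at this
    have h0 : (2 * ⟪(a : V), b⟫ - 1) * (⟪(a : V), b⟫ + 1) = 0 := by linarith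
    rcases mul_eq_zero.1 h0 with h0 | h0
    · linarith
    · have hneg : ⟪(a : V), -b⟫ = 1 := by rw [inner_neg_right]; linarith
      have := (inner_eq_one_iff_of_norm_eq_one (𝕜 := ℝ) a.2.1.1
        (by rw [norm_neg]; exact b.2.1.1)).1 hneg
      exact simpleRoot_ne_neg a b this

/-- Here `refl a` commutes with the reflection in `refl b a`, which is therefore orthogonal or
parallel to `a`; parallel would give order at most two or `a = ± b`. -/
lemma inner_sq_of_orderOf_four (hm : orderOf (simpleRefl a * simpleRefl b) = 4) :
    ⟪(a : V), b⟫ ^ 2 = 1 / 2 := by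
  have hne := ne_of_orderOf a b hm (by norm_num)
  have hpow := refl_pow_eq_one a b hm
  have ha := inner_self_of_mem_roots a.2.1
  have hsymm : ⟪(b : V), a⟫ = ⟪(a : V), b⟫ := real_inner_comm _ _
  have hd : ‖refl (b : V) a‖ = 1 := by simpa using a.2.1.1
  have h1 : refl (refl (a : V) (refl (b : V) a)) = refl (refl (b : V) a) := by
    rw [refl_refl _ hd]
    have h2 : (refl (a : V) * refl (refl (b : V) a) * refl (a : V)) *
        refl (refl (b : V) a) = 1 := by
      rw [refl_refl _ a.2.1.1]
      simpa [pow_succ, mul_assoc] using hpow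
    exact mul_right_cancel (h2.trans (refl_mul_self _).symm)
  have hinner : ⟪(a : V), refl (b : V) a⟫ = 1 - 2 * ⟪(a : V), b⟫ ^ 2 := by
    rw [refl_apply b.2.1.1, inner_sub_right, inner_smul_right, ha, hsymm]; ring
  rcases eq_or_eq_neg_of_refl_eq hd (by simpa using a.2.1.1) h1.symm with e | e
  · have := congrArg (fun x => ⟪(a : V), x⟫) e
    simp only [refl_apply a.2.1.1 (refl (b : V) a), inner_sub_right, inner_smul_right, ha,
      hinner] at this
    linarith
  · exfalso
    have hmem : refl (b : V) a ∈ ℝ ∙ (a : V) := by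
      rw [refl_apply a.2.1.1 (refl (b : V) a)] at e
      have : refl (b : V) a = ⟪(a : V), refl (b : V) a⟫ • (a : V) := by
        have h3 : (2 : ℝ) • refl (b : V) a =
            (2 : ℝ) • (⟪(a : V), refl (b : V) a⟫ • (a : V)) := by
          rw [smul_smul, two_smul]
          rw [sub_eq_iff_eq_add] at e
          nth_rewrite 2 [e]
          abel
        exact smul_right_injective V (two_ne_zero (α := ℝ)) h3
      rw [this]
      exact Submodule.smul_mem _ _ (Submodule.mem_span_singleton_self _)
    rcases eq_or_eq_neg_of_mem_span a.2.1.1 hd hmem with e | e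
    · have h4 : refl (b : V) * refl (a : V) * refl (b : V) = refl (a : V) := by
        rw [← refl_refl _ a.2.1.1, e]
      have h5 : (simpleRefl a * simpleRefl b) ^ 2 = 1 := by
        refine Subtype.ext ?_
        change (refl (a : V) * refl (b : V)) ^ 2 = 1
        rw [pow_two, mul_assoc, ← mul_assoc (refl (b : V)), h4, refl_mul_self]
      have := orderOf_dvd_of_pow_eq_one h5
      rw [hm] at this
      norm_num at this
    · have h4 : ⟪(a : V), b⟫ ^ 2 = 1 := by
        rw [e, inner_neg_right, ha] at hinner; linarith
      rcases sq_eq_one_iff.1 h4 with h5 | h5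
      · exact hne (Subtype.ext ((inner_eq_one_iff_of_norm_eq_one (𝕜 := ℝ) a.2.1.1 b.2.1.1).1 h5))
      · have hneg : ⟪(a : V), -b⟫ = 1 := by rw [inner_neg_right]; linarith
        exact simpleRoot_ne_neg a b ((inner_eq_one_iff_of_norm_eq_one (𝕜 := ℝ) a.2.1.1
          (by rw [norm_neg]; exact b.2.1.1)).1 hneg)

end Angles

/-! ### Rank at most three -/

section SmallRank

/-- In a dihedral group with rotation `x * y` of order `2 * k + 1`, the element `(x * y) ^ k`
conjugates `x` to `y`. -/
lemma isConj_of_odd_orderOf {G : Type*} [Group G] {x y : G} (hx : x * x = 1) (hy : y * y = 1)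
    {k : ℕ} (hk : orderOf (x * y) = 2 * k + 1) : IsConj x y := by
  have h1 : (x * y) ^ (2 * k + 1) = 1 := by rw [← hk]; exact pow_orderOf_eq_one _
  have h2 : (y * x) ^ k = (x * y) ^ (k + 1) := by
    have : y * x = (x * y)⁻¹ := by
      rw [mul_inv_rev, inv_eq_of_mul_eq_one_right hx, inv_eq_of_mul_eq_one_right hy]
    rw [this, inv_pow, inv_eq_iff_mul_eq_one, ← pow_add, ← h1]
    congr 1; omega
  rw [isConj_iff]
  refine ⟨(x * y) ^ k, mul_inv_eq_of_eq_mul ?_⟩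
  rw [← mul_pow_mul, h2, pow_succ, mul_assoc, mul_assoc, hy, mul_one]

variable [Finite W]

lemma rayCount_hyperplane_map (w : W) (a : V) :
    rayCount (arrangement W) (ℝ ∙ ((w : V ≃ₗᵢ[ℝ] V) a))ᗮ = rayCount (arrangement W) (ℝ ∙ a)ᗮ := by
  have hset : {v | v ∈ (ℝ ∙ ((w : V ≃ₗᵢ[ℝ] V) a))ᗮ ∧ IsRayVector (arrangement W) v} =
      (w : V ≃ₗᵢ[ℝ] V) '' {v | v ∈ (ℝ ∙ a)ᗮ ∧ IsRayVector (arrangement W) v} := by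
    ext v
    constructor
    · rintro ⟨hv, hray⟩
      refine ⟨((w⁻¹ : W) : V ≃ₗᵢ[ℝ] V) v, ⟨?_, isRayVector_map _ hray⟩, map_map_inv _ _⟩
      rw [mem_orthogonal_singleton] at hv ⊢
      rw [← hv, inner_map_eq]; rfl
    · rintro ⟨v, ⟨hv, hray⟩, rfl⟩
      refine ⟨?_, isRayVector_map _ hray⟩
      rw [mem_orthogonal_singleton] at hv ⊢
      rw [LinearIsometryEquiv.inner_map_map, hv]
  rw [rayCount, hset, Set.image_image]
  refine Set.ncard_image_congr fun c hc d hd => ?_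
  rw [halfLine_eq_iff hc.2.1, halfLine_eq_iff (by simpa using hc.2.1)]
  simp only [← map_smul, (w : V ≃ₗᵢ[ℝ] V).injective.eq_iff]

lemma rayCount_of_finrank_one {X : Submodule ℝ V} (hX : IsFlat (arrangement W) X)
    (h1 : Module.finrank ℝ X = 1) : rayCount (arrangement W) X = 2 := by
  obtain ⟨⟨v, hvX⟩, hv0, hspan⟩ := finrank_eq_one_iff'.1 h1
  have hv0' : v ≠ 0 := by simpa using hv0
  have hline : ∀ x ∈ X, ∃ c : ℝ, x = c • v := fun x hx => by
    obtain ⟨c, hc⟩ := hspan ⟨x, hx⟩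
    exact ⟨c, (congrArg Subtype.val hc).symm⟩
  have hray : ∀ x ∈ X, x ≠ 0 → IsRayVector (arrangement W) x := by
    intro x hx hx0
    refine ⟨hx0, fun z hz => ?_⟩
    obtain ⟨B, hB, hXB⟩ := hX
    have hzX : z ∈ X := by
      rw [hXB, Submodule.mem_sInf]
      intro H hH
      exact hz H (hB hH) ((Submodule.mem_sInf.1 (hXB.le hx)) H hH)
    obtain ⟨c, hc⟩ := hline x hx
    obtain ⟨d, rfl⟩ := hline z hzX
    have hc0 : c ≠ 0 := by rintro rfl; simp [hc] at hx0
    exact ⟨d * c⁻¹, by rw [hc, smul_smul, mul_assoc, inv_mul_cancel₀ hc0, mul_one]⟩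
  have hset : halfLine '' {x | x ∈ X ∧ IsRayVector (arrangement W) x} =
      {halfLine v, halfLine (-v)} := by
    ext F
    simp only [Set.mem_insert_iff, Set.mem_singleton_iff]
    constructor
    · rintro ⟨x, ⟨hx, hxr⟩, rfl⟩
      obtain ⟨c, rfl⟩ := hline x hx
      rcases lt_trichotomy c 0 with hc | hc | hc
      · right
        rw [halfLine_eq_iff hxr.1]
        exact ⟨-c, by linarith, by simp⟩
      · exact absurd (by rw [hc, zero_smul]) hxr.1
      · left
        rw [halfLine_eq_iff hxr.1]
        exact ⟨c, hc, rfl⟩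
    · rintro (rfl | rfl)
      · exact ⟨v, ⟨hvX, hray v hvX hv0'⟩, rfl⟩
      · exact ⟨-v, ⟨X.neg_mem hvX, hray _ (X.neg_mem hvX) (neg_ne_zero.2 hv0')⟩, rfl⟩
  rw [rayCount, hset, Set.ncard_pair]
  rw [Ne, halfLine_eq_iff hv0']
  rintro ⟨c, hc, he⟩
  have : (1 + c) • v = 0 := by
    rw [add_smul, one_smul]; nth_rewrite 1 [he]; simp
  rcases smul_eq_zero.1 this with h2 | h2
  · linarith
  · exact hv0' h2

/-- There is one flat in dimension zero and one in full dimension, and every line has two rays. What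
remains is planes in rank three: they are reflecting hyperplanes, conjugate to walls of simple
roots, and `hconj` makes these conjugate. -/
lemma IsRegularPoint.rayCount_eq_of_finrank_le_three (h : IsRegularPoint W p)
    (hr : Module.finrank ℝ V ≤ 3) (hconj : Module.finrank ℝ V = 3 →
      ∀ a b : simpleRoots W p, IsConj (simpleRefl a) (simpleRefl b))
    {X Y : Submodule ℝ V} (hX : IsFlat (arrangement W) X) (hY : IsFlat (arrangement W) Y)
    (hXY : Module.finrank ℝ X = Module.finrank ℝ Y) :
    rayCount (arrangement W) X = rayCount (arrangement W) Y := by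
  have hle := Submodule.finrank_le X
  rcases Nat.eq_zero_or_pos (Module.finrank ℝ X) with h0 | h0
  · rw [Submodule.finrank_eq_zero.1 h0, Submodule.finrank_eq_zero.1 (hXY.symm.trans h0)]
  rcases hle.eq_or_lt with htop | hlt
  · rw [Submodule.eq_top_of_finrank_eq htop, Submodule.eq_top_of_finrank_eq (hXY.symm.trans htop)]
  by_cases h1 : Module.finrank ℝ X = 1
  · rw [rayCount_of_finrank_one hX h1, rayCount_of_finrank_one hY (hXY ▸ h1)]
  have hV : Module.finrank ℝ V = 3 := by omega
  have hX2 : Module.finrank ℝ X = 2 := by omega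
  have key : ∀ Z : Submodule ℝ V, IsFlat (arrangement W) Z → Module.finrank ℝ Z = 2 →
      ∃ a : simpleRoots W p,
        rayCount (arrangement W) Z = rayCount (arrangement W) (ℝ ∙ (a : V))ᗮ := by
    rintro Z ⟨B, hB, rfl⟩ hZ
    obtain ⟨H, hH⟩ : B.Nonempty := by
      rw [Set.nonempty_iff_ne_empty]
      rintro rfl
      rw [sInf_empty, finrank_top] at hZ
      omega
    have hHA := hB hH
    have hHdim := hHA.1
    rw [Submodule.eq_of_le_of_finrank_eq (sInf_le hH) (by omega)]
    obtain ⟨b, hb, rfl⟩ := mem_arrangement_iff.1 hHA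
    obtain ⟨w, hw, a, ha, rfl⟩ := h.exists_map_simple hb
    rw [h.closure_simple] at hw
    exact ⟨⟨a, ha⟩, rayCount_hyperplane_map ⟨w, hw⟩ a⟩
  obtain ⟨a, ha⟩ := key X hX hX2
  obtain ⟨b, hb⟩ := key Y hY (hXY ▸ hX2)
  rw [ha, hb]
  obtain ⟨w, hw⟩ := isConj_iff.1 (hconj hV a b)
  rw [← rayCount_hyperplane_map w a]
  have h2 : refl ((w : V ≃ₗᵢ[ℝ] V) a) = refl (b : V) := by
    rw [refl_map _ a.2.1.1]
    exact congrArg Subtype.val hw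
  rcases eq_or_eq_neg_of_refl_eq b.2.1.1 (by simpa using a.2.1.1) h2.symm with e | e
  · rw [e]
  · rw [e, orthogonal_singleton_neg]

end SmallRank

/-! ### Chains of roots: coordinates for types A and B -/

/-- The nonzero multiples of the elements of `N`. -/
def nonzeroMultiples (N : Set V) : Set V := {v | ∃ c : ℝ, c ≠ 0 ∧ ∃ u ∈ N, v = c • u}

lemma subset_nonzeroMultiples (N : Set V) : N ⊆ nonzeroMultiples N := fun u hu =>
  ⟨1, one_ne_zero, u, hu, (one_smul _ _).symm⟩

lemma smul_mem_nonzeroMultiples {N : Set V} {v : V} (hv : v ∈ nonzeroMultiples N) {c : ℝ}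
    (hc : c ≠ 0) : c • v ∈ nonzeroMultiples N := by
  obtain ⟨d, hd, u, hu, rfl⟩ := hv
  exact ⟨c * d, mul_ne_zero hc hd, u, hu, smul_smul _ _ _⟩

lemma map_mem_nonzeroMultiples {N M : Set V} (w : V ≃ₗᵢ[ℝ] V)
    (hw : ∀ u ∈ N, w u ∈ nonzeroMultiples M) {v : V} (hv : v ∈ nonzeroMultiples N) :
    w v ∈ nonzeroMultiples M := by
  obtain ⟨c, hc, u, hu, rfl⟩ := hv
  rw [map_smul]
  exact smul_mem_nonzeroMultiples (hw u hu) hc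

lemma map_mem_nonzeroMultiples_roots {w : V ≃ₗᵢ[ℝ] V} (hw : w ∈ W) {v : V}
    (hv : v ∈ nonzeroMultiples (roots W)) : w v ∈ nonzeroMultiples (roots W) :=
  map_mem_nonzeroMultiples w (fun _ hu => subset_nonzeroMultiples _ (map_mem_roots hw hu)) hv

/-- The vectors `y i` and `y i - ε • y j` for `i, j < n` and `ε` in `U`. -/
def coordVectors (y : ℕ → V) (n : ℕ) (U : Set ℝ) : Set V :=
  {v | (∃ i < n, v = y i) ∨ ∃ i < n, ∃ j < n, i ≠ j ∧ ∃ ε ∈ U, v = y i - ε • y j}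

lemma ker_innerₗ (v : V) : LinearMap.ker (innerₗ V v) = (ℝ ∙ v)ᗮ := by
  ext x
  rw [mem_orthogonal_singleton]; rfl

lemma mem_coordForms_iff {y : ℕ → V} {n : ℕ} {U : Set ℝ} {f : V →ₗ[ℝ] ℝ} :
    f ∈ coordForms (fun i : Fin n => innerₗ V (y i)) U ↔
      ∃ v ∈ coordVectors y n U, f = innerₗ V v := by
  constructor
  · rintro (⟨i, rfl⟩ | ⟨i, j, hij, ε, hε, rfl⟩)
    · exact ⟨y i, Or.inl ⟨i, i.2, rfl⟩, rfl⟩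
    · exact ⟨y i - ε • y j, Or.inr ⟨i, i.2, j, j.2, fun e => hij (Fin.ext e), ε, hε, rfl⟩, by simp⟩
  · rintro ⟨v, ⟨i, hi, rfl⟩ | ⟨i, hi, j, hj, hij, ε, hε, rfl⟩, rfl⟩
    · exact Or.inl ⟨⟨i, hi⟩, rfl⟩
    · exact Or.inr ⟨⟨i, hi⟩, ⟨j, hj⟩, fun e => hij (congrArg Fin.val e), ε, hε, by simp⟩

lemma orthogonal_singleton_smul {c : ℝ} (hc : c ≠ 0) (v : V) : (ℝ ∙ (c • v))ᗮ = (ℝ ∙ v)ᗮ := by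
  rw [Submodule.span_singleton_smul_eq (IsUnit.mk0 c hc)]

lemma mem_arrangement_iff_coordForms {y : ℕ → V} {n : ℕ} {U : Set ℝ}
    (h1 : roots W ⊆ nonzeroMultiples (coordVectors y n U))
    (h2 : coordVectors y n U ⊆ nonzeroMultiples (roots W)) (H : Submodule ℝ V) :
    H ∈ arrangement W ↔
      ∃ f ∈ coordForms (fun i : Fin n => innerₗ V (y i)) U, H = LinearMap.ker f := by
  rw [mem_arrangement_iff]
  constructor
  · rintro ⟨a, ha, rfl⟩
    obtain ⟨c, hc, v, hv, rfl⟩ := h1 ha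
    exact ⟨innerₗ V v, mem_coordForms_iff.2 ⟨v, hv, rfl⟩, by
      rw [ker_innerₗ, orthogonal_singleton_smul hc]⟩
  · rintro ⟨f, hf, rfl⟩
    obtain ⟨v, hv, rfl⟩ := mem_coordForms_iff.1 hf
    obtain ⟨c, hc, a, ha, rfl⟩ := h2 hv
    exact ⟨a, ha, by rw [ker_innerₗ, orthogonal_singleton_smul hc]⟩

lemma arrangement_finite [Finite W] : (arrangement W).Finite :=
  ((roots_finite W).image fun a => (ℝ ∙ a)ᗮ).subset fun H hH => by
    obtain ⟨a, ha, rfl⟩ := mem_arrangement_iff.1 hH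
    exact ⟨a, ha, rfl⟩

/-- The simple roots form a chain, with inner products `-κ / 2` for the first edge and `-1 / 2` for
the other edges. -/
structure IsRootChain (W : Subgroup (V ≃ₗᵢ[ℝ] V)) (p : V) (n : ℕ) (κ : ℝ) (a : ℕ → V) : Prop where
  ne_zero : κ ≠ 0
  finrank_eq : Module.finrank ℝ V = n
  mem : ∀ k < n, a k ∈ simpleRoots W p
  exists_eq : ∀ b ∈ simpleRoots W p, ∃ k < n, b = a k
  inner_zero_one : 1 < n → ⟪a 0, a 1⟫ = -κ / 2
  inner_succ : ∀ k, k + 2 < n → ⟪a (k + 1), a (k + 2)⟫ = -1 / 2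
  inner_eq_zero : ∀ k l, k + 1 < l → l < n → ⟪a k, a l⟫ = 0

/-- The partial sums of a chain of roots. -/
def chainSum (κ : ℝ) (a : ℕ → V) : ℕ → V
  | 0 => a 0
  | k + 1 => chainSum κ a k + κ • a (k + 1)

namespace IsRootChain

variable {n : ℕ} {κ : ℝ} {a : ℕ → V} (hc : IsRootChain W p n κ a)

section
include hc

local notation "y" => chainSum κ a

lemma norm_eq {k : ℕ} (hk : k < n) : ‖a k‖ = 1 := (hc.mem k hk).1.1

lemma inner_chainSum_of_lt {k l : ℕ} (hkl : k + 1 < l) (hl : l < n) : ⟪a l, y k⟫ = 0 := by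
  induction k with
  | zero => rw [chainSum, real_inner_comm, hc.inner_eq_zero 0 l hkl hl]
  | succ k ih =>
    rw [chainSum, inner_add_right, inner_smul_right, ih (by omega), real_inner_comm,
      hc.inner_eq_zero _ _ hkl hl]
    simp

lemma inner_succ_chainSum {k : ℕ} (hk : k + 1 < n) : ⟪a (k + 1), y k⟫ = -κ / 2 := by
  cases k with
  | zero => rw [chainSum, real_inner_comm, hc.inner_zero_one hk]
  | succ k =>
    rw [chainSum, inner_add_right, inner_smul_right, hc.inner_chainSum_of_lt (by omega) hk,
      real_inner_comm, hc.inner_succ k hk]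
    ring

/-- Adding the next term is a reflection, since `a (k + 1)` has inner product `-κ / 2` with the
partial sum; so all partial sums are roots. -/
lemma refl_chainSum {k : ℕ} (hk : k + 1 < n) : refl (a (k + 1)) (y k) = y (k + 1) := by
  rw [refl_apply (hc.norm_eq hk), hc.inner_succ_chainSum hk, chainSum, sub_eq_add_neg, ← neg_smul]
  congr 2; ring

lemma refl_chainSum_succ {k : ℕ} (hk : k + 1 < n) : refl (a (k + 1)) (y (k + 1)) = y k := by
  rw [← hc.refl_chainSum hk, Submodule.reflection_reflection]

lemma chainSum_mem_roots {k : ℕ} (hk : k < n) : y k ∈ roots W := by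
  induction k with
  | zero => exact (hc.mem 0 hk).1
  | succ k ih =>
    rw [← hc.refl_chainSum hk]
    exact map_mem_roots (hc.mem _ hk).1.2 (ih (by omega))

lemma inner_chainSum_of_gt {k l : ℕ} (hkl : k + 1 < l) (hl : l < n) : ⟪a (k + 1), y l⟫ = 0 := by
  obtain ⟨d, rfl⟩ := Nat.exists_eq_add_of_lt hkl
  induction d with
  | zero =>
    have h1 : ⟪a (k + 1), y (k + 1)⟫ = κ / 2 := by
      rw [← hc.refl_chainSum (by omega), ← inner_refl, refl_self, inner_neg_left,
        hc.inner_succ_chainSum (by omega)]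
      ring
    change ⟪a (k + 1), y (k + 1) + κ • a (k + 2)⟫ = 0
    rw [inner_add_right, inner_smul_right, h1, hc.inner_succ k hl]
    ring
  | succ d ih =>
    change ⟪a (k + 1), y (k + 1 + d + 1) + κ • a (k + 1 + d + 2)⟫ = 0
    rw [inner_add_right, inner_smul_right, ih (by omega) (by omega),
      hc.inner_eq_zero _ (k + 1 + d + 2) (by omega) hl]
    ring

/-- The root `a (k + 1)` is proportional to the difference of two consecutive partial sums. Its
reflection transposes these and fixes the others, which are orthogonal to it. -/
lemma refl_succ_chainSum {k i : ℕ} (hk : k + 1 < n) (hi : i < n) :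
    refl (a (k + 1)) (y i) = y (Equiv.swap k (k + 1) i) := by
  by_cases h1 : i = k
  · rw [h1, Equiv.swap_apply_left, hc.refl_chainSum hk]
  by_cases h2 : i = k + 1
  · rw [h2, Equiv.swap_apply_right, hc.refl_chainSum_succ hk]
  rw [Equiv.swap_apply_of_ne_of_ne h1 h2, refl_apply (hc.norm_eq hk)]
  have : ⟪a (k + 1), y i⟫ = 0 := by
    rcases lt_or_gt_of_ne h1 with h3 | h3
    · exact hc.inner_chainSum_of_lt (by omega) hk
    · exact hc.inner_chainSum_of_gt (by omega) hi
  rw [this]; simp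

lemma inner_chainSum {i j : ℕ} (hij : i < j) (hj : j < n) : ⟪y i, y j⟫ = 1 - κ ^ 2 / 2 := by
  induction i with
  | zero =>
    obtain ⟨d, rfl⟩ := Nat.exists_eq_add_of_lt hij
    induction d with
    | zero =>
      change ⟪a 0, a 0 + κ • a 1⟫ = _
      rw [inner_add_right, inner_smul_right, hc.inner_zero_one hj,
        inner_self_of_mem_roots (hc.mem 0 (by omega)).1]
      ring
    | succ d ih =>
      change ⟪a 0, y (0 + d + 1) + κ • a (0 + d + 2)⟫ = _
      rw [inner_add_right, inner_smul_right, hc.inner_eq_zero 0 (0 + d + 2) (by omega) hj]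
      rw [chainSum] at ih
      rw [ih (by omega) (by omega)]
      ring
  | succ i ih =>
    rw [chainSum, inner_add_left, inner_smul_left, ih (by omega), hc.inner_chainSum_of_gt hij hj]
    simp

lemma refl_zero_chainSum_zero : refl (a 0) (y 0) = -y 0 := refl_self _

lemma refl_zero_chainSum {i : ℕ} (hi : i < n) (h0 : i ≠ 0) :
    refl (a 0) (y i) = y i - (2 - κ ^ 2) • y 0 := by
  have := hc.inner_chainSum (Nat.pos_of_ne_zero h0) hi
  rw [chainSum] at this
  rw [refl_apply (hc.norm_eq (by omega)), this, chainSum]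
  congr 2; ring

lemma sub_mem_nonzeroMultiples_of_lt {i j : ℕ} (hij : i < j) (hj : j < n) :
    y j - y i ∈ nonzeroMultiples (roots W) := by
  obtain ⟨d, rfl⟩ := Nat.exists_eq_add_of_lt hij
  induction d with
  | zero =>
    refine ⟨κ, hc.ne_zero, a (i + 1), (hc.mem _ hj).1, ?_⟩
    change y i + κ • a (i + 1) - y i = _
    abel
  | succ d ih =>
    have h1 := map_mem_nonzeroMultiples_roots (hc.mem _ hj).1.2 (ih (by omega) (by omega))
    rw [map_sub] at h1
    have h2 : refl (a (i + (d + 1) + 1)) (y (i + d + 1)) = y (i + (d + 1) + 1) :=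
      hc.refl_chainSum hj
    have h3 : refl (a (i + (d + 1) + 1)) (y i) = y i := by
      rw [hc.refl_succ_chainSum hj (by omega), Equiv.swap_apply_of_ne_of_ne (by omega) (by omega)]
    rwa [h2, h3] at h1

lemma sub_mem_nonzeroMultiples {i j : ℕ} (hij : i ≠ j) (hi : i < n) (hj : j < n) :
    y i - y j ∈ nonzeroMultiples (roots W) := by
  rcases lt_or_gt_of_ne hij with h1 | h1
  · have := smul_mem_nonzeroMultiples (hc.sub_mem_nonzeroMultiples_of_lt h1 hj)
      (neg_ne_zero.2 one_ne_zero)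
    simpa using this
  · exact hc.sub_mem_nonzeroMultiples_of_lt h1 hi

/-- When `κ ^ 2 = 2` the partial sums are orthonormal, and the reflection in `y j` turns the
difference into the sum. -/
lemma add_mem_nonzeroMultiples (hκ : κ ^ 2 = 2) {i j : ℕ} (hij : i ≠ j) (hi : i < n) (hj : j < n) :
    y i + y j ∈ nonzeroMultiples (roots W) := by
  have h0 : ⟪y j, y i⟫ = 0 := by
    rcases lt_or_gt_of_ne hij with h1 | h1
    · rw [real_inner_comm, hc.inner_chainSum h1 hj, hκ]; norm_num
    · rw [hc.inner_chainSum h1 hi, hκ]; norm_num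
  have h1 := map_mem_nonzeroMultiples_roots (hc.chainSum_mem_roots hj).2
    (hc.sub_mem_nonzeroMultiples hij hi hj)
  rw [map_sub, refl_self, refl_apply (hc.chainSum_mem_roots hj).1, h0] at h1
  simpa using h1

lemma refl_succ_mem {U : Set ℝ} {k : ℕ} (hk : k + 1 < n) {v : V} (hv : v ∈ coordVectors y n U) :
    refl (a (k + 1)) v ∈ coordVectors y n U := by
  have hlt : ∀ i < n, Equiv.swap k (k + 1) i < n := by
    intro i hi
    rw [Equiv.swap_apply_def]
    split_ifs <;> omega
  rcases hv with ⟨i, hi, rfl⟩ | ⟨i, hi, j, hj, hij, ε, hε, rfl⟩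
  · exact Or.inl ⟨_, hlt i hi, hc.refl_succ_chainSum hk hi⟩
  · refine Or.inr ⟨_, hlt i hi, _, hlt j hj, (Equiv.swap k (k + 1)).injective.ne hij, ε, hε, ?_⟩
    rw [map_sub, map_smul, hc.refl_succ_chainSum hk hi, hc.refl_succ_chainSum hk hj]

/-- With an additional coordinate vector equal to zero, all vectors are differences, and `refl (a
0)` acts on differences by transposing the zero vector and `y 0`. This is the symmetric group on one
more index. -/
lemma refl_zero_mem_of_one (hκ : κ = 1) {v : V} (hv : v ∈ coordVectors y n {1}) :
    refl (a 0) v ∈ nonzeroMultiples (coordVectors y n {1}) := by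
  have hrefl : ∀ i < n, i ≠ 0 → refl (a 0) (y i) = y i - y 0 := fun i hi h0 => by
    rw [hc.refl_zero_chainSum hi h0, hκ]; norm_num
  have hneg : ∀ u ∈ coordVectors y n {1}, -u ∈ nonzeroMultiples (coordVectors y n {1}) :=
    fun u hu => ⟨-1, by norm_num, u, hu, by simp⟩
  rcases hv with ⟨i, hi, rfl⟩ | ⟨i, hi, j, hj, hij, ε, rfl, rfl⟩
  · by_cases h0 : i = 0
    · rw [h0, hc.refl_zero_chainSum_zero]
      exact hneg _ (Or.inl ⟨0, by omega, rfl⟩)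
    · rw [hrefl i hi h0]
      exact subset_nonzeroMultiples _ (Or.inr ⟨i, hi, 0, by omega, h0, 1, rfl, by simp⟩)
  · rw [map_sub, map_smul, one_smul]
    by_cases h0 : i = 0
    · rw [h0, hc.refl_zero_chainSum_zero, hrefl j hj (by omega), neg_sub_left, sub_add_cancel]
      exact hneg _ (Or.inl ⟨j, hj, rfl⟩)
    · by_cases h1 : j = 0
      · rw [h1, hc.refl_zero_chainSum_zero, hrefl i hi h0, sub_neg_eq_add, sub_add_cancel]
        exact subset_nonzeroMultiples _ (Or.inl ⟨i, hi, rfl⟩)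
      · rw [hrefl i hi h0, hrefl j hj h1, sub_sub_sub_cancel_right]
        exact subset_nonzeroMultiples _ (Or.inr ⟨i, hi, j, hj, hij, 1, rfl, by simp⟩)

/-- By orthogonality the reflection only changes the sign of `y 0`, as in the hyperoctahedral group.
-/
lemma refl_zero_mem_of_sq_eq_two (hκ : κ ^ 2 = 2) {v : V} (hv : v ∈ coordVectors y n {1, -1}) :
    refl (a 0) v ∈ nonzeroMultiples (coordVectors y n {1, -1}) := by
  have hrefl : ∀ i < n, i ≠ 0 → refl (a 0) (y i) = y i := fun i hi h0 => by
    rw [hc.refl_zero_chainSum hi h0, hκ]; norm_num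
  have hneg : ∀ u ∈ coordVectors y n {1, -1}, -u ∈ nonzeroMultiples (coordVectors y n {1, -1}) :=
    fun u hu => ⟨-1, by norm_num, u, hu, by simp⟩
  have hU : ∀ ε ∈ ({1, -1} : Set ℝ), -ε ∈ ({1, -1} : Set ℝ) := by
    rintro ε (rfl | rfl) <;> simp
  rcases hv with ⟨i, hi, rfl⟩ | ⟨i, hi, j, hj, hij, ε, hε, rfl⟩
  · by_cases h0 : i = 0
    · rw [h0, hc.refl_zero_chainSum_zero]
      exact hneg _ (Or.inl ⟨0, by omega, rfl⟩)
    · rw [hrefl i hi h0]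
      exact subset_nonzeroMultiples _ (Or.inl ⟨i, hi, rfl⟩)
  · rw [map_sub, map_smul]
    by_cases h0 : i = 0
    · rw [h0, hc.refl_zero_chainSum_zero, hrefl j hj (by omega),
        show -y 0 - ε • y j = -(y 0 - -ε • y j) by rw [neg_smul]; abel]
      exact hneg _ (Or.inr ⟨0, by omega, j, hj, by omega, -ε, hU ε hε, rfl⟩)
    · rw [hrefl i hi h0]
      by_cases h1 : j = 0
      · rw [h1, hc.refl_zero_chainSum_zero, smul_neg, ← neg_smul]
        exact subset_nonzeroMultiples _ (Or.inr ⟨i, hi, 0, by omega, h0, -ε, hU ε hε, rfl⟩)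
      · rw [hrefl j hj h1]
        exact subset_nonzeroMultiples _ (Or.inr ⟨i, hi, j, hj, hij, ε, hε, rfl⟩)

/-- The multiples of the coordinate vectors contain the simple roots and are stable under simple
reflections, hence contain the whole orbit, which is all roots. -/
lemma roots_subset (h : IsRegularPoint W p) {U : Set ℝ} (hU : 1 ∈ U)
    (hzero : ∀ v ∈ coordVectors y n U, refl (a 0) v ∈ nonzeroMultiples (coordVectors y n U)) :
    roots W ⊆ nonzeroMultiples (coordVectors y n U) := by
  set P := nonzeroMultiples (coordVectors y n U)
  have hmem : ∀ k < n, a k ∈ P := by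
    rintro (_ | k) hk
    · exact subset_nonzeroMultiples _ (Or.inl ⟨0, hk, rfl⟩)
    · refine ⟨κ⁻¹, inv_ne_zero hc.ne_zero, y (k + 1) - y k,
        Or.inr ⟨k + 1, hk, k, by omega, by omega, 1, hU, by simp⟩, ?_⟩
      rw [chainSum, add_sub_cancel_left, smul_smul, inv_mul_cancel₀ hc.ne_zero, one_smul]
  have hrefl : ∀ k < n, ∀ v ∈ P, refl (a k) v ∈ P := by
    rintro (_ | k) hk v hv
    · exact map_mem_nonzeroMultiples _ hzero hv
    · exact map_mem_nonzeroMultiples _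
        (fun u hu => subset_nonzeroMultiples _ (hc.refl_succ_mem hk hu)) hv
  have hclosure : ∀ w ∈ Subgroup.closure (refl '' simpleRoots W p), ∀ v, w v ∈ P ↔ v ∈ P := by
    intro w hw
    induction hw using Subgroup.closure_induction with
    | mem w hw =>
      obtain ⟨b, hb, rfl⟩ := hw
      obtain ⟨k, hk, rfl⟩ := hc.exists_eq b hb
      refine fun v => ⟨fun hv => ?_, hrefl k hk v⟩
      have := hrefl k hk _ hv
      rwa [Submodule.reflection_reflection] at this
    | one => exact fun v => Iff.rfl
    | mul w w' _ _ h1 h2 => exact fun v => by rw [mul_map, h1, h2]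
    | inv w _ h1 => exact fun v => by rw [← h1, map_inv_map]
  intro b hb
  obtain ⟨w, hw, c, hcs, rfl⟩ := h.exists_map_simple hb
  obtain ⟨k, hk, rfl⟩ := hc.exists_eq c hcs
  exact (hclosure w hw _).2 (hmem k hk)

lemma eq_zero_of_inner_chainSum (h : IsRegularPoint W p) {v : V}
    (hv : ∀ i < n, ⟪y i, v⟫ = 0) : v = 0 := by
  refine h.eq_zero_of_simple fun b hb => ?_
  obtain ⟨k, hk, rfl⟩ := hc.exists_eq b hb
  cases k with
  | zero => exact hv 0 hk
  | succ k =>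
    have h1 := hv (k + 1) hk
    rw [chainSum, inner_add_left, inner_smul_left, hv k (by omega), zero_add] at h1
    exact (mul_eq_zero.1 h1).resolve_left hc.ne_zero

/-- The coordinates given by the partial sums of a chain of roots. -/
def coordEquiv (h : IsRegularPoint W p) : V ≃ₗ[ℝ] (Fin n → ℝ) :=
  LinearEquiv.ofInjectiveOfFinrankEq (LinearMap.pi fun i : Fin n => innerₗ V (y i))
    ((injective_iff_map_eq_zero _).2 fun v hv => hc.eq_zero_of_inner_chainSum h fun i hi =>
      congrFun hv ⟨i, hi⟩) (by rw [hc.finrank_eq, Module.finrank_fin_fun])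

/-- The parametrization of `V` by the coordinates of a chain of roots. -/
def coordParam (h : IsRegularPoint W p) {U : Set ℝ} (hU : 1 ∈ U) :
    CoordParam (fun i : Fin n => innerₗ V (y i)) U ⊤ (Fin n) where
  toFun := (hc.coordEquiv h).symm
  inj := (hc.coordEquiv h).symm.injective
  range_eq := LinearEquiv.range _
  form_eq j := Or.inr ⟨j, 1, hU, fun c => by
    rw [one_mul]; exact congrFun ((hc.coordEquiv h).apply_symm_apply c) j⟩
  exists_form t := ⟨t, 1, hU, fun c => by
    rw [one_mul]; exact congrFun ((hc.coordEquiv h).apply_symm_apply c) t⟩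

lemma rayCount_eq [Finite W] (h : IsRegularPoint W p) (hκ : κ = 1 ∨ κ ^ 2 = 2)
    {X Y : Submodule ℝ V} (hX : IsFlat (arrangement W) X) (hY : IsFlat (arrangement W) Y)
    (hXY : Module.finrank ℝ X = Module.finrank ℝ Y) :
    rayCount (arrangement W) X = rayCount (arrangement W) Y := by
  rcases hκ with hκ | hκ
  · have h1 : (1 : ℝ) ∈ ({1} : Set ℝ) := rfl
    refine rayCount_eq_of_finrank_eq (mem_arrangement_iff_coordForms
      (hc.roots_subset h h1 fun _ => hc.refl_zero_mem_of_one hκ) ?_) arrangement_finite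
      ⟨h1, ?_, ?_⟩ (hc.coordParam h h1) hX hY hXY
    · rintro v (⟨i, hi, rfl⟩ | ⟨i, hi, j, hj, hij, ε, rfl, rfl⟩)
      · exact subset_nonzeroMultiples _ (hc.chainSum_mem_roots hi)
      · rw [one_smul]
        exact hc.sub_mem_nonzeroMultiples hij hi hj
    · rintro ε rfl δ rfl; simp
    · rintro ε rfl; simp
  · have h1 : (1 : ℝ) ∈ ({1, -1} : Set ℝ) := Or.inl rfl
    refine rayCount_eq_of_finrank_eq (mem_arrangement_iff_coordForms
      (hc.roots_subset h h1 fun _ => hc.refl_zero_mem_of_sq_eq_two hκ) ?_) arrangement_finite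
      ⟨h1, ?_, ?_⟩ (hc.coordParam h h1) hX hY hXY
    · rintro v (⟨i, hi, rfl⟩ | ⟨i, hi, j, hj, hij, ε, rfl | rfl, rfl⟩)
      · exact subset_nonzeroMultiples _ (hc.chainSum_mem_roots hi)
      · rw [one_smul]
        exact hc.sub_mem_nonzeroMultiples hij hi hj
      · rw [neg_one_smul, sub_neg_eq_add]
        exact hc.add_mem_nonzeroMultiples hκ hij hi hj
    · rintro ε (rfl | rfl) δ (rfl | rfl) <;> simp
    · rintro ε (rfl | rfl) <;> simp

end

end IsRootChain

/-! ### The coincidental types -/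

variable [Finite W]

lemma IsRegularPoint.finrank_eq_of_equiv (h : IsRegularPoint W p) {n : ℕ}
    (e : Fin n ≃ simpleRoots W p) : Module.finrank ℝ V = n := by
  rw [h.finrank_eq, ← Fintype.card_congr e, Fintype.card_fin]

/-- The labelling is reversed: the exceptional edge of type B joins `n - 1` and `n - 2`, and the
chain must begin with it. The value `0` beyond `n` plays no role. -/
lemma isRootChain_of_equiv (h : IsRegularPoint W p) {n : ℕ} (e : Fin n ≃ simpleRoots W p) {κ : ℝ}
    (hκ : κ ≠ 0)
    (hzero : ∀ i j : Fin n, (i : ℕ) = n - 1 → (j : ℕ) = n - 2 → i ≠ j →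
      ⟪(e i : V), e j⟫ = -κ / 2)
    (hsucc : ∀ i j : Fin n, (j : ℕ) + 1 = i → (i : ℕ) + 1 < n →
      orderOf (simpleRefl (e i) * simpleRefl (e j)) = 3)
    (hne : ∀ i j : Fin n, (j : ℕ) + 1 < i →
      orderOf (simpleRefl (e i) * simpleRefl (e j)) = 2) :
    IsRootChain W p n κ fun k => if hk : k < n then e (Fin.rev ⟨k, hk⟩) else 0 where
  ne_zero := hκ
  finrank_eq := h.finrank_eq_of_equiv e
  mem k hk := by simp [hk]
  exists_eq b hb := by
    refine ⟨Fin.rev (e.symm ⟨b, hb⟩), Fin.is_lt _, ?_⟩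
    rw [dif_pos (Fin.is_lt _), Fin.eta, Fin.rev_rev, e.apply_symm_apply]
  inner_zero_one hn := by
    rw [dif_pos hn, dif_pos (by omega)]
    refine hzero _ _ ?_ ?_ fun e => ?_
    · simp
    · simp [Fin.val_rev]
    · have := congrArg Fin.val e
      simp only [Fin.val_rev] at this
      omega
  inner_succ k hk := by
    rw [dif_pos hk, dif_pos (by omega)]
    refine inner_eq_of_orderOf_three _ _ h (hsucc _ _ ?_ ?_) <;> simp only [Fin.val_rev] <;> omega
  inner_eq_zero k l hkl hl := by
    rw [dif_pos hl, dif_pos (by omega)]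
    refine inner_eq_of_orderOf_two _ _ (hne _ _ ?_)
    simp only [Fin.val_rev]
    omega

lemma rayCount_eq_of_type_A (h : IsRegularPoint W p) {n : ℕ}
    (hM : HasCoxeterType (simpleReflections W p) (CoxeterMatrix.A n)) {X Y : Submodule ℝ V}
    (hX : IsFlat (arrangement W) X) (hY : IsFlat (arrangement W) Y)
    (hXY : Module.finrank ℝ X = Module.finrank ℝ Y) :
    rayCount (arrangement W) X = rayCount (arrangement W) Y := by
  obtain ⟨e, he⟩ := exists_labelling hM
  have h3 : ∀ i j : Fin n, (j : ℕ) + 1 = i →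
      orderOf (simpleRefl (e i) * simpleRefl (e j)) = 3 := fun i j hij => by
    rw [he]
    have : i ≠ j := fun e => by rw [e] at hij; omega
    simp [CoxeterMatrix.A, this, hij]
  refine (isRootChain_of_equiv h e (κ := 1) one_ne_zero (fun i j hi hj hij => ?_)
    (fun i j hij _ => h3 i j hij) fun i j hij => ?_).rayCount_eq h (Or.inl rfl) hX hY hXY
  · refine inner_eq_of_orderOf_three _ _ h (h3 i j ?_)
    have := Fin.val_ne_of_ne hij
    omega
  · rw [he]
    have h1 : i ≠ j := fun e => by rw [e] at hij; omega
    have h2 : ¬ ((j : ℕ) + 1 = i ∨ (i : ℕ) + 1 = j) := by omega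
    simp [CoxeterMatrix.A, h1, h2]

lemma rayCount_eq_of_type_B (h : IsRegularPoint W p) {n : ℕ} (hn : 2 ≤ n)
    (hM : HasCoxeterType (simpleReflections W p) (CoxeterMatrix.B n)) {X Y : Submodule ℝ V}
    (hX : IsFlat (arrangement W) X) (hY : IsFlat (arrangement W) Y)
    (hXY : Module.finrank ℝ X = Module.finrank ℝ Y) :
    rayCount (arrangement W) X = rayCount (arrangement W) Y := by
  obtain ⟨e, he⟩ := exists_labelling hM
  let i₀ : Fin n := ⟨n - 1, by omega⟩
  let j₀ : Fin n := ⟨n - 2, by omega⟩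
  have hij₀ : i₀ ≠ j₀ := fun e => by have := congrArg Fin.val e; simp only [i₀, j₀] at this; omega
  have hsq : ⟪(e i₀ : V), e j₀⟫ ^ 2 = 1 / 2 := by
    refine inner_sq_of_orderOf_four _ _ ?_
    rw [he]
    simp [CoxeterMatrix.B, hij₀]
    simp [i₀, j₀]
  -- This `κ` makes the first inner product `-κ / 2` and has square `2`; its sign is not needed.
  refine (isRootChain_of_equiv h e (κ := -2 * ⟪(e i₀ : V), e j₀⟫) ?_ (fun i j hi hj hij => ?_)
    (fun i j hij hi => ?_) fun i j hij => ?_).rayCount_eq h (Or.inr ?_) hX hY hXY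
  · intro h0
    have : ⟪(e i₀ : V), e j₀⟫ = 0 := by linarith
    rw [this] at hsq
    norm_num at hsq
  · rw [show i = i₀ from Fin.ext hi, show j = j₀ from Fin.ext hj]
    ring
  · rw [he]
    have h1 : i ≠ j := fun e => by rw [e] at hij; omega
    have h2 : ¬ ((i : ℕ) = n - 1 ∧ (j : ℕ) = n - 2 ∨ (j : ℕ) = n - 1 ∧ (i : ℕ) = n - 2) := by omega
    simp [CoxeterMatrix.B, h1, h2, hij]
  · rw [he]
    have h1 : i ≠ j := fun e => by rw [e] at hij; omega
    have h2 : ¬ ((i : ℕ) = n - 1 ∧ (j : ℕ) = n - 2 ∨ (j : ℕ) = n - 1 ∧ (i : ℕ) = n - 2) := by omega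
    have h3 : ¬ ((j : ℕ) + 1 = i ∨ (i : ℕ) + 1 = j) := by omega
    simp [CoxeterMatrix.B, h1, h2, h3]
  · linarith [mul_pow (-2) ⟪(e i₀ : V), e j₀⟫ 2]

/-- Both edges of the diagram have odd labels, `3` and `5`. -/
lemma isConj_simpleRefl_of_type_H₃ {e : Fin 3 ≃ simpleRoots W p}
    (he : ∀ i j, orderOf (simpleRefl (e i) * simpleRefl (e j)) = CoxeterMatrix.H₃ i j)
    (a b : simpleRoots W p) : IsConj (simpleRefl a) (simpleRefl b) := by
  have h01 : IsConj (simpleRefl (e 0)) (simpleRefl (e 1)) :=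
    isConj_of_odd_orderOf (k := 1) (simpleRefl_mul_self _) (simpleRefl_mul_self _)
      ((he 0 1).trans rfl)
  have h12 : IsConj (simpleRefl (e 1)) (simpleRefl (e 2)) :=
    isConj_of_odd_orderOf (k := 2) (simpleRefl_mul_self _) (simpleRefl_mul_self _)
      ((he 1 2).trans rfl)
  have key : ∀ i, IsConj (simpleRefl (e 1)) (simpleRefl (e i)) := by
    intro i
    fin_cases i
    exacts [h01.symm, IsConj.refl _, h12]
  have := (key (e.symm a)).symm.trans (key (e.symm b))
  rwa [e.apply_symm_apply, e.apply_symm_apply] at this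

/-- For a coincidental group, the number of rays in a flat depends only on its dimension. -/
theorem rayCount_eq_of_isCoincidentalType (h : IsRegularPoint W p)
    (hM : IsCoincidentalType (simpleReflections W p)) {X Y : Submodule ℝ V}
    (hX : IsFlat (arrangement W) X) (hY : IsFlat (arrangement W) Y)
    (hXY : Module.finrank ℝ X = Module.finrank ℝ Y) :
    rayCount (arrangement W) X = rayCount (arrangement W) Y := by
  rcases hM with ⟨n, -, hM⟩ | ⟨n, hn, hM⟩ | hM | ⟨k, -, hM⟩
  · exact rayCount_eq_of_type_A h hM hX hY hXY
  · exact rayCount_eq_of_type_B h hn hM hX hY hXY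
  · obtain ⟨e, he⟩ := exists_labelling hM
    exact h.rayCount_eq_of_finrank_le_three (h.finrank_eq_of_equiv e).le
      (fun _ => isConj_simpleRefl_of_type_H₃ he) hX hY hXY
  · obtain ⟨e, -⟩ := exists_labelling hM
    have hr := h.finrank_eq_of_equiv e
    -- The rank is two, so the conjugacy condition for rank three is vacuous.
    exact h.rayCount_eq_of_finrank_le_three (by omega) (by omega) hX hY hXY

end ReflectionGroup
end

/-! ### The theorem -/

theorem proposition4p1
    {V : Type*} [NormedAddCommGroup V] [InnerProductSpace ℝ V] [FiniteDimensional ℝ V]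
    (W : Subgroup (V ≃ₗᵢ[ℝ] V)) [Fintype W]
    (hW : ReflectionGroup.IsReflectionGroup W) (hess : ReflectionGroup.IsEssential W)
    (C : Set V) (hC : Arrangement.IsChamber (ReflectionGroup.arrangement W) C)
    (S : Set W) (hS : S = ReflectionGroup.coxeterGenerators W C) :
    (IsRealSemisimple (LinearMap.mulLeft ℝ (barrElement S)) ∧
      IsRealSemisimple (LinearMap.mulRight ℝ (barrElement S))) ∧
    (IsCoincidentalType S →
      ∃ σ : Fin (Module.finrank ℝ V + 1) → ℕ,
        StrictMono σ ∧
        (∀ μ : ℝ, Module.End.HasEigenvalue (LinearMap.mulLeft ℝ (barrElement S)) μ ↔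
          ∃ k, μ = (σ k : ℝ)) ∧
        (∀ μ : ℝ, Module.End.HasEigenvalue (LinearMap.mulRight ℝ (barrElement S)) μ ↔
          ∃ k, μ = (σ k : ℝ)) ∧
        (∀ (k : Fin (Module.finrank ℝ V + 1)) (X : Submodule ℝ V),
          Arrangement.IsFlat (ReflectionGroup.arrangement W) X → Module.finrank ℝ X = k →
            Arrangement.numRays
              (Arrangement.restriction (ReflectionGroup.arrangement W) X) = σ k)) := by
  obtain ⟨p, h, hCp⟩ := ReflectionGroup.exists_isRegularPoint hW hess hC
  rw [h.coxeterGenerators_eq hC.1 hCp] at hS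
  subst hS
  refine ⟨h.isRealSemisimple_barrElement, fun hM => ?_⟩
  obtain ⟨σ, hσ, hleft, hright, hrays⟩ := h.exists_eigenvalues fun X Y =>
    ReflectionGroup.rayCount_eq_of_isCoincidentalType h hM
  refine ⟨σ, hσ, hleft, hright, fun k X hX hk => ?_⟩
  rw [Arrangement.numRays_restriction
    (fun H => ReflectionGroup.exists_ker_eq_of_mem_arrangement) hess hX]
  exact hrays k X hX hk
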